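/- **Setting.** Let $n,m,t\ge 0$, $N=2^n$, and identify $[N]$ with $\{0,1\}^n$. Let $\mathsf A$ be an $n$-qubit and $\mathsf B$ an $m$-qubit register. A $t$-query two-oracle adversary $\mathcal A$ consists of unitaries $A^{(1)},\dots,A^{(t)}$ on $\mathsf{AB}$ and indices $q_1,\dots,q_t\in\{1,2\}$. For oracles $\mathcal O_1,\mathcal O_2$ acting on $\mathsf A$ (and possibly on a further register $\mathsf E$), its view is $$|\mathcal A_t^{\mathcal O_1,\mathcal O_2}\rangle=(\mathcal O_{q_t}A^{(t)})\cdots(\mathcal O_{q_1}A^{(1)})\,|0\rangle_{\mathsf{AB}}$$ (tensored with the initial state of $\mathsf E$). Let $\mathsf{TD}(\rho,\sigma)=\frac12\|\rho-\sigma\|_1$ be the trace distance. An *injective relation* is a finite set $R=\{(x_1,y_1),\dots,(x_k,y_k)\}\subseteq\{0,1\}^n\times\{0,1\}^n$ with $y_1,\dots,y_k$ pairwise distinct; $\mathrm{Im}(R)=\{y_1,\dots,y_k\}$. Its relation state is $|R\rangle=\frac1{\sqrt{k!}}\sum_{\pi\in \mathsf{Sym}_k}|x_{\pi(1)},\dots,x_{\pi(k)}\rangle\otimes|y_{\pi(1)},\dots,y_{\pi(k)}\rangle$,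 in a recording register $\mathsf E_1$ or $\mathsf E_2$ with state space $\bigoplus_{k\le N}(\mathbb C^N\otimes\mathbb C^N)^{\otimes k}$. Both recording registers start in $|\emptyset\rangle$. All maps below are extended by zero to the orthogonal complement of the span of the listed states. * *Independent path-recording oracles*: $\mathsf{PR}_{\mathsf{AE}_j}$ $(j=1,2)$ acts on $\mathsf{AE}_j$ by $|x\rangle|R\rangle\mapsto\frac1{\sqrt{N-|R|}}\sum_{y\notin \mathrm{Im}(R)}|y\rangle|R\cup\{(x,y)\}\rangle$ for $R$ injective with $|R|<N$, and as the identity on the other recording register. * Let $0\le\lambda\le n$ and $\ell\ge1$. A set $S\subseteq\{0,1\}^n$ is *strong $\ell$-fold $\lambda$-prefix collision-free* if for every $i\le\ell$ and all $S_1,S_2\subseteq S$ of size $i$, $\bigoplus_{x\in S_1}x_{[1:\lambda]}=\bigoplus_{y\in S_2}y_{[1:\lambda]}$ if and only if $S_1=S_2$. Let $\mathsf{CF}_{\ell,\lambda}(S)$ be the set of $y\in\{0,1\}^n\setminus S$ such that $S\cup\{y\}$ is strong $\ell$-fold $\lambda$-prefix collision-free. A relation is collision-free if it is injective and its image is a strong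 $\ell$-fold $\lambda$-prefix collision-free set. * *Collision-free path-recording oracles with shared image constraint*: for $R_1,R_2$ disjoint, with $R_1$, $R_2$, $R_1\cup R_2$ collision-free and $|R_1\cup R_2|<2^n$, put $Y=\mathsf{CF}_{\ell,\lambda}(\mathrm{Im}(R_1\cup R_2))$. Then $\mathsf{cfPR}^{(\mathsf E_1)}$ maps $|x\rangle_{\mathsf A}|R_1\rangle_{\mathsf E_1}|R_2\rangle_{\mathsf E_2}\mapsto\frac1{\sqrt{|Y|}}\sum_{y\in Y}|y\rangle|R_1\cup\{(x,y)\}\rangle|R_2\rangle$ (to $0$ if $Y=\emptyset$), and $\mathsf{cfPR}^{(\mathsf E_2)}$ is defined in the same way with $(x,y)$ added to $R_2$. * *Collision-free path-recording oracles* $\mathsf{PR}^{(\mathsf E_1)},\mathsf{PR}^{(\mathsf E_2)}$: the same formulas for $R_1,R_2$ disjoint, with $R_1,R_2,R_1\cup R_2$ injective, $|R_1\cup R_2|<2^n$, $Y=\{0,1\}^n\setminus\mathrm{Im}(R_1\cup R_2)$ and normalization $1/\sqrt{N-|\mathrm{Im}(R_1\cup R_2)|}$. Put $\rho_{\mathsf{cf}}=\mathrm{Tr}_{\mathsf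 E_1\mathsf E_2}|\mathcal A_t^{\mathsf{cfPR}^{(\mathsf E_1)},\mathsf{cfPR}^{(\mathsf E_2)}}\rangle\langle\cdot|$, $\rho_{\mathsf{PR}}=\mathrm{Tr}_{\mathsf E_1\mathsf E_2}|\mathcal A_t^{\mathsf{PR}_{\mathsf{AE}_1},\mathsf{PR}_{\mathsf{AE}_2}}\rangle\langle\cdot|$, $\rho_{\mathsf{sh}}=\mathrm{Tr}_{\mathsf E_1\mathsf E_2}|\mathcal A_t^{\mathsf{PR}^{(\mathsf E_1)},\mathsf{PR}^{(\mathsf E_2)}}\rangle\langle\cdot|$ and $\rho_{\mathrm{Haar}}=\mathbb E_{U,V}|\mathcal A_t^{U,V}\rangle\langle\mathcal A_t^{U,V}|$ with $U,V$ independent Haar-random $n$-qubit unitaries. **Theorem.** There are absolute constants $C,C',C''>0$ such that for all $n,m,t\ge0$, all $0\le\lambda\le n$, all $\ell\ge1$, and every $t$-query two-oracle adversary $\mathcal A$: 1. $\mathsf{TD}(\rho_{\mathsf{cf}},\rho_{\mathsf{PR}})\le C\,\dfrac{\sqrt{\ell}\,t^{\ell+1}}{2^{\lambda/2}}$; 2.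 $\mathsf{TD}(\rho_{\mathsf{cf}},\rho_{\mathrm{Haar}})\le C'\,\dfrac{\sqrt{\ell}\,t^{\ell+1}}{2^{\lambda/2}}+\dfrac{4t(t-1)}{N+1}$; 3. for $\ell=1$, $\lambda=n$ the oracles $\mathsf{cfPR}^{(\mathsf E_j)}$ are equal to $\mathsf{PR}^{(\mathsf E_j)}$ $(j=1,2)$, and $\mathsf{TD}(\rho_{\mathsf{sh}},\rho_{\mathrm{Haar}})\le C''\,\dfrac{t^2}{\sqrt N}$. -/

import Mathlib

open scoped BigOperators Matrix Nat

noncomputable section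

namespace PathRec

/-! ### Registers, states, trace distance -/

/-- Bit strings of length `n`; addition is bitwise XOR. The query register `A` has
computational basis `BitString n`, so that its dimension is `N = 2 ^ n`. -/
abbrev BitString (n : ℕ) : Type := Fin n → ZMod 2

/-- The computational basis vector `|x⟩`. -/
def basisKet {n : ℕ} (x : BitString n) : BitString n → ℂ := Pi.single x 1

/-- The trace norm `Tr √(X† X)`. -/
def traceNorm {ι : Type} [Fintype ι] [DecidableEq ι] (X : Matrix ι ι ℂ) : ℝ :=
  ((Matrix.isHermitian_conjTranspose_mul_self X).cfc Real.sqrt).trace.re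

/-- The trace distance `½ ‖ρ - σ‖₁`. -/
def traceDist {ι : Type} [Fintype ι] [DecidableEq ι] (ρ σ : Matrix ι ι ℂ) : ℝ :=
  traceNorm (ρ - σ) / 2

/-- Partial trace over the register `E` of the rank-one operator `|ψ⟩⟨ψ|`. -/
def reducedState {ι E : Type} [Fintype E] (ψ : ι × E → ℂ) : Matrix ι ι ℂ :=
  Matrix.of fun i j => ∑ e, ψ (i, e) * star (ψ (j, e))

/-! ### Adversaries with access to two oracles -/

/-- A `t`-query two-oracle adversary, with an `n`-qubit query register `A` and an `m`-qubit
ancillary register `B`: the `i`-th query goes to the oracle with index `query i`, and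
`unitary i` is applied to `AB` right before that query. -/
structure Adversary (n m t : ℕ) where
  query : Fin t → Fin 2
  unitary : Fin t → Matrix.unitaryGroup (BitString n × BitString m) ℂ

/-- A unitary on `AB`, applied to a state on `ABE` (identity on `E`). -/
def applyLocal {n m : ℕ} {E : Type}
    (U : Matrix (BitString n × BitString m) (BitString n × BitString m) ℂ)
    (ψ : (BitString n × BitString m) × E → ℂ) : (BitString n × BitString m) × E → ℂ :=
  fun p => ∑ q, U p.1 q * ψ (q, p.2)

/-- An operator on `AE`, applied to a state on `ABE` (identity on `B`). -/
def applyOracle {n m : ℕ} {E : Type} [Fintype E]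
    (O : Matrix (BitString n × E) (BitString n × E) ℂ)
    (ψ : (BitString n × BitString m) × E → ℂ) : (BitString n × BitString m) × E → ℂ :=
  fun p => ∑ q, O (p.1.1, p.2) q * ψ ((q.1, p.1.2), q.2)

/-- The view of the adversary after all its queries,
`∏ᵢ (O⁽ⁱ⁾ A⁽ⁱ⁾) |0⟩_{AB} |init⟩_E`, for two oracles `O 0`, `O 1` acting on `AE`. -/
def Adversary.view {n m t : ℕ} (𝒜 : Adversary n m t) {E : Type} [Fintype E]
    (O : Fin 2 → Matrix (BitString n × E) (BitString n × E) ℂ) (init : E → ℂ) :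
    (BitString n × BitString m) × E → ℂ :=
  Fin.foldl t
    (fun ψ i => applyOracle (O (𝒜.query i)) (applyLocal (𝒜.unitary i).1 ψ))
    (fun p => if p.1 = 0 then init p.2 else 0)

/-! ### Relation states -/

/-- A relation on `{0,1}ⁿ × {0,1}ⁿ` without repeated pairs. -/
abbrev Rel (n : ℕ) : Type := Finset (BitString n × BitString n)

/-- The image of a relation. -/
def im {n : ℕ} (R : Rel n) : Finset (BitString n) := R.image Prod.snd

/-- A relation is injective if distinct pairs have distinct second components. -/
def IsInj {n : ℕ} (R : Rel n) : Prop := Set.InjOn Prod.snd (R : Set (BitString n × BitString n))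

/-- Computational basis of a recording register `E`: sequences of at most `N` pairs, that is
`E = ⨁_{k ≤ N} (ℂ^N ⊗ ℂ^N)^{⊗ k}`. -/
abbrev RecIdx (n : ℕ) : Type := Σ k : Fin (2 ^ n + 1), (Fin k → BitString n × BitString n)

/-- The relation state `|R⟩`: the uniform superposition, with amplitude `1 / √(k!)`, of the `k!`
orderings of the `k` (pairwise distinct) pairs of `R`. -/
def relKet {n : ℕ} (R : Rel n) : RecIdx n → ℂ := fun s =>
  if Finset.univ.val.map s.2 = R.val then ((Real.sqrt (R.card ! : ℝ) : ℝ) : ℂ)⁻¹ else 0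

/-! ### Path-recording operators -/

open Classical in
/-- The path-recording map on `AE`,
`|x⟩|R⟩ ↦ (N - |R|)^{-1/2} ∑_{y ∉ Im R} |y⟩|R ∪ {(x,y)}⟩` for injective `R` with `|R| < N`
(and zero on the orthogonal complement of the span of these states). -/
def pr (n : ℕ) : Matrix (BitString n × RecIdx n) (BitString n × RecIdx n) ℂ :=
  ∑ x : BitString n, ∑ R : Rel n with IsInj R ∧ R.card < 2 ^ n,
    Matrix.vecMulVec
      (((Real.sqrt ((2 : ℝ) ^ n - R.card) : ℝ) : ℂ)⁻¹ •
        ∑ y ∈ Finset.univ \ im R,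
          fun p : BitString n × RecIdx n => basisKet y p.1 * relKet (insert (x, y) R) p.2)
      (star fun p : BitString n × RecIdx n => basisKet x p.1 * relKet R p.2)

/-- Two independent path-recording oracles on `A E₁ E₂`: oracle `0` is the path-recording map on
`A E₁` and oracle `1` is the path-recording map on `A E₂`. -/
def prOracle (n : ℕ) (j : Fin 2) :
    Matrix (BitString n × (RecIdx n × RecIdx n)) (BitString n × (RecIdx n × RecIdx n)) ℂ :=
  Matrix.of fun p q =>
    if j = 0 then pr n (p.1, p.2.1) (q.1, q.2.1) * (if p.2.2 = q.2.2 then 1 else 0)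
    else pr n (p.1, p.2.2) (q.1, q.2.2) * (if p.2.1 = q.2.1 then 1 else 0)

/-- The vector `|x⟩_A |R₁⟩_{E₁} |R₂⟩_{E₂}`. -/
def ket {n : ℕ} (x : BitString n) (R₁ R₂ : Rel n) :
    BitString n × (RecIdx n × RecIdx n) → ℂ :=
  fun p => basisKet x p.1 * relKet R₁ p.2.1 * relKet R₂ p.2.2

/-- The first `lam` bits of a bit string. -/
def takeBits {n : ℕ} (lam : ℕ) (x : BitString n) : {j : Fin n // (j : ℕ) < lam} → ZMod 2 :=
  fun j => x j

/-- Strong `ℓ`-fold `lam`-prefix collision-free sets. -/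
def StrongCF {n : ℕ} (ℓ lam : ℕ) (S : Finset (BitString n)) : Prop :=
  ∀ i ≤ ℓ, ∀ S₁ ⊆ S, ∀ S₂ ⊆ S, S₁.card = i → S₂.card = i →
    (∑ x ∈ S₁, takeBits lam x = ∑ y ∈ S₂, takeBits lam y ↔ S₁ = S₂)

open Classical in
/-- The new outputs `y` (not already in `S`) that keep `S ∪ {y}` collision-free. -/
def CF {n : ℕ} (ℓ lam : ℕ) (S : Finset (BitString n)) : Finset (BitString n) :=
  Finset.univ.filter fun y => y ∉ S ∧ StrongCF ℓ lam (insert y S)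

/-- Strong `ℓ`-fold `lam`-prefix collision-free relations (they are injective, and their image is
collision-free). -/
def IsCFRel {n : ℕ} (ℓ lam : ℕ) (R : Rel n) : Prop := IsInj R ∧ StrongCF ℓ lam (im R)

/-- `R_j ∪ {(x, y)}` for the pair of relations `(R₁, R₂)`: the pair `(x, y)` is recorded in
`E₁` if `j = 0` and in `E₂` if `j = 1`. -/
def record {n : ℕ} (j : Fin 2) (x : BitString n) (R₁ R₂ : Rel n) (y : BitString n) :
    BitString n × (RecIdx n × RecIdx n) → ℂ :=
  if j = 0 then ket y (insert (x, y) R₁) R₂ else ket y R₁ (insert (x, y) R₂)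

open Classical in
/-- The two strong `ℓ`-fold `lam`-prefix collision-free path-recording oracles (`j = 0, 1`) on
`A E₁ E₂`; both are constrained by the joint image `Im (R₁ ∪ R₂)`. -/
def cfprOracle (n ℓ lam : ℕ) (j : Fin 2) :
    Matrix (BitString n × (RecIdx n × RecIdx n)) (BitString n × (RecIdx n × RecIdx n)) ℂ :=
  ∑ x : BitString n, ∑ R : Rel n × Rel n with
      IsCFRel ℓ lam R.1 ∧ IsCFRel ℓ lam R.2 ∧ IsCFRel ℓ lam (R.1 ∪ R.2) ∧
        Disjoint R.1 R.2 ∧ (R.1 ∪ R.2).card < 2 ^ n,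
    Matrix.vecMulVec
      (((Real.sqrt ((CF ℓ lam (im (R.1 ∪ R.2))).card : ℝ) : ℝ) : ℂ)⁻¹ •
        ∑ y ∈ CF ℓ lam (im (R.1 ∪ R.2)), record j x R.1 R.2 y)
      (star (ket x R.1 R.2))

open Classical in
/-- The two collision-free path-recording oracles (`j = 0, 1`) on `A E₁ E₂` that share the
constraint that the new output avoids the joint image `Im (R₁ ∪ R₂)`. -/
def sharedPrOracle (n : ℕ) (j : Fin 2) :
    Matrix (BitString n × (RecIdx n × RecIdx n)) (BitString n × (RecIdx n × RecIdx n)) ℂ :=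
  ∑ x : BitString n, ∑ R : Rel n × Rel n with
      IsInj R.1 ∧ IsInj R.2 ∧ IsInj (R.1 ∪ R.2) ∧
        Disjoint R.1 R.2 ∧ (R.1 ∪ R.2).card < 2 ^ n,
    Matrix.vecMulVec
      (((Real.sqrt ((2 : ℝ) ^ n - (im (R.1 ∪ R.2)).card) : ℝ) : ℂ)⁻¹ •
        ∑ y ∈ Finset.univ \ im (R.1 ∪ R.2), record j x R.1 R.2 y)
      (star (ket x R.1 R.2))

/-- The reduced state on `AB` of an adversary with two oracles recording in `E₁ E₂`, where both
recording registers start in the state `|∅⟩` of the empty relation. -/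
def Adversary.recState {n m t : ℕ} (𝒜 : Adversary n m t)
    (O : Fin 2 →
      Matrix (BitString n × (RecIdx n × RecIdx n)) (BitString n × (RecIdx n × RecIdx n)) ℂ) :
    Matrix (BitString n × BitString m) (BitString n × BitString m) ℂ :=
  reducedState (𝒜.view O fun e => relKet ∅ e.1 * relKet ∅ e.2)

/-! ### Haar-random unitaries -/

instance compactSpace_unitaryGroup {ι : Type} [Fintype ι] [DecidableEq ι] :
    CompactSpace (Matrix.unitaryGroup ι ℂ) := by
  refine isCompact_iff_compactSpace.mp (?_ : IsCompact (Matrix.unitaryGroup ι ℂ : Set (Matrix ι ι ℂ)))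
  have hK : IsCompact (Set.pi Set.univ fun _ : ι => Set.pi Set.univ fun _ : ι =>
      Metric.closedBall (0 : ℂ) 1) :=
    isCompact_univ_pi fun _ => isCompact_univ_pi fun _ => isCompact_closedBall 0 1
  refine hK.of_isClosed_subset ?_ ?_
  · exact isClosed_unitary (R := Matrix ι ι ℂ)
  · intro U hU i _ j _
    simpa using entry_norm_bound_of_unitary hU i j

instance measurableSpace_unitaryGroup {ι : Type} [Fintype ι] [DecidableEq ι] :
    MeasurableSpace (Matrix.unitaryGroup ι ℂ) := borel _

instance borelSpace_unitaryGroup {ι : Type} [Fintype ι] [DecidableEq ι] :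
    BorelSpace (Matrix.unitaryGroup ι ℂ) := ⟨rfl⟩

/-- The Haar probability measure on the `n`-qubit unitary group. -/
def haar (n : ℕ) : MeasureTheory.Measure (Matrix.unitaryGroup (BitString n) ℂ) :=
  MeasureTheory.Measure.haarMeasure ⊤

/-- Two unitary oracles on `A` (the register `E` is trivial). -/
def unitaryOracle {n : ℕ} (U V : Matrix.unitaryGroup (BitString n) ℂ) (j : Fin 2) :
    Matrix (BitString n × Unit) (BitString n × Unit) ℂ :=
  Matrix.of fun p q => if j = 0 then U.1 p.1 q.1 else V.1 p.1 q.1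

/-- The averaged state `𝔼_{U,V} |𝒜^{U,V}⟩⟨𝒜^{U,V}|` for independent Haar-random `U`, `V`. -/
def Adversary.haarState {n m t : ℕ} (𝒜 : Adversary n m t) :
    Matrix (BitString n × BitString m) (BitString n × BitString m) ℂ :=
  Matrix.of fun i j =>
    ∫ W, reducedState (𝒜.view (unitaryOracle W.1 W.2) fun _ => 1) i j ∂((haar n).prod (haar n))

end PathRec

end

/-
Writing a pair of injective relations as a partial function from outputs to inputs turns both kinds
of path-recording oracles into maps of the same form: a new output is recorded with an amplitude
that depends only on the previous record and the output. If an output completes a prefix collision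
with a collision-free record of size `k`, its prefix is the sum of the prefixes of fewer than `ℓ`
and of at most `ℓ` recorded outputs, so there are at most `ℓ k^{2ℓ - 1} N / 2^λ` such outputs. The
amplitudes of collision-free and independent path recording therefore differ by
`O(√ℓ t^ℓ / 2^{λ/2})` in norm at each query.

For the Haar measure, a change of the queried inputs by a unitary can be moved to the recording
registers, so it leaves the reduced state of independent path recording unchanged, and averages
over the Haar measure absorb it by translation. It therefore suffices to compare path recording
with randomly signed permutations composed with a randomly phased Hadamard transform. In the
Fourier basis of the signs, the part of the signed-permutation view where all `t` queried inputs are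
distinct, averaged over the permutations, is path recording restricted to records that are also
injective in the inputs; since both states have trace one, the rest has the weight of the other
records. After the random twirl two given recorded inputs agree with probability at most `2 / N`, so
this weight is `O(t² / N)`.
-/

namespace PathRec

noncomputable section

/-! ### Iterated maps -/

lemma foldl_rel {α β : Type*} (P : ℕ → α → β → Prop) :
    ∀ (t : ℕ) (f : α → Fin t → α) (g : β → Fin t → β) (a : α) (b : β), P 0 a b →
      (∀ (i : Fin t) (a : α) (b : β), P i a b → P (i + 1) (f a i) (g b i)) →
      P t (Fin.foldl t f a) (Fin.foldl t g b)
  | 0, _, _, _, _, h0, _ => by simpa only [Fin.foldl_zero] using h0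
  | t + 1, f, g, a, b, h0, hs => by
    rw [Fin.foldl_succ_last, Fin.foldl_succ_last]
    exact hs (Fin.last t) _ _ <|
      foldl_rel P t _ _ a b h0 fun i a b h => hs i.castSucc a b h

lemma foldl_induction {α : Type*} (P : ℕ → α → Prop) (t : ℕ) (f : α → Fin t → α) (a : α)
    (h0 : P 0 a) (hs : ∀ (i : Fin t) (a : α), P i a → P (i + 1) (f a i)) :
    P t (Fin.foldl t f a) :=
  foldl_rel (fun i a (_ : α) => P i a) t f f a a h0 fun i a _ h => hs i a h

/-! ### The Euclidean norm -/

/-- The Euclidean norm of a state vector. State vectors are plain functions, whose own norm in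
Mathlib is the supremum norm. -/
def l2 {α : Type*} [Fintype α] (ψ : α → ℂ) : ℝ :=
  ‖(WithLp.toLp 2 ψ : EuclideanSpace ℂ α)‖

section
variable {α : Type*} [Fintype α]

lemma l2_nonneg (ψ : α → ℂ) : 0 ≤ l2 ψ := norm_nonneg _

lemma l2_sq (ψ : α → ℂ) : l2 ψ ^ 2 = ∑ a, ‖ψ a‖ ^ 2 := by
  simp [l2, EuclideanSpace.norm_sq_eq]

lemma l2_add_le (ψ χ : α → ℂ) : l2 (ψ + χ) ≤ l2 ψ + l2 χ := by
  simpa [l2] using norm_add_le (WithLp.toLp 2 ψ : EuclideanSpace ℂ α) (WithLp.toLp 2 χ)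

lemma l2_sub_le (ψ χ : α → ℂ) : l2 (ψ - χ) ≤ l2 ψ + l2 χ := by
  simpa [l2] using norm_sub_le (WithLp.toLp 2 ψ : EuclideanSpace ℂ α) (WithLp.toLp 2 χ)

lemma norm_sum_star_mul_le (χ ψ : α → ℂ) : ‖∑ a, star (χ a) * ψ a‖ ≤ l2 χ * l2 ψ := by
  have := norm_inner_le_norm (𝕜 := ℂ) (WithLp.toLp 2 χ : EuclideanSpace ℂ α) (WithLp.toLp 2 ψ)
  simpa [l2, PiLp.inner_apply, mul_comm] using this

lemma ofReal_sum_norm_sq (v : α → ℂ) : ((∑ a, ‖v a‖ ^ 2 : ℝ) : ℂ) = star v ⬝ᵥ v := by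
  simp only [dotProduct, Pi.star_apply, Complex.ofReal_sum, Complex.ofReal_pow]
  exact Finset.sum_congr rfl fun a _ => (Complex.conj_mul' _).symm

lemma sum_norm_sq_mulVec [DecidableEq α] {M : Matrix α α ℂ} (hM : M ∈ Matrix.unitaryGroup α ℂ)
    (v : α → ℂ) : ∑ a, ‖(M *ᵥ v) a‖ ^ 2 = ∑ a, ‖v a‖ ^ 2 := by
  have hMM : Mᴴ * M = 1 := Matrix.mem_unitaryGroup_iff'.1 hM
  rw [← Complex.ofReal_inj, ofReal_sum_norm_sq, ofReal_sum_norm_sq, Matrix.star_mulVec,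
    ← Matrix.dotProduct_mulVec, Matrix.mulVec_mulVec, hMM, Matrix.one_mulVec]

end

/-! ### The trace distance of reduced states -/

section
variable {ι : Type} [Fintype ι] [DecidableEq ι]

lemma traceNorm_eq_trace_cfc_abs {X : Matrix ι ι ℂ} (hX : X.IsHermitian) :
    traceNorm X = (cfc (fun x : ℝ => |x|) X).trace.re := by
  have hsa : IsSelfAdjoint X := hX
  have hsq : Xᴴ * X = cfc (fun x : ℝ => x ^ 2) X := by
    rw [cfc_pow_id (R := ℝ) X 2, hX.eq, sq]
  rw [traceNorm, ← Matrix.IsHermitian.cfc_eq, hsq, ← cfc_comp Real.sqrt (fun x : ℝ => x ^ 2) X hsa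
    Real.continuous_sqrt.continuousOn (Matrix.finite_real_spectrum.continuousOn _)]
  simp only [Function.comp_def, Real.sqrt_sq_eq_abs]

/- The unitary is the sign of `X`, with the sign of `0` chosen to be `1`. -/
lemma exists_unitary_traceNorm_eq {X : Matrix ι ι ℂ} (hX : X.IsHermitian) :
    ∃ W ∈ Matrix.unitaryGroup ι ℂ, traceNorm X = (W * X).trace.re := by
  have hsa : IsSelfAdjoint X := hX
  have hcont (f : ℝ → ℝ) : ContinuousOn f (spectrum ℝ X) :=
    Matrix.finite_real_spectrum.continuousOn f
  let sgn : ℝ → ℝ := fun x => if 0 ≤ x then 1 else -1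
  have hsgn_sq : (fun x => sgn x * sgn x) = fun _ => 1 := by
    funext x
    by_cases hx : 0 ≤ x <;> simp [sgn, hx]
  have hsgn_mul : (fun x => sgn x * x) = fun x => |x| := by
    funext x
    by_cases hx : 0 ≤ x
    · simp [sgn, hx, abs_of_nonneg hx]
    · simp [sgn, hx, abs_of_neg (not_le.1 hx)]
  refine ⟨cfc sgn X, ?_, ?_⟩
  · have hstar : star (cfc sgn X) = cfc sgn X := (cfc_predicate sgn X : IsSelfAdjoint _)
    rw [Matrix.mem_unitaryGroup_iff, hstar, ← cfc_mul sgn sgn X (hcont _) (hcont _), hsgn_sq,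
      cfc_const_one ℝ X]
  · have hmul : cfc sgn X * X = cfc (fun x => sgn x * x) X := by
      rw [cfc_mul sgn (fun x => x) X (hcont _) (hcont _), cfc_id' ℝ X]
    rw [traceNorm_eq_trace_cfc_abs hX, hmul, hsgn_mul]

lemma traceDist_le {ρ σ : Matrix ι ι ℂ} (hρ : ρ.IsHermitian) (hσ : σ.IsHermitian) {c : ℝ}
    (h : ∀ W ∈ Matrix.unitaryGroup ι ℂ, ‖(W * ρ).trace - (W * σ).trace‖ ≤ 2 * c) :
    traceDist ρ σ ≤ c := by
  obtain ⟨W, hW, hWX⟩ := exists_unitary_traceNorm_eq (hρ.sub hσ)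
  have hre := (Complex.re_le_norm _).trans (h W hW)
  rw [← Matrix.trace_sub, ← mul_sub] at hre
  rw [traceDist, hWX]
  linarith

end

lemma isHermitian_reducedState {ι E : Type} [Fintype E] (ψ : ι × E → ℂ) :
    (reducedState ψ).IsHermitian := by
  ext i j
  simp only [Matrix.conjTranspose_apply, reducedState, Matrix.of_apply, star_sum, star_mul',
    star_star]
  exact Finset.sum_congr rfl fun e _ => mul_comm _ _

section
variable {n m : ℕ} {E : Type}

lemma applyLocal_sub (U : Matrix (BitString n × BitString m) (BitString n × BitString m) ℂ)
    (ψ χ : (BitString n × BitString m) × E → ℂ) :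
    applyLocal U (ψ - χ) = applyLocal U ψ - applyLocal U χ := by
  funext p
  simp [applyLocal, mul_sub, Finset.sum_sub_distrib]

lemma applyLocal_mul (U V : Matrix (BitString n × BitString m) (BitString n × BitString m) ℂ)
    (ψ : (BitString n × BitString m) × E → ℂ) :
    applyLocal (U * V) ψ = applyLocal U (applyLocal V ψ) := by
  funext p
  simp only [applyLocal, Matrix.mul_apply, Finset.sum_mul, Finset.mul_sum]
  rw [Finset.sum_comm]
  simp only [mul_assoc]

/-- The part of `ψ` in the register `E` is supported on the basis states satisfying `Q`. -/
def SupportedOn {ι : Type} (Q : E → Prop) (ψ : ι × E → ℂ) : Prop := ∀ p, ψ p ≠ 0 → Q p.2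

lemma SupportedOn.applyLocal {Q : E → Prop} {ψ : (BitString n × BitString m) × E → ℂ}
    (hψ : SupportedOn Q ψ)
    (U : Matrix (BitString n × BitString m) (BitString n × BitString m) ℂ) :
    SupportedOn Q (applyLocal U ψ) := by
  intro p hp
  obtain ⟨q, _, hq⟩ := Finset.exists_ne_zero_of_sum_ne_zero hp
  exact hψ (q, p.2) (right_ne_zero_of_mul hq)

variable [Fintype E]

lemma l2_applyLocal {U : Matrix (BitString n × BitString m) (BitString n × BitString m) ℂ}
    (hU : U ∈ Matrix.unitaryGroup (BitString n × BitString m) ℂ)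
    (ψ : (BitString n × BitString m) × E → ℂ) : l2 (applyLocal U ψ) = l2 ψ := by
  rw [← sq_eq_sq₀ (l2_nonneg _) (l2_nonneg _), l2_sq, l2_sq, Fintype.sum_prod_type_right,
    Fintype.sum_prod_type_right]
  exact Finset.sum_congr rfl fun e _ => sum_norm_sq_mulVec hU fun q => ψ (q, e)

lemma trace_mul_reducedState
    (W : Matrix (BitString n × BitString m) (BitString n × BitString m) ℂ)
    (ψ : (BitString n × BitString m) × E → ℂ) :
    (W * reducedState ψ).trace =
      ∑ p : (BitString n × BitString m) × E, star (ψ p) * applyLocal W ψ p := by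
  simp only [Matrix.trace, Matrix.diag, Matrix.mul_apply, reducedState, Matrix.of_apply,
    applyLocal, Finset.mul_sum]
  conv_rhs => rw [Fintype.sum_prod_type]
  refine Finset.sum_congr rfl fun i _ => ?_
  rw [Finset.sum_comm]
  exact Finset.sum_congr rfl fun e _ => Finset.sum_congr rfl fun q _ => by ring

variable {W : Matrix (BitString n × BitString m) (BitString n × BitString m) ℂ}

lemma norm_trace_mul_reducedState_le (hW : W ∈ Matrix.unitaryGroup (BitString n × BitString m) ℂ)
    (ψ : (BitString n × BitString m) × E → ℂ) :
    ‖(W * reducedState ψ).trace‖ ≤ l2 ψ ^ 2 := by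
  rw [trace_mul_reducedState]
  refine (norm_sum_star_mul_le _ _).trans ?_
  rw [l2_applyLocal hW, sq]

lemma norm_trace_mul_reducedState_sub_le
    (hW : W ∈ Matrix.unitaryGroup (BitString n × BitString m) ℂ)
    (ψ χ : (BitString n × BitString m) × E → ℂ) :
    ‖(W * reducedState ψ).trace - (W * reducedState χ).trace‖ ≤ (l2 ψ + l2 χ) * l2 (ψ - χ) := by
  have hsplit : (W * reducedState ψ).trace - (W * reducedState χ).trace =
      (∑ p : (BitString n × BitString m) × E, star (ψ p) * applyLocal W (ψ - χ) p) +
        ∑ p : (BitString n × BitString m) × E, star ((ψ - χ) p) * applyLocal W χ p := by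
    rw [trace_mul_reducedState, trace_mul_reducedState, applyLocal_sub, ← Finset.sum_sub_distrib,
      ← Finset.sum_add_distrib]
    refine Finset.sum_congr rfl fun p _ => ?_
    simp only [Pi.sub_apply, star_sub]
    ring
  have hψ := norm_sum_star_mul_le ψ (applyLocal W (ψ - χ))
  have hχ := norm_sum_star_mul_le (ψ - χ) (applyLocal W χ)
  rw [l2_applyLocal hW] at hψ hχ
  rw [hsplit]
  refine (norm_add_le _ _).trans ?_
  linarith

end

/-! ### Orthonormality of relation states -/

section
variable {α : Type*} {k : ℕ} {R : Finset α} {s : Fin k → α}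

lemma injective_of_map_univ_eq_val (h : Finset.univ.val.map s = R.val) : Function.Injective s :=
  fun i j hij => Multiset.inj_on_of_nodup_map (h ▸ R.nodup) i (Finset.mem_univ i) j
    (Finset.mem_univ j) hij

lemma mem_iff_of_map_univ_eq_val (h : Finset.univ.val.map s = R.val) (a : α) :
    a ∈ R ↔ ∃ i, s i = a := by
  rw [← Finset.mem_val, ← h]
  simp

lemma card_enumerations [Fintype α] [DecidableEq α] (R : Finset α) :
    (Finset.univ.filter fun s : Fin R.card → α => Finset.univ.val.map s = R.val).card =
      R.card ! := by
  let e : {s : Fin R.card → α // Finset.univ.val.map s = R.val} ≃ (Fin R.card ≃ R) :=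
    { toFun := fun s => Equiv.ofBijective
        (fun i => ⟨s.1 i, (mem_iff_of_map_univ_eq_val s.2 _).2 ⟨i, rfl⟩⟩)
        ⟨fun _ _ hij => injective_of_map_univ_eq_val s.2 (Subtype.ext_iff.1 hij), fun a =>
          ((mem_iff_of_map_univ_eq_val s.2 a.1).1 a.2).imp fun _ hi => Subtype.ext hi⟩
      invFun := fun f => ⟨Subtype.val ∘ f, by
        rw [← Multiset.map_map, Multiset.map_univ_val_equiv]
        exact Multiset.attach_map_val _⟩
      left_inv := fun s => rfl
      right_inv := fun f => by ext; rfl }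
  rw [← Fintype.card_subtype, Fintype.card_congr e, Fintype.card_equiv R.equivFin.symm,
    Fintype.card_fin]

end

section
variable {n : ℕ}

lemma star_relKet_dotProduct_self {R : Rel n} (hR : R.card ≤ 2 ^ n) :
    star (relKet R) ⬝ᵥ relKet R = 1 := by
  have hterm (e : RecIdx n) : star (relKet R e) * relKet R e =
      if Finset.univ.val.map e.2 = R.val then ((R.card ! : ℝ) : ℂ)⁻¹ else 0 := by
    unfold relKet
    split_ifs
    · rw [Complex.star_def, ← Complex.ofReal_inv, Complex.conj_ofReal, ← Complex.ofReal_mul,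
        ← mul_inv, Real.mul_self_sqrt (by positivity), Complex.ofReal_inv]
    · simp
  simp only [dotProduct, Pi.star_apply, hterm]
  rw [Fintype.sum_sigma, Finset.sum_eq_single (⟨R.card, by omega⟩ : Fin (2 ^ n + 1))]
  · rw [← Finset.sum_filter, Finset.sum_const, card_enumerations, nsmul_eq_mul,
      Complex.ofReal_natCast]
    exact mul_inv_cancel₀ (Nat.cast_ne_zero.2 (Nat.factorial_ne_zero _))
  · intro k _ hk
    refine Finset.sum_eq_zero fun s _ => if_neg fun hs => hk (Fin.ext ?_)
    simpa using congrArg Multiset.card hs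
  · simp

lemma star_relKet_dotProduct (R : Rel n) {R' : Rel n} (hR : R'.card ≤ 2 ^ n) :
    star (relKet R) ⬝ᵥ relKet R' = if R = R' then 1 else 0 := by
  split_ifs with h
  · rw [h, star_relKet_dotProduct_self hR]
  · refine Finset.sum_eq_zero fun e _ => ?_
    simp only [Pi.star_apply, relKet]
    split_ifs with h1 h2
    · exact absurd (Finset.val_injective (h1.symm.trans h2)) h
    all_goals simp

end

/-! ### Pairs of relations as partial functions -/

/-- The tensor product `|u⟩|v⟩` of two vectors. -/
def tensorKet {α β : Type*} (u : α → ℂ) (v : β → ℂ) : α × β → ℂ := fun p => u p.1 * v p.2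

lemma star_tensorKet_dotProduct {α β : Type*} [Fintype α] [Fintype β] (u u' : α → ℂ)
    (v v' : β → ℂ) :
    star (tensorKet u v) ⬝ᵥ tensorKet u' v' = (star u ⬝ᵥ u') * (star v ⬝ᵥ v') := by
  simp only [dotProduct, Pi.star_apply, tensorKet, star_mul', Fintype.sum_mul_sum,
    Fintype.sum_prod_type]
  exact Finset.sum_congr rfl fun a _ => Finset.sum_congr rfl fun b _ => by ring

/-- Pairs of injective relations, encoded as partial functions: `g (j, y) = some x` means that
`(x, y)` is recorded in the `j`-th relation. -/
abbrev RelPair (n : ℕ) : Type := Fin 2 × BitString n → Option (BitString n)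

lemma card_bitString (n : ℕ) : Fintype.card (BitString n) = 2 ^ n := by
  simp [BitString]

section
variable {n m : ℕ}

/-- The `j`-th relation encoded by `g`. -/
def rel (g : RelPair n) (j : Fin 2) : Rel n := Finset.univ.filter fun q => g (j, q.2) = some q.1

/-- The image of the `j`-th relation encoded by `g`. -/
def outputs (g : RelPair n) (j : Fin 2) : Finset (BitString n) :=
  Finset.univ.filter fun y => g (j, y) ≠ none

lemma mem_rel {g : RelPair n} {j : Fin 2} {q : BitString n × BitString n} :
    q ∈ rel g j ↔ g (j, q.2) = some q.1 := by simp [rel]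

lemma mem_outputs {g : RelPair n} {j : Fin 2} {y : BitString n} :
    y ∈ outputs g j ↔ g (j, y) ≠ none := by simp [outputs]

lemma isInj_rel (g : RelPair n) (j : Fin 2) : IsInj (rel g j) := by
  rintro ⟨x, y⟩ hx ⟨x', y'⟩ hx' (rfl : y = y')
  simp only [Finset.mem_coe, mem_rel] at hx hx'
  rw [Option.some_injective _ (hx.symm.trans hx')]

lemma im_rel (g : RelPair n) (j : Fin 2) : im (rel g j) = outputs g j := by
  ext y
  simp only [im, Finset.mem_image, mem_rel, mem_outputs, Prod.exists, exists_eq_right]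
  exact Option.ne_none_iff_exists'.symm

lemma card_rel (g : RelPair n) (j : Fin 2) : (rel g j).card = (outputs g j).card := by
  rw [← im_rel, im, Finset.card_image_of_injOn (isInj_rel g j)]

lemma card_outputs_le (g : RelPair n) (j : Fin 2) : (outputs g j).card ≤ 2 ^ n :=
  (Finset.card_le_univ _).trans_eq (card_bitString n)

lemma card_rel_le (g : RelPair n) (j : Fin 2) : (rel g j).card ≤ 2 ^ n :=
  (card_rel g j).trans_le (card_outputs_le g j)

lemma card_outputs_lt {g : RelPair n} {j : Fin 2} {y : BitString n} (h : g (j, y) = none) :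
    (outputs g j).card < 2 ^ n := by
  rw [← card_bitString n]
  exact Finset.card_lt_univ_of_notMem (x := y) (by simp [mem_outputs, h])

lemma eq_of_rel_eq {g h : RelPair n} (hr : ∀ j, rel g j = rel h j) : g = h := by
  funext ⟨j, y⟩
  ext x
  simpa [mem_rel] using Finset.ext_iff.1 (hr j) (x, y)

lemma rel_update_self {g : RelPair n} {j : Fin 2} {y : BitString n} (x : BitString n)
    (h : g (j, y) = none) :
    rel (Function.update g (j, y) (some x)) j = insert (x, y) (rel g j) := by
  ext ⟨x', y'⟩
  simp only [mem_rel, Finset.mem_insert, Function.update_apply, Prod.mk.injEq, true_and]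
  by_cases hy : y' = y
  · subst hy
    simp [h, eq_comm]
  · simp [hy]

lemma rel_update_of_ne {g : RelPair n} {j j' : Fin 2} (hj : j' ≠ j) {y : BitString n}
    (u : Option (BitString n)) : rel (Function.update g (j, y) u) j' = rel g j' := by
  ext ⟨x', y'⟩
  simp [mem_rel, hj]

lemma rel_none (j : Fin 2) : rel (fun _ => none : RelPair n) j = ∅ := by
  ext; simp [mem_rel]

/-- The vector `|R₁⟩|R₂⟩` for the pair of relations encoded by `g`. -/
def pairKet (g : RelPair n) : RecIdx n × RecIdx n → ℂ :=
  tensorKet (relKet (rel g 0)) (relKet (rel g 1))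

lemma star_pairKet_dotProduct (g h : RelPair n) :
    star (pairKet g) ⬝ᵥ pairKet h = if g = h then 1 else 0 := by
  rw [pairKet, pairKet, star_tensorKet_dotProduct, star_relKet_dotProduct _ (card_rel_le h 0),
    star_relKet_dotProduct _ (card_rel_le h 1), ite_zero_mul_ite_zero, one_mul]
  refine if_congr ⟨fun hr => eq_of_rel_eq (Fin.forall_fin_two.2 hr), ?_⟩ rfl rfl
  rintro rfl
  exact ⟨rfl, rfl⟩

/-! ### Path recording on partial functions -/

/-- The isometry that writes a partial function as a pair of relation states. -/
def embed (c : (BitString n × BitString m) × RelPair n → ℂ) :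
    (BitString n × BitString m) × (RecIdx n × RecIdx n) → ℂ :=
  fun p => ∑ g, c (p.1, g) * pairKet g p.2

lemma reducedState_embed (c : (BitString n × BitString m) × RelPair n → ℂ) :
    reducedState (embed c) = reducedState c := by
  ext p q
  simp only [reducedState, Matrix.of_apply, embed, star_sum, star_mul', Finset.sum_mul_sum]
  rw [Finset.sum_comm]
  refine Finset.sum_congr rfl fun g _ => ?_
  rw [Finset.sum_comm]
  have horth (h : RelPair n) :
      ∑ e, c (p, g) * pairKet g e * (star (c (q, h)) * star (pairKet h e)) =
        c (p, g) * star (c (q, h)) * if h = g then 1 else 0 := by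
    rw [← star_pairKet_dotProduct, dotProduct, Finset.mul_sum]
    exact Finset.sum_congr rfl fun e _ => by rw [Pi.star_apply]; ring
  rw [Finset.sum_congr rfl fun h _ => horth h]
  simp

lemma applyLocal_embed
    (U : Matrix (BitString n × BitString m) (BitString n × BitString m) ℂ)
    (c : (BitString n × BitString m) × RelPair n → ℂ) :
    applyLocal U (embed c) = embed (applyLocal U c) := by
  funext p
  simp only [applyLocal, embed, Finset.mul_sum, Finset.sum_mul]
  rw [Finset.sum_comm]
  simp only [mul_assoc]

/-- A path-recording step with weights `w`:
`|x⟩|g⟩ ↦ ∑_{y : g (j, y) = none} w g y |y⟩|g[(j, y) ↦ x]⟩`. -/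
def recStep (w : RelPair n → BitString n → ℝ) (j : Fin 2)
    (ψ : (BitString n × BitString m) × RelPair n → ℂ) :
    (BitString n × BitString m) × RelPair n → ℂ :=
  fun p => (p.2 (j, p.1.1)).elim 0 fun x =>
    (w (Function.update p.2 (j, p.1.1) none) p.1.1 : ℂ) *
      ψ ((x, p.1.2), Function.update p.2 (j, p.1.1) none)

/-- The state `|0⟩|∅⟩|∅⟩` before the first query. -/
def initRec (n m : ℕ) : (BitString n × BitString m) × RelPair n → ℂ :=
  fun p => if p.1 = 0 then (if p.2 = fun _ => none then 1 else 0) else 0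

/-- The view of an adversary for path-recording oracles with weights `w 0`, `w 1`. -/
def Adversary.recView {t : ℕ} (𝒜 : Adversary n m t) (w : Fin 2 → RelPair n → BitString n → ℝ) :
    (BitString n × BitString m) × RelPair n → ℂ :=
  Fin.foldl t (fun ψ i => recStep (w (𝒜.query i)) (𝒜.query i) (applyLocal (𝒜.unitary i).1 ψ))
    (initRec n m)

/-- The oracle `O` on `A E₁ E₂` is a path-recording step with weights `w` into the `j`-th relation,
on the span of the states `|x⟩|R₁⟩|R₂⟩` with `R₁` and `R₂` injective. -/
def IsRecording (w : RelPair n → BitString n → ℝ) (j : Fin 2)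
    (O : Matrix (BitString n × (RecIdx n × RecIdx n)) (BitString n × (RecIdx n × RecIdx n)) ℂ) :
    Prop :=
  ∀ x g, O *ᵥ ket x (rel g 0) (rel g 1) =
    ∑ y with g (j, y) = none, (w g y : ℂ) • record j x (rel g 0) (rel g 1) y

lemma embed_initRec (n m : ℕ) : embed (initRec n m) =
    fun p => if p.1 = 0 then relKet (∅ : Rel n) p.2.1 * relKet ∅ p.2.2 else 0 := by
  funext p
  simp only [embed, initRec]
  split_ifs
  · rw [Finset.sum_eq_single (fun _ => none)]
    · simp [pairKet, tensorKet, rel_none]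
    · intro g _ hg
      simp [hg]
    · simp
  · simp

lemma ket_eq_tensorKet (x : BitString n) (R₁ R₂ : Rel n) :
    ket x R₁ R₂ = tensorKet (basisKet x) (tensorKet (relKet R₁) (relKet R₂)) :=
  funext fun _ => mul_assoc _ _ _

lemma record_rel {g : RelPair n} {j : Fin 2} {y : BitString n} (x : BitString n)
    (h : g (j, y) = none) :
    record j x (rel g 0) (rel g 1) y =
      tensorKet (basisKet y) (pairKet (Function.update g (j, y) (some x))) := by
  rw [record, ket_eq_tensorKet, ket_eq_tensorKet, pairKet]
  obtain rfl | rfl : j = 0 ∨ j = 1 := by omega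
  · rw [if_pos rfl, rel_update_self x h, rel_update_of_ne (by decide)]
  · rw [if_neg (by decide), rel_update_self x h, rel_update_of_ne (by decide)]

lemma IsRecording.mulVec_apply {w : RelPair n → BitString n → ℝ} {j : Fin 2}
    {O : Matrix (BitString n × (RecIdx n × RecIdx n)) (BitString n × (RecIdx n × RecIdx n)) ℂ}
    (hO : IsRecording w j O) (x y : BitString n) (g : RelPair n) (e : RecIdx n × RecIdx n) :
    (O *ᵥ ket x (rel g 0) (rel g 1)) (y, e) =
      if g (j, y) = none then
        (w g y : ℂ) * pairKet (Function.update g (j, y) (some x)) e else 0 := by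
  have hterm (y' : BitString n) (hy' : g (j, y') = none) :
      ((w g y' : ℂ) • record j x (rel g 0) (rel g 1) y') (y, e) =
        if y = y' then (w g y : ℂ) * pairKet (Function.update g (j, y) (some x)) e else 0 := by
    rw [record_rel x hy']
    split_ifs with h
    · simp [tensorKet, basisKet, h]
    · simp [tensorKet, basisKet, h]
  rw [hO, Finset.sum_apply,
    Finset.sum_congr rfl fun y' hy' => hterm y' (Finset.mem_filter.1 hy').2, Finset.sum_ite_eq]
  simp only [Finset.mem_filter, Finset.mem_univ, true_and]

lemma applyOracle_embed_apply
    (O : Matrix (BitString n × (RecIdx n × RecIdx n)) (BitString n × (RecIdx n × RecIdx n)) ℂ)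
    (c : (BitString n × BitString m) × RelPair n → ℂ) (y : BitString n) (b : BitString m)
    (e : RecIdx n × RecIdx n) :
    applyOracle O (embed c) ((y, b), e) =
      ∑ g, ∑ x, c ((x, b), g) * (O *ᵥ ket x (rel g 0) (rel g 1)) (y, e) := by
  simp only [applyOracle, embed, Finset.mul_sum, Matrix.mulVec, dotProduct]
  rw [Finset.sum_comm]
  refine Finset.sum_congr rfl fun g _ => ?_
  rw [Finset.sum_comm]
  refine Finset.sum_congr rfl fun q _ => ?_
  rw [Finset.sum_eq_single q.1]
  · simp only [ket_eq_tensorKet, tensorKet, basisKet, pairKet, Pi.single_eq_same]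
    ring
  · intro x _ hx
    simp [ket, basisKet, hx.symm]
  · simp

lemma sum_eq_sum_update {I κ M : Type*} [Fintype I] [DecidableEq I] [Fintype κ] [DecidableEq κ]
    [AddCommMonoid M] (a : I) (o : κ) (G : (I → κ) → M) :
    ∑ g, G g = ∑ g : I → κ, if g a = o then ∑ u, G (Function.update g a u) else 0 := by
  rw [← Finset.sum_filter, ← Finset.sum_product']
  symm
  refine Finset.sum_nbij' (fun q => Function.update q.1 a q.2)
    (fun g => (Function.update g a o, g a)) ?_ ?_ ?_ ?_ ?_
  · simp
  · simp
  · rintro ⟨g, u⟩ h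
    simp only [Finset.mem_product, Finset.mem_filter, Finset.mem_univ, true_and, and_true] at h
    simp [← h]
  · simp
  · simp

lemma applyOracle_embed {w : RelPair n → BitString n → ℝ} {j : Fin 2}
    {O : Matrix (BitString n × (RecIdx n × RecIdx n)) (BitString n × (RecIdx n × RecIdx n)) ℂ}
    (hO : IsRecording w j O) (c : (BitString n × BitString m) × RelPair n → ℂ) :
    applyOracle O (embed c) = embed (recStep w j c) := by
  funext ⟨⟨y, b⟩, e⟩
  rw [applyOracle_embed_apply, embed]
  conv_rhs => rw [sum_eq_sum_update (j, y) none]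
  refine Finset.sum_congr rfl fun g _ => ?_
  simp_rw [hO.mulVec_apply]
  split_ifs with h
  · have hg : Function.update g (j, y) none = g := by rw [← h, Function.update_eq_self]
    rw [Fintype.sum_option]
    simp only [recStep, Function.update_self, Option.elim, zero_mul, zero_add,
      Function.update_idem, hg]
    exact Finset.sum_congr rfl fun x _ => by ring
  · simp

lemma recState_eq_reducedState_recView {t : ℕ} (𝒜 : Adversary n m t)
    {w : Fin 2 → RelPair n → BitString n → ℝ}
    {O : Fin 2 →
      Matrix (BitString n × (RecIdx n × RecIdx n)) (BitString n × (RecIdx n × RecIdx n)) ℂ}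
    (hO : ∀ j, IsRecording (w j) j (O j)) :
    𝒜.recState O = reducedState (𝒜.recView w) := by
  rw [← reducedState_embed]
  unfold Adversary.recState Adversary.view Adversary.recView
  congr 1
  refine foldl_rel (fun _ a b => a = embed b) t _ _ _ _ ?_ ?_
  · rw [embed_initRec]
  · rintro i a b rfl
    rw [applyLocal_embed, applyOracle_embed (hO _)]

end

/-! ### The path-recording oracles as recording steps -/

lemma sum_vecMulVec_star_mulVec {α β κ : Type*} [Fintype α] [Fintype κ] {S : Finset β}
    (v e : α → β → κ → ℂ) {a : α} {b : β} [Decidable (b ∈ S)]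
    (hself : star (e a b) ⬝ᵥ e a b = 1)
    (horth : ∀ a' b', ¬(a' = a ∧ b' = b) → star (e a' b') ⬝ᵥ e a b = 0) :
    (∑ a', ∑ b' ∈ S, Matrix.vecMulVec (v a' b') (star (e a' b'))) *ᵥ e a b =
      if b ∈ S then v a b else 0 := by
  have hzero (a' : α) (b' : β) (h : ¬(a' = a ∧ b' = b)) :
      Matrix.vecMulVec (v a' b') (star (e a' b')) *ᵥ e a b = 0 := by
    simp [Matrix.vecMulVec_mulVec, horth a' b' h]
  simp only [Matrix.sum_mulVec]
  rw [Finset.sum_eq_single a (fun a' _ ha => Finset.sum_eq_zero fun b' _ =>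
    hzero a' b' fun h => ha h.1) fun ha => absurd (Finset.mem_univ a) ha]
  split_ifs with hb
  · rw [Finset.sum_eq_single_of_mem b hb fun b' _ hb' => hzero a b' fun h => hb' h.2]
    simp [Matrix.vecMulVec_mulVec, hself]
  · exact Finset.sum_eq_zero fun b' hb' => hzero a b' fun h => hb (h.2 ▸ hb')

section
variable {n : ℕ}

lemma star_basisKet_dotProduct (x x' : BitString n) :
    star (basisKet x) ⬝ᵥ basisKet x' = if x = x' then 1 else 0 := by
  simp [basisKet, Pi.single_apply, eq_comm]

lemma star_ket_dotProduct (x x' : BitString n) (R₁ R₂ : Rel n) {R₁' R₂' : Rel n}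
    (h₁ : R₁'.card ≤ 2 ^ n) (h₂ : R₂'.card ≤ 2 ^ n) :
    star (ket x R₁ R₂) ⬝ᵥ ket x' R₁' R₂' = if x = x' ∧ R₁ = R₁' ∧ R₂ = R₂' then 1 else 0 := by
  rw [ket_eq_tensorKet, ket_eq_tensorKet, star_tensorKet_dotProduct, star_tensorKet_dotProduct,
    star_basisKet_dotProduct, star_relKet_dotProduct _ h₁, star_relKet_dotProduct _ h₂,
    ite_zero_mul_ite_zero, ite_zero_mul_ite_zero, one_mul, one_mul]

/-- The weights of the independent path-recording oracles. -/
def prWeight (n : ℕ) (j : Fin 2) (g : RelPair n) (_ : BitString n) : ℝ :=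
  (Real.sqrt ((2 : ℝ) ^ n - (outputs g j).card))⁻¹

lemma pr_mulVec (x : BitString n) (R : Rel n) (hi : IsInj R) (hR : R.card ≤ 2 ^ n) :
    pr n *ᵥ tensorKet (basisKet x) (relKet R) =
      if R.card < 2 ^ n then (((Real.sqrt ((2 : ℝ) ^ n - R.card) : ℝ) : ℂ)⁻¹ •
        ∑ y ∈ Finset.univ \ im R, tensorKet (basisKet y) (relKet (insert (x, y) R)))
      else 0 := by
  classical
  have horth (x' : BitString n) (R' : Rel n) :
      star (tensorKet (basisKet x') (relKet R')) ⬝ᵥ tensorKet (basisKet x) (relKet R) =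
        if x' = x ∧ R' = R then 1 else 0 := by
    rw [star_tensorKet_dotProduct, star_basisKet_dotProduct, star_relKet_dotProduct _ hR,
      ite_zero_mul_ite_zero, one_mul]
  refine (sum_vecMulVec_star_mulVec _ (fun x R => tensorKet (basisKet x) (relKet R))
    ((horth x R).trans (if_pos ⟨rfl, rfl⟩))
    fun x' R' h => (horth x' R').trans (if_neg h)).trans (if_congr ?_ rfl rfl)
  simp [hi]

lemma pr_mulVec_rel (j : Fin 2) (x : BitString n) (g : RelPair n) :
    pr n *ᵥ tensorKet (basisKet x) (relKet (rel g j)) =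
      ∑ y with g (j, y) = none, (prWeight n j g y : ℂ) •
        tensorKet (basisKet y) (relKet (insert (x, y) (rel g j))) := by
  have hcompl : Finset.univ \ outputs g j = Finset.univ.filter fun y => g (j, y) = none := by
    ext y
    simp [mem_outputs]
  rw [pr_mulVec x _ (isInj_rel g j) (card_rel_le g j), card_rel, im_rel, hcompl]
  split_ifs with h
  · simp only [prWeight, Complex.ofReal_inv, Finset.smul_sum]
  · refine (Finset.sum_eq_zero fun y hy => absurd ?_ h).symm
    exact card_outputs_lt (Finset.mem_filter.1 hy).2

lemma prOracle_zero_mulVec (x : BitString n) (R₁ R₂ : Rel n) :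
    prOracle n 0 *ᵥ ket x R₁ R₂ = fun p =>
      (pr n *ᵥ tensorKet (basisKet x) (relKet R₁)) (p.1, p.2.1) * relKet R₂ p.2.2 := by
  funext ⟨y, e₁, e₂⟩
  simp only [Matrix.mulVec, dotProduct, prOracle, Matrix.of_apply, if_pos, ket, tensorKet,
    Fintype.sum_prod_type, Finset.sum_mul]
  refine Finset.sum_congr rfl fun a _ => Finset.sum_congr rfl fun b _ => ?_
  simp [mul_assoc]

lemma prOracle_one_mulVec (x : BitString n) (R₁ R₂ : Rel n) :
    prOracle n 1 *ᵥ ket x R₁ R₂ = fun p =>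
      (pr n *ᵥ tensorKet (basisKet x) (relKet R₂)) (p.1, p.2.2) * relKet R₁ p.2.1 := by
  funext ⟨y, e₁, e₂⟩
  simp only [Matrix.mulVec, dotProduct, prOracle, Matrix.of_apply, one_ne_zero, if_false, ket,
    tensorKet, Fintype.sum_prod_type_right, Finset.sum_mul]
  refine Finset.sum_congr rfl fun a _ => ?_
  rw [Finset.sum_comm, Finset.sum_comm]
  simp [mul_assoc, mul_comm, mul_left_comm]

lemma isRecording_prOracle (n : ℕ) (j : Fin 2) : IsRecording (prWeight n j) j (prOracle n j) := by
  intro x g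
  funext p
  rw [Finset.sum_apply]
  obtain rfl | rfl : j = 0 ∨ j = 1 := by omega
  · simp only [prOracle_zero_mulVec, pr_mulVec_rel, Finset.sum_apply, Finset.sum_mul]
    refine Finset.sum_congr rfl fun y _ => ?_
    simp only [record, ket, if_pos, Pi.smul_apply, smul_eq_mul, tensorKet]
    ring
  · simp only [prOracle_one_mulVec, pr_mulVec_rel, Finset.sum_apply, Finset.sum_mul]
    refine Finset.sum_congr rfl fun y _ => ?_
    simp only [record, ket, one_ne_zero, if_false, Pi.smul_apply, smul_eq_mul, tensorKet]
    ring

lemma recState_prOracle {m t : ℕ} (𝒜 : Adversary n m t) :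
    𝒜.recState (prOracle n) = reducedState (𝒜.recView (prWeight n)) :=
  recState_eq_reducedState_recView 𝒜 (isRecording_prOracle n)

/-- The pairs of relations on which the collision-free path-recording oracles are not extended by
zero. -/
def InCFDomain (ℓ lam : ℕ) (g : RelPair n) : Prop :=
  IsCFRel ℓ lam (rel g 0) ∧ IsCFRel ℓ lam (rel g 1) ∧ IsCFRel ℓ lam (rel g 0 ∪ rel g 1) ∧
    Disjoint (rel g 0) (rel g 1) ∧ (rel g 0 ∪ rel g 1).card < 2 ^ n

/-- The joint image of both relations. -/
def jointOutputs (g : RelPair n) : Finset (BitString n) := outputs g 0 ∪ outputs g 1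

lemma im_union_rel (g : RelPair n) : im (rel g 0 ∪ rel g 1) = jointOutputs g := by
  rw [im, Finset.image_union, jointOutputs, ← im_rel, ← im_rel]
  rfl

lemma eq_none_of_notMem_jointOutputs {g : RelPair n} {y : BitString n}
    (hy : y ∉ jointOutputs g) (j : Fin 2) : g (j, y) = none := by
  simp only [jointOutputs, Finset.mem_union, not_or, mem_outputs, not_not] at hy
  exact Fin.forall_fin_two (p := fun j => g (j, y) = none).2 hy j

open Classical in
/-- The weights of the collision-free path-recording oracles; they do not depend on the queried
oracle, because the constraint on the new output is shared. -/
def cfWeight (n ℓ lam : ℕ) (_ : Fin 2) (g : RelPair n) (y : BitString n) : ℝ :=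
  if InCFDomain ℓ lam g ∧ y ∈ CF ℓ lam (jointOutputs g) then
    (Real.sqrt (CF ℓ lam (jointOutputs g)).card)⁻¹ else 0

lemma mem_CF {ℓ lam : ℕ} {S : Finset (BitString n)} {y : BitString n} :
    y ∈ CF ℓ lam S ↔ y ∉ S ∧ StrongCF ℓ lam (insert y S) := by
  simp [CF]

lemma CF_subset_filter_none (ℓ lam : ℕ) (g : RelPair n) (j : Fin 2) :
    CF ℓ lam (jointOutputs g) ⊆ Finset.univ.filter fun y => g (j, y) = none := fun _ hy =>
  Finset.mem_filter.2
    ⟨Finset.mem_univ _, eq_none_of_notMem_jointOutputs (mem_CF.1 hy).1 j⟩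

lemma isRecording_cfprOracle (n ℓ lam : ℕ) (j : Fin 2) :
    IsRecording (cfWeight n ℓ lam j) j (cfprOracle n ℓ lam j) := by
  classical
  intro x g
  have horth (x' : BitString n) (R : Rel n × Rel n) :
      star (ket x' R.1 R.2) ⬝ᵥ ket x (rel g 0) (rel g 1) =
        if x' = x ∧ R.1 = rel g 0 ∧ R.2 = rel g 1 then 1 else 0 :=
    star_ket_dotProduct _ _ _ _ (card_rel_le g 0) (card_rel_le g 1)
  refine (sum_vecMulVec_star_mulVec _ (fun x (R : Rel n × Rel n) => ket x R.1 R.2)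
    (b := (rel g 0, rel g 1))
    ((horth x _).trans (if_pos ⟨rfl, rfl, rfl⟩))
    fun x' R h => (horth x' R).trans (if_neg fun hR => h ⟨hR.1, Prod.ext hR.2.1 hR.2.2⟩)).trans ?_
  simp only [Finset.mem_filter, Finset.mem_univ, true_and, im_union_rel, Finset.smul_sum]
  split_ifs with hg
  · rw [← Finset.sum_subset (CF_subset_filter_none ℓ lam g j)]
    · refine Finset.sum_congr rfl fun y hy => ?_
      rw [cfWeight, if_pos ⟨hg, hy⟩, Complex.ofReal_inv]
    · intro y _ hy
      simp [cfWeight, hy]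
  · have hdom : ¬InCFDomain ℓ lam g := hg
    simp [cfWeight, hdom]

lemma recState_cfprOracle {m t : ℕ} (ℓ lam : ℕ) (𝒜 : Adversary n m t) :
    𝒜.recState (cfprOracle n ℓ lam) = reducedState (𝒜.recView (cfWeight n ℓ lam)) :=
  recState_eq_reducedState_recView 𝒜 (isRecording_cfprOracle n ℓ lam)

lemma takeBits_injective (n : ℕ) : Function.Injective (takeBits n : BitString n → _) :=
  fun _ _ h => funext fun i => congrFun h ⟨i, i.2⟩

lemma strongCF_one_self (S : Finset (BitString n)) : StrongCF 1 n S := by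
  intro i hi S₁ _ S₂ _ h₁ h₂
  refine ⟨fun h => ?_, fun h => by rw [h]⟩
  interval_cases i
  · rw [Finset.card_eq_zero] at h₁ h₂
    rw [h₁, h₂]
  · obtain ⟨x, rfl⟩ := Finset.card_eq_one.1 h₁
    obtain ⟨y, rfl⟩ := Finset.card_eq_one.1 h₂
    simp only [Finset.sum_singleton] at h
    rw [takeBits_injective n h]

lemma sharedPrOracle_eq_cfprOracle (n : ℕ) (j : Fin 2) :
    sharedPrOracle n j = cfprOracle n 1 n j := by
  classical
  have hrel (R : Rel n) : IsCFRel 1 n R ↔ IsInj R := and_iff_left (strongCF_one_self _)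
  have hCF (S : Finset (BitString n)) : CF 1 n S = Finset.univ \ S := by
    ext y
    simp [CF, strongCF_one_self]
  unfold sharedPrOracle cfprOracle
  simp only [hrel, hCF]
  refine Finset.sum_congr rfl fun x _ => Finset.sum_congr rfl fun R _ => ?_
  rw [Finset.card_sdiff_of_subset (Finset.subset_univ _), Finset.card_univ, card_bitString,
    Nat.cast_sub ((Finset.card_le_univ _).trans_eq (card_bitString n)), Nat.cast_pow,
    Nat.cast_ofNat]

end

section
variable {n m : ℕ}

/-! ### Norms of recording steps -/

lemma l2_sq_recStep (w : RelPair n → BitString n → ℝ) (j : Fin 2)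
    (ψ : (BitString n × BitString m) × RelPair n → ℂ) :
    l2 (recStep w j ψ) ^ 2 = ∑ p, ‖ψ p‖ ^ 2 * ∑ y with p.2 (j, y) = none, w p.2 y ^ 2 := by
  have hcomponent (y : BitString n) (b : BitString m) :
      ∑ g : RelPair n, ‖recStep w j ψ ((y, b), g)‖ ^ 2 =
        ∑ g : RelPair n, ∑ x, ‖ψ ((x, b), g)‖ ^ 2 * if g (j, y) = none then w g y ^ 2 else 0 := by
    rw [sum_eq_sum_update (j, y) none]
    refine Finset.sum_congr rfl fun g _ => ?_
    split_ifs with h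
    · have hg : Function.update g (j, y) none = g := by rw [← h, Function.update_eq_self]
      rw [Fintype.sum_option]
      simp only [recStep, Function.update_self, Option.elim, norm_zero, Function.update_idem, hg]
      rw [zero_pow two_ne_zero, zero_add]
      refine Finset.sum_congr rfl fun x _ => ?_
      rw [norm_mul, mul_pow, Complex.norm_real, Real.norm_eq_abs, sq_abs, mul_comm]
    · simp
  rw [l2_sq]
  simp only [Finset.sum_filter, Fintype.sum_prod_type (α₁ := BitString n × BitString m),
    Fintype.sum_prod_type (α₁ := BitString n) (α₂ := BitString m), hcomponent, Finset.mul_sum]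
  rw [Finset.sum_comm, Finset.sum_comm (γ := BitString n)]
  refine Finset.sum_congr rfl fun b _ => ?_
  rw [Finset.sum_comm, Finset.sum_comm (γ := BitString n)]
  exact Finset.sum_congr rfl fun g _ => Finset.sum_comm

lemma recStep_sub (w : RelPair n → BitString n → ℝ) (j : Fin 2)
    (ψ χ : (BitString n × BitString m) × RelPair n → ℂ) :
    recStep w j (ψ - χ) = recStep w j ψ - recStep w j χ := by
  funext p
  simp only [recStep, Pi.sub_apply]
  cases p.2 (j, p.1.1) <;> simp [mul_sub]

lemma recStep_sub_left (w w' : RelPair n → BitString n → ℝ) (j : Fin 2)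
    (ψ : (BitString n × BitString m) × RelPair n → ℂ) :
    recStep (w - w') j ψ = recStep w j ψ - recStep w' j ψ := by
  funext p
  simp only [recStep, Pi.sub_apply]
  cases p.2 (j, p.1.1) <;> simp [sub_mul]

lemma l2_recStep_le_of_supportedOn {w : RelPair n → BitString n → ℝ} {j : Fin 2}
    {Q : RelPair n → Prop} {ψ : (BitString n × BitString m) × RelPair n → ℂ}
    (hψ : SupportedOn Q ψ) {c : ℝ} (hc : 0 ≤ c)
    (hw : ∀ g, Q g → ∑ y with g (j, y) = none, w g y ^ 2 ≤ c ^ 2) :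
    l2 (recStep w j ψ) ≤ c * l2 ψ := by
  refine le_of_sq_le_sq ?_ (mul_nonneg hc (l2_nonneg _))
  rw [l2_sq_recStep, mul_pow, l2_sq, Finset.mul_sum]
  refine Finset.sum_le_sum fun p _ => ?_
  by_cases hp : ψ p = 0
  · simp [hp]
  · rw [mul_comm]
    exact mul_le_mul_of_nonneg_right (hw _ (hψ p hp)) (by positivity)

lemma l2_recStep_le {w : RelPair n → BitString n → ℝ} {j : Fin 2}
    (hw : ∀ g, ∑ y with g (j, y) = none, w g y ^ 2 ≤ 1)
    (ψ : (BitString n × BitString m) × RelPair n → ℂ) : l2 (recStep w j ψ) ≤ l2 ψ := by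
  have hle := l2_recStep_le_of_supportedOn (w := w) (j := j) (Q := fun _ => True) (ψ := ψ)
    (fun _ _ => trivial) zero_le_one fun g _ => by rw [one_pow]; exact hw g
  rwa [one_mul] at hle

lemma exists_of_recStep_ne_zero {w : RelPair n → BitString n → ℝ} {j : Fin 2}
    {ψ : (BitString n × BitString m) × RelPair n → ℂ}
    {p : (BitString n × BitString m) × RelPair n} (h : recStep w j ψ p ≠ 0) :
    ∃ (g : RelPair n) (x y : BitString n), g (j, y) = none ∧
      p.2 = Function.update g (j, y) (some x) ∧ w g y ≠ 0 ∧ ∃ q, ψ (q, g) ≠ 0 := by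
  unfold recStep at h
  rcases hx : p.2 (j, p.1.1) with _ | x
  · simp [hx] at h
  · rw [hx, Option.elim] at h
    refine ⟨Function.update p.2 (j, p.1.1) none, x, p.1.1, by simp, ?_, ?_, _,
      right_ne_zero_of_mul h⟩
    · rw [Function.update_idem, ← hx, Function.update_eq_self]
    · exact_mod_cast left_ne_zero_of_mul h

lemma l2_initRec : l2 (initRec n m) = 1 := by
  have hinit : initRec n m = Pi.single (0, fun _ => none) 1 := by
    funext p
    simp only [initRec, Pi.single_apply, Prod.ext_iff, ite_and]
  rw [← sq_eq_sq₀ (l2_nonneg _) zero_le_one, l2_sq, hinit]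
  simp [Pi.single_apply, apply_ite norm]

lemma l2_recView_le {t : ℕ} (𝒜 : Adversary n m t) {w : Fin 2 → RelPair n → BitString n → ℝ}
    (hw : ∀ j g, ∑ y with g (j, y) = none, w j g y ^ 2 ≤ 1) : l2 (𝒜.recView w) ≤ 1 :=
  foldl_induction (fun _ ψ => l2 ψ ≤ 1) t _ _ l2_initRec.le fun i ψ hψ =>
    (l2_recStep_le (hw _) _).trans ((l2_applyLocal (𝒜.unitary i).2 ψ).trans_le hψ)

lemma card_filter_none (g : RelPair n) (j : Fin 2) :
    ((Finset.univ.filter fun y => g (j, y) = none).card : ℝ) = 2 ^ n - (outputs g j).card := by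
  have hsplit := Finset.card_filter_add_card_filter_not (s := (Finset.univ : Finset (BitString n)))
    (fun y => g (j, y) = none)
  rw [Finset.card_univ, card_bitString] at hsplit
  rw [eq_sub_iff_add_eq]
  exact_mod_cast hsplit

lemma sum_prWeight_sq {g : RelPair n} {j : Fin 2} (hg : (outputs g j).card < 2 ^ n) :
    ∑ y with g (j, y) = none, prWeight n j g y ^ 2 = 1 := by
  have hpos : (0 : ℝ) < 2 ^ n - (outputs g j).card := by
    rw [sub_pos]
    exact_mod_cast hg
  simp only [prWeight]
  rw [Finset.sum_const, nsmul_eq_mul, card_filter_none, inv_pow, Real.sq_sqrt hpos.le]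
  exact mul_inv_cancel₀ hpos.ne'

lemma sum_prWeight_sq_le (j : Fin 2) (g : RelPair n) :
    ∑ y with g (j, y) = none, prWeight n j g y ^ 2 ≤ 1 := by
  by_cases hg : (outputs g j).card < 2 ^ n
  · exact (sum_prWeight_sq hg).le
  · have hempty : (Finset.univ.filter fun y => g (j, y) = none) = ∅ :=
      Finset.filter_eq_empty_iff.2 fun y _ hy => hg (card_outputs_lt hy)
    rw [hempty, Finset.sum_empty]
    exact zero_le_one

lemma sum_cfWeight_sq_le (ℓ lam : ℕ) (j : Fin 2) (g : RelPair n) :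
    ∑ y with g (j, y) = none, cfWeight n ℓ lam j g y ^ 2 ≤ 1 := by
  rw [← Finset.sum_subset (CF_subset_filter_none ℓ lam g j) fun y _ hy => by simp [cfWeight, hy]]
  have hterm (y : BitString n) :
      cfWeight n ℓ lam j g y ^ 2 ≤ ((CF ℓ lam (jointOutputs g)).card : ℝ)⁻¹ := by
    unfold cfWeight
    split_ifs
    · rw [inv_pow, Real.sq_sqrt (Nat.cast_nonneg _)]
    · rw [zero_pow two_ne_zero]
      positivity
  refine (Finset.sum_le_card_nsmul _ _ _ fun y _ => hterm y).trans ?_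
  rw [nsmul_eq_mul]
  exact mul_inv_le_one

/-! ### Counting outputs that create a collision -/

lemma card_takeBits_fiber_le {lam : ℕ} (hlam : lam ≤ n)
    (v : {j : Fin n // (j : ℕ) < lam} → ZMod 2) :
    (Finset.univ.filter fun y : BitString n => takeBits lam y = v).card ≤ 2 ^ (n - lam) := by
  have hsuffix : Fintype.card ({j : Fin n // ¬(j : ℕ) < lam} → ZMod 2) = 2 ^ (n - lam) := by
    rw [Fintype.card_fun, ZMod.card, Fintype.card_subtype_compl, Fintype.card_fin,
      Fintype.card_subtype, Fin.card_filter_val_lt, min_eq_right hlam]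
  rw [← hsuffix, ← Finset.card_univ]
  refine Finset.card_le_card_of_injOn
    (fun (y : BitString n) (j : {j : Fin n // ¬(j : ℕ) < lam}) => y j) (by simp) ?_
  intro y hy y' hy' h
  have hprefix : takeBits lam y = takeBits lam y' :=
    (Finset.mem_filter.1 hy).2.trans (Finset.mem_filter.1 hy').2.symm
  funext j
  by_cases hj : (j : ℕ) < lam
  · exact congrFun hprefix ⟨j, hj⟩
  · exact congrFun h ⟨j, hj⟩

lemma StrongCF.subset {ℓ lam : ℕ} {S T : Finset (BitString n)} (h : StrongCF ℓ lam T)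
    (hST : S ⊆ T) : StrongCF ℓ lam S :=
  fun i hi S₁ h₁ S₂ h₂ => h i hi S₁ (h₁.trans hST) S₂ (h₂.trans hST)

lemma strongCF_empty (ℓ lam : ℕ) : StrongCF ℓ lam (∅ : Finset (BitString n)) := by
  intro i _ S₁ h₁ S₂ h₂ _ _
  rw [Finset.subset_empty.1 h₁, Finset.subset_empty.1 h₂]
  simp

lemma exists_takeBits_eq_sub {ℓ lam : ℕ} {S S₁ S₂ : Finset (BitString n)} {y : BitString n}
    (h₁ : S₁ ⊆ insert y S) (h₂ : S₂ ⊆ insert y S) (hcard : S₁.card = S₂.card)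
    (hℓ : S₁.card ≤ ℓ) (hsum : ∑ x ∈ S₁, takeBits lam x = ∑ x ∈ S₂, takeBits lam x)
    (hy₁ : y ∈ S₁) (hy₂ : y ∉ S₂) :
    ∃ s < ℓ, ∃ A ∈ S.powersetCard s, ∃ B ∈ S.powersetCard (s + 1),
      takeBits lam y = ∑ x ∈ B, takeBits lam x - ∑ x ∈ A, takeBits lam x := by
  have hpos : 0 < S₁.card := Finset.card_pos.2 ⟨y, hy₁⟩
  refine ⟨S₁.card - 1, by omega, S₁.erase y, ?_, S₂, ?_, ?_⟩
  · exact Finset.mem_powersetCard.2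
      ⟨Finset.subset_insert_iff.1 h₁, Finset.card_erase_of_mem hy₁⟩
  · exact Finset.mem_powersetCard.2
      ⟨(Finset.subset_insert_iff_of_notMem hy₂).1 h₂, by omega⟩
  · rw [← hsum, ← Finset.add_sum_erase _ _ hy₁, add_sub_cancel_right]

lemma StrongCF.eq_of_sum_takeBits_eq {ℓ lam : ℕ} {S S₁ S₂ : Finset (BitString n)}
    {y : BitString n} (hS : StrongCF ℓ lam S) (h₁ : S₁ ⊆ insert y S) (h₂ : S₂ ⊆ insert y S)
    (hcard : S₁.card = S₂.card) (hℓ : S₁.card ≤ ℓ)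
    (hsum : ∑ x ∈ S₁, takeBits lam x = ∑ x ∈ S₂, takeBits lam x) (hy : y ∈ S₁ ↔ y ∈ S₂) :
    S₁ = S₂ := by
  by_cases hy₁ : y ∈ S₁
  · have hy₂ := hy.1 hy₁
    have hsum' : ∑ x ∈ S₁.erase y, takeBits lam x = ∑ x ∈ S₂.erase y, takeBits lam x := by
      rw [← Finset.add_sum_erase S₁ _ hy₁, ← Finset.add_sum_erase S₂ _ hy₂] at hsum
      exact add_left_cancel hsum
    have hcard' : (S₂.erase y).card = (S₁.erase y).card := by
      rw [Finset.card_erase_of_mem hy₁, Finset.card_erase_of_mem hy₂, hcard]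
    have herase := (hS _ (Finset.card_erase_le.trans hℓ) _ (Finset.subset_insert_iff.1 h₁) _
      (Finset.subset_insert_iff.1 h₂) rfl hcard').1 hsum'
    rw [← Finset.insert_erase hy₁, ← Finset.insert_erase hy₂, herase]
  · have hy₂ := mt hy.2 hy₁
    exact (hS _ hℓ S₁ ((Finset.subset_insert_iff_of_notMem hy₁).1 h₁) S₂
      ((Finset.subset_insert_iff_of_notMem hy₂).1 h₂) rfl hcard.symm).1 hsum

lemma exists_of_not_strongCF_insert {ℓ lam : ℕ} {S : Finset (BitString n)} {y : BitString n}
    (hS : StrongCF ℓ lam S) (hy : ¬StrongCF ℓ lam (insert y S)) :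
    ∃ s < ℓ, ∃ A ∈ S.powersetCard s, ∃ B ∈ S.powersetCard (s + 1),
      takeBits lam y = ∑ x ∈ B, takeBits lam x - ∑ x ∈ A, takeBits lam x := by
  contrapose! hy
  rintro i hi S₁ h₁ S₂ h₂ rfl hcard
  refine ⟨fun hsum => hS.eq_of_sum_takeBits_eq h₁ h₂ hcard.symm hi hsum
    ⟨fun hy₁ => ?_, fun hy₂ => ?_⟩, fun h => by rw [h]⟩
  · by_contra hy₂
    obtain ⟨s, hs, A, hA, B, hB, h⟩ := exists_takeBits_eq_sub h₁ h₂ hcard.symm hi hsum hy₁ hy₂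
    exact hy s hs A hA B hB h
  · by_contra hy₁
    obtain ⟨s, hs, A, hA, B, hB, h⟩ :=
      exists_takeBits_eq_sub h₂ h₁ hcard (hcard.trans_le hi) hsum.symm hy₂ hy₁
    exact hy s hs A hA B hB h

lemma choose_mul_choose_succ_le {k s ℓ : ℕ} (hs : s < ℓ) :
    k.choose s * k.choose (s + 1) ≤ k ^ (2 * ℓ - 1) := by
  rcases Nat.eq_zero_or_pos k with rfl | hk
  · simp
  · calc k.choose s * k.choose (s + 1) ≤ k ^ s * k ^ (s + 1) :=
          Nat.mul_le_mul (Nat.choose_le_pow _ _) (Nat.choose_le_pow _ _)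
      _ = k ^ (2 * s + 1) := by rw [← pow_add]; congr 1; ring
      _ ≤ k ^ (2 * ℓ - 1) := Nat.pow_le_pow_right hk (by omega)

open Classical in
lemma card_not_strongCF_insert_le {ℓ lam : ℕ} (hlam : lam ≤ n) {S : Finset (BitString n)}
    (hS : StrongCF ℓ lam S) :
    (Finset.univ.filter fun y => ¬StrongCF ℓ lam (insert y S)).card ≤
      ℓ * S.card ^ (2 * ℓ - 1) * 2 ^ (n - lam) := by
  have hcover : (Finset.univ.filter fun y => ¬StrongCF ℓ lam (insert y S)) ⊆
      (Finset.range ℓ).biUnion fun s =>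
        (S.powersetCard s ×ˢ S.powersetCard (s + 1)).biUnion fun q =>
          Finset.univ.filter fun y : BitString n =>
            takeBits lam y = ∑ x ∈ q.2, takeBits lam x - ∑ x ∈ q.1, takeBits lam x := by
    intro y hy
    obtain ⟨s, hs, A, hA, B, hB, h⟩ :=
      exists_of_not_strongCF_insert hS (Finset.mem_filter.1 hy).2
    refine Finset.mem_biUnion.2 ⟨s, Finset.mem_range.2 hs, Finset.mem_biUnion.2
      ⟨(A, B), Finset.mem_product.2 ⟨hA, hB⟩, ?_⟩⟩
    simpa using h
  refine (Finset.card_le_card hcover).trans ?_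
  rw [mul_assoc]
  refine (Finset.card_biUnion_le_card_mul _ _ (S.card ^ (2 * ℓ - 1) * 2 ^ (n - lam))
    fun s hs => ?_).trans_eq (by rw [Finset.card_range])
  refine (Finset.card_biUnion_le_card_mul _ _ (2 ^ (n - lam)) fun q _ =>
    card_takeBits_fiber_le hlam _).trans (Nat.mul_le_mul_right _ ?_)
  rw [Finset.card_product, Finset.card_powersetCard, Finset.card_powersetCard]
  exact choose_mul_choose_succ_le (Finset.mem_range.1 hs)

lemma isInj_union_rel {g : RelPair n} (hd : Disjoint (outputs g 0) (outputs g 1)) :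
    IsInj (rel g 0 ∪ rel g 1) := by
  rw [← im_rel, ← im_rel] at hd
  rw [IsInj, Finset.coe_union, Set.injOn_union (Finset.disjoint_coe.2 hd.of_image_finset)]
  refine ⟨isInj_rel g 0, isInj_rel g 1, fun p hp q hq h => ?_⟩
  exact Finset.disjoint_left.1 hd (Finset.mem_image_of_mem _ hp)
    (h ▸ Finset.mem_image_of_mem _ hq)

lemma inCFDomain_of_strongCF {ℓ lam : ℕ} {g : RelPair n} (hc : StrongCF ℓ lam (jointOutputs g))
    (hd : Disjoint (outputs g 0) (outputs g 1)) (hcard : (jointOutputs g).card < 2 ^ n) :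
    InCFDomain ℓ lam g := by
  have hinj := isInj_union_rel hd
  refine ⟨⟨isInj_rel g 0, ?_⟩, ⟨isInj_rel g 1, ?_⟩, ⟨hinj, ?_⟩, ?_, ?_⟩
  · rw [im_rel]
    exact hc.subset Finset.subset_union_left
  · rw [im_rel]
    exact hc.subset Finset.subset_union_right
  · rwa [im_union_rel]
  · rw [← im_rel, ← im_rel] at hd
    exact hd.of_image_finset
  · rwa [← Finset.card_image_of_injOn hinj, ← im, im_union_rel]

end

/-! ### Collision-free against independent path recording -/

lemma card_mul_inv_sqrt_sq {k : ℕ} (hk : 0 < k) : (k : ℝ) * (Real.sqrt k)⁻¹ ^ 2 = 1 := by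
  have hk' : (0 : ℝ) < k := Nat.cast_pos.2 hk
  rw [inv_pow, Real.sq_sqrt hk'.le, mul_inv_cancel₀ hk'.ne']

lemma div_le_mul_inv_sqrt_mul_inv_sqrt {k l : ℕ} (hkl : k ≤ l) :
    (k : ℝ) / l ≤ k * ((Real.sqrt l)⁻¹ * (Real.sqrt k)⁻¹) := by
  rcases Nat.eq_zero_or_pos k with rfl | hk
  · simp
  · have hsqrt : Real.sqrt k ≤ Real.sqrt l := Real.sqrt_le_sqrt (by exact_mod_cast hkl)
    rw [div_eq_mul_inv]
    refine mul_le_mul_of_nonneg_left ?_ (Nat.cast_nonneg k)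
    calc (l : ℝ)⁻¹ = (Real.sqrt l)⁻¹ * (Real.sqrt l)⁻¹ := by
          rw [← mul_inv, Real.mul_self_sqrt (Nat.cast_nonneg l)]
      _ ≤ (Real.sqrt l)⁻¹ * (Real.sqrt k)⁻¹ := by
          gcongr

lemma sum_uniform_sub_sq_le {α : Type*} [DecidableEq α] {F Y : Finset α} (hY : Y ⊆ F)
    (hF : 0 < F.card) :
    ∑ y ∈ F, ((if y ∈ Y then (Real.sqrt Y.card)⁻¹ else 0) - (Real.sqrt F.card)⁻¹) ^ 2 ≤
      2 * ((F.card : ℝ) - Y.card) / F.card := by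
  set a := (Real.sqrt F.card)⁻¹
  set b := (Real.sqrt Y.card)⁻¹
  have hterm (y : α) : ((if y ∈ Y then b else 0) - a) ^ 2 =
      (if y ∈ Y then b ^ 2 - 2 * (a * b) else 0) + a ^ 2 := by
    split_ifs <;> ring
  have hsum : ∑ y ∈ F, ((if y ∈ Y then b else 0) - a) ^ 2 =
      Y.card * b ^ 2 - 2 * (Y.card * (a * b)) + 1 := by
    simp_rw [hterm]
    rw [Finset.sum_add_distrib, Finset.sum_ite_mem, Finset.inter_eq_right.2 hY, Finset.sum_const,
      Finset.sum_const, nsmul_eq_mul, nsmul_eq_mul, card_mul_inv_sqrt_sq hF]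
    ring
  have hYb : Y.card * b ^ 2 ≤ 1 := by
    rcases Nat.eq_zero_or_pos Y.card with h | h
    · simp [h]
    · exact (card_mul_inv_sqrt_sq h).le
  have hab : (Y.card : ℝ) / F.card ≤ Y.card * (a * b) :=
    div_le_mul_inv_sqrt_mul_inv_sqrt (Finset.card_le_card hY)
  rw [hsum, mul_div_assoc, sub_div, div_self (Nat.cast_pos.2 hF).ne']
  linarith

section
variable {n m : ℕ} {ℓ lam : ℕ}

lemma card_filter_none_le {g : RelPair n} (hlam : lam ≤ n) (hℓ : 1 ≤ ℓ)
    (hc : StrongCF ℓ lam (jointOutputs g)) (j : Fin 2) :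
    (Finset.univ.filter fun y => g (j, y) = none).card ≤ (CF ℓ lam (jointOutputs g)).card +
      2 * (ℓ * (jointOutputs g).card ^ (2 * ℓ - 1) * 2 ^ (n - lam)) := by
  classical
  set S := jointOutputs g
  have hcover : (Finset.univ.filter fun y => g (j, y) = none) ⊆
      CF ℓ lam S ∪ (S ∪ Finset.univ.filter fun y => ¬StrongCF ℓ lam (insert y S)) := by
    intro y _
    simp only [mem_CF, Finset.mem_union, Finset.mem_filter, Finset.mem_univ, true_and]
    tauto
  have hS : S.card ≤ ℓ * S.card ^ (2 * ℓ - 1) * 2 ^ (n - lam) :=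
    calc S.card ≤ S.card ^ (2 * ℓ - 1) := Nat.le_self_pow (by omega) _
      _ = 1 * S.card ^ (2 * ℓ - 1) * 1 := by ring
      _ ≤ _ := Nat.mul_le_mul (Nat.mul_le_mul_right _ hℓ) Nat.one_le_two_pow
  calc _ ≤ (CF ℓ lam S).card +
        (S.card + (Finset.univ.filter fun y => ¬StrongCF ℓ lam (insert y S)).card) :=
        (Finset.card_le_card hcover).trans <| (Finset.card_union_le _ _).trans <|
          Nat.add_le_add_left (Finset.card_union_le _ _) _
    _ ≤ (CF ℓ lam S).card + (ℓ * S.card ^ (2 * ℓ - 1) * 2 ^ (n - lam) +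
          ℓ * S.card ^ (2 * ℓ - 1) * 2 ^ (n - lam)) := by
        gcongr
        exact card_not_strongCF_insert_le hlam hc
    _ = _ := by ring

lemma outputs_subset_jointOutputs (g : RelPair n) (j : Fin 2) : outputs g j ⊆ jointOutputs g :=
  Fin.forall_fin_two (p := fun j => outputs g j ⊆ jointOutputs g).2
    ⟨Finset.subset_union_left, Finset.subset_union_right⟩ j

/-- The recorded pairs of relations that a collision-free path-recording view can contain after
`k` queries. -/
def IsCFRecord (ℓ lam k : ℕ) (g : RelPair n) : Prop :=
  StrongCF ℓ lam (jointOutputs g) ∧ Disjoint (outputs g 0) (outputs g 1) ∧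
    (jointOutputs g).card = k

lemma IsCFRecord.card_outputs_le {k : ℕ} {g : RelPair n} (hg : IsCFRecord ℓ lam k g)
    (j : Fin 2) : (outputs g j).card ≤ k :=
  (Finset.card_le_card (outputs_subset_jointOutputs g j)).trans_eq hg.2.2

lemma IsCFRecord.card_filter_none_sub_card_CF_le {k t : ℕ} {g : RelPair n}
    (hg : IsCFRecord ℓ lam k g) (hlam : lam ≤ n) (hℓ : 1 ≤ ℓ) (hk : k < t) (j : Fin 2) :
    ((Finset.univ.filter fun y => g (j, y) = none).card : ℝ) - (CF ℓ lam (jointOutputs g)).card ≤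
      2 * (ℓ * (t : ℝ) ^ (2 * ℓ) * 2 ^ (n - lam)) := by
  have hpow : (jointOutputs g).card ^ (2 * ℓ - 1) ≤ t ^ (2 * ℓ) := by
    rw [hg.2.2]
    exact (Nat.pow_le_pow_left hk.le _).trans (Nat.pow_le_pow_right (by omega) (by omega))
  have hle : (Finset.univ.filter fun y => g (j, y) = none).card ≤
      (CF ℓ lam (jointOutputs g)).card + 2 * (ℓ * t ^ (2 * ℓ) * 2 ^ (n - lam)) := by
    refine (card_filter_none_le hlam hℓ hg.1 j).trans ?_
    gcongr
  rw [sub_le_iff_le_add']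
  exact_mod_cast hle

lemma IsCFRecord.sum_cfWeight_sub_prWeight_sq_le {k t : ℕ} {g : RelPair n}
    (hg : IsCFRecord ℓ lam k g) (hlam : lam ≤ n) (hℓ : 1 ≤ ℓ) (ht : 2 * t ≤ 2 ^ n) (hk : k < t)
    (j : Fin 2) :
    ∑ y with g (j, y) = none, (cfWeight n ℓ lam j - prWeight n j) g y ^ 2 ≤
      8 * (ℓ * (t : ℝ) ^ (2 * ℓ) / 2 ^ lam) := by
  classical
  have hdom : InCFDomain ℓ lam g := inCFDomain_of_strongCF hg.1 hg.2.1 (by have := hg.2.2; omega)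
  set F := Finset.univ.filter fun y => g (j, y) = none
  set Y := CF ℓ lam (jointOutputs g)
  have hcardF : (F.card : ℝ) = 2 ^ n - (outputs g j).card := card_filter_none g j
  have hFlow : (2 : ℝ) ^ n / 2 ≤ F.card := by
    have ht' : 2 * (t : ℝ) ≤ 2 ^ n := by exact_mod_cast ht
    have hout : ((outputs g j).card : ℝ) ≤ t := by exact_mod_cast (hg.card_outputs_le j).trans hk.le
    linarith
  have hFpos : (0 : ℝ) < F.card := lt_of_lt_of_le (by positivity) hFlow
  have hweight (y : BitString n) : (cfWeight n ℓ lam j - prWeight n j) g y =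
      (if y ∈ Y then (Real.sqrt Y.card)⁻¹ else 0) - (Real.sqrt F.card)⁻¹ := by
    simp only [Pi.sub_apply, cfWeight, prWeight, hdom, true_and, hcardF, Y]
  simp_rw [hweight]
  refine (sum_uniform_sub_sq_le (CF_subset_filter_none ℓ lam g j)
    (by exact_mod_cast hFpos)).trans ?_
  rw [div_le_iff₀ hFpos]
  have hdiff := hg.card_filter_none_sub_card_CF_le hlam hℓ hk j
  have hsplit : (2 : ℝ) ^ n = 2 ^ (n - lam) * 2 ^ lam := by
    rw [← pow_add, Nat.sub_add_cancel hlam]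
  calc 2 * ((F.card : ℝ) - Y.card) ≤ 4 * (ℓ * (t : ℝ) ^ (2 * ℓ) * 2 ^ (n - lam)) := by linarith
    _ = 8 * (ℓ * (t : ℝ) ^ (2 * ℓ) / 2 ^ lam) * (2 ^ n / 2) := by
      rw [hsplit]
      field_simp
      ring
    _ ≤ _ := mul_le_mul_of_nonneg_left hFlow (by positivity)

lemma outputs_update_self (g : RelPair n) (j : Fin 2) (x y : BitString n) :
    outputs (Function.update g (j, y) (some x)) j = insert y (outputs g j) := by
  ext y'
  simp only [mem_outputs, Finset.mem_insert, Function.update_apply, Prod.mk.injEq, true_and]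
  by_cases hy : y' = y <;> simp [hy]

lemma outputs_update_of_ne (g : RelPair n) {j j' : Fin 2} (hj : j' ≠ j) (y : BitString n)
    (u : Option (BitString n)) :
    outputs (Function.update g (j, y) u) j' = outputs g j' := by
  ext y'
  simp [mem_outputs, hj]

lemma jointOutputs_update (g : RelPair n) (j : Fin 2) (x y : BitString n) :
    jointOutputs (Function.update g (j, y) (some x)) = insert y (jointOutputs g) := by
  obtain rfl | rfl : j = 0 ∨ j = 1 := by omega
  · rw [jointOutputs, outputs_update_self, outputs_update_of_ne g one_ne_zero,
      Finset.insert_union, jointOutputs]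
  · rw [jointOutputs, outputs_update_self, outputs_update_of_ne g zero_ne_one,
      Finset.union_insert, jointOutputs]

lemma disjoint_outputs_update {g : RelPair n} {y : BitString n} (j : Fin 2) (x : BitString n)
    (hd : Disjoint (outputs g 0) (outputs g 1)) (hy : y ∉ jointOutputs g) :
    Disjoint (outputs (Function.update g (j, y) (some x)) 0)
      (outputs (Function.update g (j, y) (some x)) 1) := by
  rw [jointOutputs, Finset.mem_union, not_or] at hy
  obtain rfl | rfl : j = 0 ∨ j = 1 := by omega
  · rw [outputs_update_self, outputs_update_of_ne g one_ne_zero, Finset.disjoint_insert_left]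
    exact ⟨hy.2, hd⟩
  · rw [outputs_update_self, outputs_update_of_ne g zero_ne_one, Finset.disjoint_insert_right]
    exact ⟨hy.1, hd⟩

lemma isCFRecord_none (ℓ lam : ℕ) : IsCFRecord ℓ lam 0 (fun _ => none : RelPair n) := by
  have houtputs (j : Fin 2) : outputs (fun _ => none : RelPair n) j = ∅ := by
    ext
    simp [mem_outputs]
  rw [IsCFRecord, jointOutputs, houtputs, houtputs]
  exact ⟨strongCF_empty _ _, by simp, by simp⟩

lemma supportedOn_initRec (ℓ lam : ℕ) : SupportedOn (IsCFRecord ℓ lam 0) (initRec n m) := by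
  intro p hp
  have hnone : p.2 = fun _ => none := by
    by_contra h
    simp [initRec, h] at hp
  rw [hnone]
  exact isCFRecord_none ℓ lam

lemma SupportedOn.recStep_cfWeight {k : ℕ} {ψ : (BitString n × BitString m) × RelPair n → ℂ}
    (hψ : SupportedOn (IsCFRecord ℓ lam k) ψ) (j : Fin 2) :
    SupportedOn (IsCFRecord ℓ lam (k + 1)) (recStep (cfWeight n ℓ lam j) j ψ) := by
  intro p hp
  obtain ⟨g, x, y, -, hpg, hw, q, hq⟩ := exists_of_recStep_ne_zero hp
  obtain ⟨-, hd, hcard⟩ : IsCFRecord ℓ lam k g := hψ _ hq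
  have hy : y ∈ CF ℓ lam (jointOutputs g) := by
    by_contra hy
    exact hw (if_neg fun h => hy h.2)
  obtain ⟨hyn, hyc⟩ := mem_CF.1 hy
  rw [hpg, IsCFRecord, jointOutputs_update, Finset.card_insert_of_notMem hyn, hcard]
  exact ⟨hyc, disjoint_outputs_update j x hd hyn, rfl⟩

lemma l2_recStep_cf_sub_recStep_pr_le {k t : ℕ} (hlam : lam ≤ n) (hℓ : 1 ≤ ℓ)
    (ht : 2 * t ≤ 2 ^ n) (hk : k < t) (j : Fin 2)
    {ψ : (BitString n × BitString m) × RelPair n → ℂ} (hψ : SupportedOn (IsCFRecord ℓ lam k) ψ)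
    (χ : (BitString n × BitString m) × RelPair n → ℂ) :
    l2 (recStep (cfWeight n ℓ lam j) j ψ - recStep (prWeight n j) j χ) ≤
      Real.sqrt (8 * (ℓ * (t : ℝ) ^ (2 * ℓ) / 2 ^ lam)) * l2 ψ + l2 (ψ - χ) := by
  have hsplit : recStep (cfWeight n ℓ lam j) j ψ - recStep (prWeight n j) j χ =
      recStep (cfWeight n ℓ lam j - prWeight n j) j ψ + recStep (prWeight n j) j (ψ - χ) := by
    rw [recStep_sub_left, recStep_sub]
    abel
  rw [hsplit]
  refine (l2_add_le _ _).trans (add_le_add ?_ (l2_recStep_le (sum_prWeight_sq_le j) _))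
  refine l2_recStep_le_of_supportedOn hψ (Real.sqrt_nonneg _) fun g hg => ?_
  rw [Real.sq_sqrt (by positivity)]
  exact hg.sum_cfWeight_sub_prWeight_sq_le hlam hℓ ht hk j

lemma l2_recView_cf_sub_recView_pr_le {t : ℕ} (hlam : lam ≤ n) (hℓ : 1 ≤ ℓ) (ht : 2 * t ≤ 2 ^ n)
    (𝒜 : Adversary n m t) :
    l2 (𝒜.recView (cfWeight n ℓ lam) - 𝒜.recView (prWeight n)) ≤
      t * Real.sqrt (8 * (ℓ * (t : ℝ) ^ (2 * ℓ) / 2 ^ lam)) := by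
  set ε := Real.sqrt (8 * (ℓ * (t : ℝ) ^ (2 * ℓ) / 2 ^ lam))
  refine (foldl_rel (fun k (ψ χ : (BitString n × BitString m) × RelPair n → ℂ) =>
    l2 (ψ - χ) ≤ k * ε ∧ l2 ψ ≤ 1 ∧ SupportedOn (IsCFRecord ℓ lam k) ψ) t _ _ _ _
    ⟨by simp [l2], l2_initRec.le, supportedOn_initRec ℓ lam⟩ ?_).1
  rintro i ψ χ ⟨hdiff, hle, hsupp⟩
  have hU := (𝒜.unitary i).2
  have hsupp' := hsupp.applyLocal (𝒜.unitary i).1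
  refine ⟨?_, ?_, hsupp'.recStep_cfWeight _⟩
  · calc _ ≤ ε * l2 (applyLocal (𝒜.unitary i).1 ψ) +
          l2 (applyLocal (𝒜.unitary i).1 ψ - applyLocal (𝒜.unitary i).1 χ) :=
          l2_recStep_cf_sub_recStep_pr_le hlam hℓ ht i.2 _ hsupp' _
      _ = ε * l2 ψ + l2 (ψ - χ) := by rw [← applyLocal_sub, l2_applyLocal hU, l2_applyLocal hU]
      _ ≤ ε * 1 + i * ε := by gcongr
      _ = (i + 1 : ℕ) * ε := by push_cast; ring
  · refine (l2_recStep_le (sum_cfWeight_sq_le ℓ lam _) _).trans ?_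
    rwa [l2_applyLocal hU]

/-- The error bound `√ℓ t^{ℓ+1} / 2^{lam/2}`. -/
def cfError (ℓ lam t : ℕ) : ℝ := Real.sqrt ℓ * (t : ℝ) ^ (ℓ + 1) / (2 : ℝ) ^ ((lam : ℝ) / 2)

lemma two_rpow_half (k : ℕ) : (2 : ℝ) ^ ((k : ℝ) / 2) = Real.sqrt (2 ^ k) := by
  rw [Real.sqrt_eq_rpow, ← Real.rpow_natCast, ← Real.rpow_mul (by norm_num)]
  congr 1
  ring

lemma cfError_nonneg (ℓ lam t : ℕ) : 0 ≤ cfError ℓ lam t := by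
  unfold cfError
  positivity

lemma sq_div_sqrt_le_cfError (t : ℕ) (hlam : lam ≤ n) (hℓ : 1 ≤ ℓ) :
    (t : ℝ) ^ 2 / Real.sqrt (2 ^ n) ≤ cfError ℓ lam t := by
  unfold cfError
  rw [two_rpow_half]
  have hden : Real.sqrt ((2 : ℝ) ^ lam) ≤ Real.sqrt (2 ^ n) :=
    Real.sqrt_le_sqrt (pow_le_pow_right₀ (by norm_num) hlam)
  have hnum : (t : ℝ) ^ 2 ≤ Real.sqrt ℓ * (t : ℝ) ^ (ℓ + 1) := by
    rcases Nat.eq_zero_or_pos t with rfl | ht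
    · simp
    · have hsqrt : (1 : ℝ) ≤ Real.sqrt ℓ := Real.one_le_sqrt.2 (by exact_mod_cast hℓ)
      calc (t : ℝ) ^ 2 ≤ (t : ℝ) ^ (ℓ + 1) :=
            pow_le_pow_right₀ (by exact_mod_cast ht) (by omega)
        _ ≤ Real.sqrt ℓ * (t : ℝ) ^ (ℓ + 1) := le_mul_of_one_le_left (by positivity) hsqrt
  exact div_le_div₀ (by positivity) hnum (by positivity) hden

lemma one_le_two_mul_sq_div_sqrt {t : ℕ} (h : 2 ^ n ≤ 2 * t) :
    1 ≤ 2 * ((t : ℝ) ^ 2 / Real.sqrt (2 ^ n)) := by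
  have ht : 0 < t := by
    have := Nat.two_pow_pos n
    omega
  rw [← mul_div_assoc, one_le_div (by positivity)]
  calc Real.sqrt ((2 : ℝ) ^ n) ≤ 2 ^ n := by
        rw [Real.sqrt_le_left (by positivity)]
        exact le_self_pow₀ (one_le_pow₀ (by norm_num)) two_ne_zero
    _ ≤ 2 * t := by exact_mod_cast h
    _ ≤ 2 * (t : ℝ) ^ 2 := by
        gcongr
        exact le_self_pow₀ (by exact_mod_cast ht) two_ne_zero

lemma mul_sqrt_eq_sqrt_eight_mul_cfError (ℓ lam t : ℕ) :
    t * Real.sqrt (8 * (ℓ * (t : ℝ) ^ (2 * ℓ) / 2 ^ lam)) = Real.sqrt 8 * cfError ℓ lam t := by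
  rw [Real.sqrt_mul (by norm_num), Real.sqrt_div (by positivity), Real.sqrt_mul (by positivity),
    mul_comm 2 ℓ, pow_mul, Real.sqrt_sq (by positivity), cfError, two_rpow_half, pow_succ]
  ring

/- For `2t > N` the right-hand side exceeds the trivial bound. -/
lemma norm_trace_cf_sub_pr_le {t : ℕ} (hlam : lam ≤ n) (hℓ : 1 ≤ ℓ) (𝒜 : Adversary n m t)
    {W : Matrix (BitString n × BitString m) (BitString n × BitString m) ℂ}
    (hW : W ∈ Matrix.unitaryGroup (BitString n × BitString m) ℂ) :
    ‖(W * reducedState (𝒜.recView (cfWeight n ℓ lam))).trace -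
      (W * reducedState (𝒜.recView (prWeight n))).trace‖ ≤ 2 * (4 * cfError ℓ lam t) := by
  set ψ := 𝒜.recView (cfWeight n ℓ lam)
  set χ := 𝒜.recView (prWeight n)
  have hψ : l2 ψ ≤ 1 := l2_recView_le 𝒜 (sum_cfWeight_sq_le ℓ lam)
  have hχ : l2 χ ≤ 1 := l2_recView_le 𝒜 sum_prWeight_sq_le
  have hdiff : l2 (ψ - χ) ≤ 4 * cfError ℓ lam t := by
    rcases le_total (2 * t) (2 ^ n) with ht | ht
    · refine (l2_recView_cf_sub_recView_pr_le hlam hℓ ht 𝒜).trans ?_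
      rw [mul_sqrt_eq_sqrt_eight_mul_cfError]
      refine mul_le_mul_of_nonneg_right ?_ (cfError_nonneg _ _ _)
      rw [Real.sqrt_le_left (by norm_num)]
      norm_num
    · calc l2 (ψ - χ) ≤ 1 + 1 := (l2_sub_le ψ χ).trans (add_le_add hψ hχ)
        _ ≤ 4 * ((t : ℝ) ^ 2 / Real.sqrt (2 ^ n)) := by
            linarith [one_le_two_mul_sq_div_sqrt ht]
        _ ≤ 4 * cfError ℓ lam t := by gcongr; exact sq_div_sqrt_le_cfError t hlam hℓ
  calc _ ≤ (l2 ψ + l2 χ) * l2 (ψ - χ) := norm_trace_mul_reducedState_sub_le hW ψ χ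
    _ ≤ (1 + 1) * (4 * cfError ℓ lam t) := by
        gcongr
        exact l2_nonneg _
    _ = 2 * (4 * cfError ℓ lam t) := by ring

end

/-! ### Tensor powers of matrices -/

section
variable {I κ : Type*}

/-- The tensor product of a family of matrices. -/
def tensor [Fintype I] (M : I → Matrix κ κ ℂ) : Matrix (I → κ) (I → κ) ℂ :=
  Matrix.of fun g h => ∏ i, M i (g i) (h i)

section
variable [Fintype I]

lemma star_tensor (M : I → Matrix κ κ ℂ) : star (tensor M) = tensor fun i => star (M i) := by
  ext g h
  simp [tensor, Matrix.star_apply]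

lemma tensor_mul [DecidableEq I] [Fintype κ] (M M' : I → Matrix κ κ ℂ) :
    tensor M * tensor M' = tensor fun i => M i * M' i := by
  ext g h
  simp only [Matrix.mul_apply, tensor, Matrix.of_apply, ← Finset.prod_mul_distrib]
  rw [Finset.prod_univ_sum, Fintype.piFinset_univ]

lemma tensor_one [DecidableEq κ] : tensor (fun _ : I => (1 : Matrix κ κ ℂ)) = 1 := by
  ext g h
  simp only [tensor, Matrix.of_apply, Matrix.one_apply]
  rw [Fintype.prod_ite_zero]
  simp [funext_iff]

lemma tensor_mem_unitaryGroup [DecidableEq I] [Fintype κ] [DecidableEq κ] {M : I → Matrix κ κ ℂ}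
    (hM : ∀ i, M i ∈ Matrix.unitaryGroup κ ℂ) : tensor M ∈ Matrix.unitaryGroup (I → κ) ℂ := by
  rw [Matrix.mem_unitaryGroup_iff, star_tensor, tensor_mul, ← tensor_one]
  congr 1
  funext i
  exact Matrix.mem_unitaryGroup_iff.1 (hM i)

end

/-- The extension of a matrix by the identity on an additional basis vector `none`. -/
def liftOpt (C : Matrix κ κ ℂ) : Matrix (Option κ) (Option κ) ℂ :=
  Matrix.of fun a b => a.elim (b.elim 1 fun _ => 0) fun x => b.elim 0 fun y => C x y

@[simp] lemma liftOpt_none_none (C : Matrix κ κ ℂ) : liftOpt C none none = 1 := rfl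
@[simp] lemma liftOpt_none_some (C : Matrix κ κ ℂ) (y : κ) : liftOpt C none (some y) = 0 := rfl
@[simp] lemma liftOpt_some_none (C : Matrix κ κ ℂ) (x : κ) : liftOpt C (some x) none = 0 := rfl
@[simp] lemma liftOpt_some_some (C : Matrix κ κ ℂ) (x y : κ) :
    liftOpt C (some x) (some y) = C x y := rfl

lemma eq_none_iff_of_liftOpt_ne_zero {C : Matrix κ κ ℂ} {a b : Option κ}
    (h : liftOpt C a b ≠ 0) : a = none ↔ b = none := by
  cases a <;> cases b <;> simp_all

lemma star_liftOpt (C : Matrix κ κ ℂ) : star (liftOpt C) = liftOpt (star C) := by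
  ext a b
  cases a <;> cases b <;> simp [Matrix.star_apply]

lemma liftOpt_mul [Fintype κ] (C D : Matrix κ κ ℂ) :
    liftOpt C * liftOpt D = liftOpt (C * D) := by
  ext a b
  rw [Matrix.mul_apply, Fintype.sum_option]
  cases a <;> cases b <;> simp [Matrix.mul_apply]

lemma liftOpt_one [DecidableEq κ] : liftOpt (1 : Matrix κ κ ℂ) = 1 := by
  ext a b
  cases a <;> cases b <;> simp [Matrix.one_apply]

lemma liftOpt_mem_unitaryGroup [Fintype κ] [DecidableEq κ] {C : Matrix κ κ ℂ}
    (hC : C ∈ Matrix.unitaryGroup κ ℂ) :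
    liftOpt C ∈ Matrix.unitaryGroup (Option κ) ℂ := by
  rw [Matrix.mem_unitaryGroup_iff, star_liftOpt, liftOpt_mul, Matrix.mem_unitaryGroup_iff.1 hC,
    liftOpt_one]

end

/-! ### Twirling the queries -/

section
variable {n m : ℕ}

/-- An operator on the register `E`, applied to a state on `ABE` (identity on `AB`). -/
def applyRec {E : Type} [Fintype E] (V : Matrix E E ℂ)
    (ψ : (BitString n × BitString m) × E → ℂ) : (BitString n × BitString m) × E → ℂ :=
  fun p => (V *ᵥ fun h => ψ (p.1, h)) p.2

section
variable {E : Type} [Fintype E]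

lemma applyLocal_applyRec (V : Matrix E E ℂ)
    (U : Matrix (BitString n × BitString m) (BitString n × BitString m) ℂ)
    (ψ : (BitString n × BitString m) × E → ℂ) :
    applyLocal U (applyRec V ψ) = applyRec V (applyLocal U ψ) := by
  funext p
  simp only [applyLocal, applyRec, Matrix.mulVec, dotProduct, Finset.mul_sum]
  rw [Finset.sum_comm]
  refine Finset.sum_congr rfl fun a _ => Finset.sum_congr rfl fun b _ => ?_
  ring

lemma applyRec_mul (V V' : Matrix E E ℂ) (ψ : (BitString n × BitString m) × E → ℂ) :
    applyRec (V * V') ψ = applyRec V (applyRec V' ψ) := by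
  funext p
  simp only [applyRec, ← Matrix.mulVec_mulVec]

lemma reducedState_applyRec [DecidableEq E] {V : Matrix E E ℂ}
    (hV : V ∈ Matrix.unitaryGroup E ℂ) (ψ : (BitString n × BitString m) × E → ℂ) :
    reducedState (applyRec V ψ) = reducedState ψ := by
  ext p q
  have hVV : Vᴴ * V = 1 := Matrix.mem_unitaryGroup_iff'.1 hV
  have hdot (a b : E → ℂ) : ∑ e, a e * star (b e) = star b ⬝ᵥ a :=
    Finset.sum_congr rfl fun e _ => mul_comm _ _
  simp only [reducedState, Matrix.of_apply, applyRec]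
  rw [hdot, hdot, Matrix.star_mulVec, ← Matrix.dotProduct_mulVec, Matrix.mulVec_mulVec, hVV,
    Matrix.one_mulVec]

end

/-- The operator acting by `C j` on each of the inputs recorded in the `j`-th relation. -/
def onRec (C : Fin 2 → Matrix (BitString n) (BitString n) ℂ) : Matrix (RelPair n) (RelPair n) ℂ :=
  tensor fun i => liftOpt (C i.1)

lemma onRec_mul (C D : Fin 2 → Matrix (BitString n) (BitString n) ℂ) :
    onRec C * onRec D = onRec fun j => C j * D j := by
  simp only [onRec, tensor_mul, liftOpt_mul]

lemma onRec_mem_unitaryGroup {C : Fin 2 → Matrix (BitString n) (BitString n) ℂ}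
    (hC : ∀ j, C j ∈ Matrix.unitaryGroup (BitString n) ℂ) :
    onRec C ∈ Matrix.unitaryGroup (RelPair n) ℂ :=
  tensor_mem_unitaryGroup fun i => liftOpt_mem_unitaryGroup (hC i.1)

lemma applyRec_onRec_initRec (C : Fin 2 → Matrix (BitString n) (BitString n) ℂ) :
    applyRec (onRec C) (initRec n m) = initRec n m := by
  funext ⟨p, g⟩
  simp only [applyRec, Matrix.mulVec, dotProduct, initRec]
  by_cases hp : p = 0
  · simp only [hp, mul_ite, mul_one, mul_zero, Finset.sum_ite_eq', Finset.mem_univ, if_true]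
    split_ifs with hg
    · subst hg
      simp [onRec, tensor]
    · obtain ⟨i, hi⟩ := Function.ne_iff.1 hg
      obtain ⟨u, hu⟩ := Option.ne_none_iff_exists'.1 hi
      refine Finset.prod_eq_zero (Finset.mem_univ i) ?_
      simp [hu]
  · simp [hp]

/-- The entry of `onRec C` without the tensor factor at `i`. -/
def onRecOff (C : Fin 2 → Matrix (BitString n) (BitString n) ℂ) (i : Fin 2 × BitString n)
    (g h : RelPair n) : ℂ :=
  ∏ k ∈ Finset.univ.erase i, liftOpt (C k.1) (g k) (h k)

section
variable (C : Fin 2 → Matrix (BitString n) (BitString n) ℂ) (i : Fin 2 × BitString n)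
  (g h : RelPair n)

lemma onRec_apply : onRec C g h = liftOpt (C i.1) (g i) (h i) * onRecOff C i g h :=
  (Finset.mul_prod_erase _ _ (Finset.mem_univ i)).symm

lemma onRecOff_update_left (u : Option (BitString n)) :
    onRecOff C i (Function.update g i u) h = onRecOff C i g h :=
  Finset.prod_congr rfl fun k hk => by rw [Function.update_of_ne (Finset.ne_of_mem_erase hk)]

lemma onRecOff_update_right (u : Option (BitString n)) :
    onRecOff C i g (Function.update h i u) = onRecOff C i g h :=
  Finset.prod_congr rfl fun k hk => by rw [Function.update_of_ne (Finset.ne_of_mem_erase hk)]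

variable {C i g h}

lemma update_eq_none_iff_of_onRecOff_ne_zero (hoff : onRecOff C i g h ≠ 0) (hi : h i = none)
    (k : Fin 2 × BitString n) : Function.update g i none k = none ↔ h k = none := by
  by_cases hk : k = i
  · simp [hk, hi]
  · rw [Function.update_of_ne hk]
    exact eq_none_iff_of_liftOpt_ne_zero
      (Finset.prod_ne_zero_iff.1 hoff k (Finset.mem_erase.2 ⟨hk, Finset.mem_univ _⟩))

end

/-- The operator `C ⊗ 1` on `AB`. -/
def onA (m : ℕ) (C : Matrix (BitString n) (BitString n) ℂ) :
    Matrix (BitString n × BitString m) (BitString n × BitString m) ℂ :=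
  Matrix.kronecker C 1

lemma onA_mem_unitaryGroup {C : Matrix (BitString n) (BitString n) ℂ}
    (hC : C ∈ Matrix.unitaryGroup (BitString n) ℂ) :
    onA m C ∈ Matrix.unitaryGroup (BitString n × BitString m) ℂ :=
  Matrix.kronecker_mem_unitary hC (one_mem _)

lemma applyLocal_onA {E : Type} (C : Matrix (BitString n) (BitString n) ℂ)
    (ψ : (BitString n × BitString m) × E → ℂ) (p : (BitString n × BitString m) × E) :
    applyLocal (onA m C) ψ p = ∑ x, C p.1.1 x * ψ ((x, p.1.2), p.2) := by
  simp only [applyLocal, onA, Fintype.sum_prod_type]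
  refine Finset.sum_congr rfl fun x _ => ?_
  rw [Finset.sum_eq_single p.1.2]
  · simp [Matrix.kronecker, Matrix.kroneckerMap_apply]
  · intro b _ hb
    simp [Matrix.kronecker, Matrix.kroneckerMap_apply, hb.symm]
  · simp

lemma applyRec_onRec_recStep_apply (w : RelPair n → BitString n → ℝ) (j : Fin 2)
    (C : Fin 2 → Matrix (BitString n) (BitString n) ℂ)
    (ψ : (BitString n × BitString m) × RelPair n → ℂ) (y : BitString n) (b : BitString m)
    (g : RelPair n) :
    applyRec (onRec C) (recStep w j ψ) ((y, b), g) =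
      ∑ h : RelPair n, if h (j, y) = none then
        ∑ x, liftOpt (C j) (g (j, y)) (some x) * onRecOff C (j, y) g h *
          (w h y * ψ ((x, b), h)) else 0 := by
  simp only [applyRec, Matrix.mulVec, dotProduct]
  rw [sum_eq_sum_update (j, y) none]
  refine Finset.sum_congr rfl fun h _ => ?_
  split_ifs with hh
  · have hupdate : Function.update h (j, y) none = h := by rw [← hh, Function.update_eq_self]
    rw [Fintype.sum_option]
    simp only [recStep, onRec_apply C (j, y), onRecOff_update_right, Function.update_self,
      Option.elim, Function.update_idem, hupdate, mul_zero, zero_add, hh]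
  · rfl

lemma recStep_onRec {w : RelPair n → BitString n → ℝ}
    (hw : ∀ g h : RelPair n, (∀ i, g i = none ↔ h i = none) → ∀ y, w g y = w h y) (j : Fin 2)
    (C : Fin 2 → Matrix (BitString n) (BitString n) ℂ)
    (ψ : (BitString n × BitString m) × RelPair n → ℂ) :
    recStep w j (applyLocal (onA m (C j)) (applyRec (onRec C) ψ)) =
      applyRec (onRec C) (recStep w j ψ) := by
  funext ⟨⟨y, b⟩, g⟩
  rw [applyRec_onRec_recStep_apply]
  simp only [recStep]
  rcases g (j, y) with _ | x₀
  · simp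
  simp only [Option.elim, applyLocal_onA, applyRec, Matrix.mulVec, dotProduct,
    onRec_apply C (j, y), onRecOff_update_left, Function.update_self, Finset.mul_sum]
  rw [Finset.sum_comm]
  refine Finset.sum_congr rfl fun h _ => ?_
  split_ifs with hh
  · refine Finset.sum_congr rfl fun x _ => ?_
    rw [hh]
    by_cases hoff : onRecOff C (j, y) g h = 0
    · simp [hoff]
    · rw [hw _ h (update_eq_none_iff_of_onRecOff_ne_zero hoff hh) y, liftOpt_none_none,
        liftOpt_some_some]
      ring
  · obtain ⟨u, hu⟩ := Option.ne_none_iff_exists'.1 hh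
    exact Finset.sum_eq_zero fun x _ => by simp [hu]

/-- The adversary that applies `C j` to the query register before each query to oracle `j`. -/
def Adversary.twist {t : ℕ} (𝒜 : Adversary n m t)
    (C : Fin 2 → Matrix.unitaryGroup (BitString n) ℂ) : Adversary n m t where
  query := 𝒜.query
  unitary i := ⟨onA m (C (𝒜.query i)).1, onA_mem_unitaryGroup (C (𝒜.query i)).2⟩ * 𝒜.unitary i

lemma outputs_congr {g h : RelPair n} (hgh : ∀ i, g i = none ↔ h i = none) (j : Fin 2) :
    outputs g j = outputs h j := by
  ext y
  simp [mem_outputs, hgh]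

lemma recView_twist {t : ℕ} (𝒜 : Adversary n m t)
    (C : Fin 2 → Matrix.unitaryGroup (BitString n) ℂ) :
    (𝒜.twist C).recView (prWeight n) =
      applyRec (onRec fun j => (C j).1) (𝒜.recView (prWeight n)) := by
  refine foldl_rel (fun _ a b => a = applyRec (onRec fun j => (C j).1) b) t _ _ _ _ ?_ ?_
  · rw [applyRec_onRec_initRec]
  · rintro i a b rfl
    rw [← recStep_onRec, ← applyLocal_applyRec, ← applyLocal_mul]
    · rfl
    · intro g h hgh y
      simp only [prWeight, outputs_congr hgh]

lemma reducedState_recView_twist {t : ℕ} (𝒜 : Adversary n m t)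
    (C : Fin 2 → Matrix.unitaryGroup (BitString n) ℂ) :
    reducedState ((𝒜.twist C).recView (prWeight n)) =
      reducedState (𝒜.recView (prWeight n)) := by
  rw [recView_twist, reducedState_applyRec (onRec_mem_unitaryGroup fun j => (C j).2)]

end

/-! ### Random phases -/

section
variable {N : ℕ} [NeZero N] {X : Type*} [Fintype X]

variable (N X) in
/-- The character table of the group `X → ZMod N`. -/
def charTable : Matrix (X → ZMod N) (X → ZMod N) ℂ :=
  Matrix.of fun k v => ZMod.stdAddChar (k ⬝ᵥ v)

lemma norm_charTable_apply (k v : X → ZMod N) : ‖charTable N X k v‖ = 1 :=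
  AddChar.norm_apply (ZMod.stdAddChar (N := N)) (k ⬝ᵥ v)

lemma star_charTable_mul_charTable (k v v' : X → ZMod N) :
    star (charTable N X k v) * charTable N X k v' =
      ∏ x, (ZMod.stdAddChar (k x * (v' - v) x) : ℂ) := by
  simp only [charTable, Matrix.of_apply]
  rw [Complex.star_def, ← AddChar.map_neg_eq_conj, ← AddChar.map_add_eq_mul, neg_add_eq_sub,
    ← dotProduct_sub, dotProduct]
  exact (congrArg _ (ofAdd_sum _ _)).trans (map_prod (ZMod.stdAddChar (N := N)).toMonoidHom _ _)

lemma charTable_conjTranspose_mul_self [DecidableEq X] :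
    (charTable N X)ᴴ * charTable N X = (Fintype.card (X → ZMod N) : ℂ) • 1 := by
  ext v v'
  have hsum (x : X) : ∑ a : ZMod N, (ZMod.stdAddChar (a * (v' - v) x) : ℂ) =
      if v x = v' x then (N : ℂ) else 0 := by
    rw [AddChar.sum_mulShift _ (ZMod.isPrimitive_stdAddChar N), ZMod.card, Pi.sub_apply]
    simp only [sub_eq_zero, eq_comm, Nat.cast_ite, Nat.cast_zero]
  simp only [Matrix.mul_apply, Matrix.conjTranspose_apply, star_charTable_mul_charTable]
  rw [← Fintype.piFinset_univ, ← Finset.prod_univ_sum (fun _ => Finset.univ)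
    fun x a => (ZMod.stdAddChar (a * (v' - v) x) : ℂ)]
  simp only [hsum]
  rw [Fintype.prod_ite_zero]
  simp [Matrix.one_apply, funext_iff]

lemma sum_norm_sq_charTable_mulVec [DecidableEq X] (b : (X → ZMod N) → ℂ) :
    ∑ k, ‖(charTable N X *ᵥ b) k‖ ^ 2 = Fintype.card (X → ZMod N) * ∑ v, ‖b v‖ ^ 2 := by
  rw [← Complex.ofReal_inj, ofReal_sum_norm_sq, Complex.ofReal_mul, ofReal_sum_norm_sq,
    Matrix.star_mulVec, ← Matrix.dotProduct_mulVec, Matrix.mulVec_mulVec,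
    charTable_conjTranspose_mul_self, Matrix.smul_mulVec, Matrix.one_mulVec, dotProduct_smul,
    smul_eq_mul, Complex.ofReal_natCast]

lemma sum_norm_sq_sum_mul_charTable_le [DecidableEq X] {Q : Type*} [Fintype Q] {c : ℕ}
    {e : Q → X → ZMod N} (he : ∀ v, (Finset.univ.filter fun q => e q = v).card ≤ c) (a : Q → ℂ) :
    ∑ k, ‖∑ q, a q * charTable N X k (e q)‖ ^ 2 ≤
      Fintype.card (X → ZMod N) * (c * ∑ q, ‖a q‖ ^ 2) := by
  have hgroup (k : X → ZMod N) : ∑ q, a q * charTable N X k (e q) =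
      (charTable N X *ᵥ fun v => ∑ q with e q = v, a q) k := by
    rw [← Finset.sum_fiberwise Finset.univ e]
    refine Finset.sum_congr rfl fun v _ => ?_
    rw [mul_comm, Finset.sum_mul]
    exact Finset.sum_congr rfl fun q hq => by rw [(Finset.mem_filter.1 hq).2]
  have hfiber (v : X → ZMod N) :
      ‖∑ q with e q = v, a q‖ ^ 2 ≤ c * ∑ q with e q = v, ‖a q‖ ^ 2 :=
    calc ‖∑ q with e q = v, a q‖ ^ 2 ≤ (∑ q with e q = v, ‖a q‖) ^ 2 := by
          gcongr
          exact norm_sum_le _ _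
      _ ≤ (Finset.univ.filter fun q => e q = v).card * ∑ q with e q = v, ‖a q‖ ^ 2 :=
          sq_sum_le_card_mul_sum_sq
      _ ≤ c * ∑ q with e q = v, ‖a q‖ ^ 2 := by
          gcongr
          exact he v
  simp only [hgroup]
  rw [sum_norm_sq_charTable_mulVec, ← Finset.sum_fiberwise Finset.univ e fun q => ‖a q‖ ^ 2,
    Finset.mul_sum (a := (c : ℝ))]
  gcongr
  exact hfiber _

end

section
variable {X : Type*} [DecidableEq X]

lemma eq_or_eq_swap_of_single_add_single_eq {q q' : X × X}
    (h : (Pi.single q.1 1 + Pi.single q.2 1 : X → ZMod 3) = Pi.single q'.1 1 + Pi.single q'.2 1) :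
    q = q' ∨ q = q'.swap := by
  have h₁ := congrFun h q.1
  have h₂ := congrFun h q.2
  simp only [Pi.add_apply, Pi.single_apply] at h₁ h₂
  obtain ⟨u, v⟩ := q
  obtain ⟨u', v'⟩ := q'
  simp only [Prod.mk.injEq, Prod.swap_prod_mk] at *
  have hne : (1 : ZMod 3) ≠ 0 ∧ (1 + 1 : ZMod 3) ≠ 0 ∧ (1 + 1 : ZMod 3) ≠ 1 := by decide
  revert hne
  grind only

lemma card_filter_single_add_single_le [Fintype X] (v : X → ZMod 3) :
    (Finset.univ.filter fun q : X × X =>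
      (Pi.single q.1 1 + Pi.single q.2 1 : X → ZMod 3) = v).card ≤ 2 := by
  rcases Finset.eq_empty_or_nonempty (Finset.univ.filter fun q : X × X =>
    (Pi.single q.1 1 + Pi.single q.2 1 : X → ZMod 3) = v) with hempty | ⟨q₀, hq₀⟩
  · simp [hempty]
  · refine (Finset.card_le_card (t := {q₀, q₀.swap}) fun q hq => ?_).trans Finset.card_le_two
    rw [Finset.mem_insert, Finset.mem_singleton]
    exact eq_or_eq_swap_of_single_add_single_eq
      ((Finset.mem_filter.1 hq).2.trans (Finset.mem_filter.1 hq₀).2.symm)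

/- Cubic phases: the monomials `k u * k v` of two distinct unordered pairs are distinct characters,
also when `u = v`, which fails for signs. -/
lemma sum_norm_sq_sum_mul_cubic_le [Fintype X] (a : X × X → ℂ) :
    ∑ k : X → ZMod 3,
        ‖∑ q : X × X, a q * (ZMod.stdAddChar (k q.1) * ZMod.stdAddChar (k q.2))‖ ^ 2 ≤
      Fintype.card (X → ZMod 3) * (2 * ∑ q, ‖a q‖ ^ 2) := by
  have hchar (k : X → ZMod 3) (q : X × X) :
      (ZMod.stdAddChar (k q.1) * ZMod.stdAddChar (k q.2) : ℂ) =
        charTable 3 X k (Pi.single q.1 1 + Pi.single q.2 1) := by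
    simp [charTable, dotProduct_add, AddChar.map_add_eq_mul]
  simp only [hchar]
  exact sum_norm_sq_sum_mul_charTable_le card_filter_single_add_single_le a

end

/-! ### The Hadamard transform with random phases -/

/-- The Hadamard transform on `n` qubits. -/
def hadamardTransform (n : ℕ) : Matrix (BitString n) (BitString n) ℂ :=
  ((Real.sqrt (2 ^ n) : ℝ) : ℂ)⁻¹ • charTable 2 (Fin n)

lemma norm_sq_hadamardTransform_apply {n : ℕ} (x y : BitString n) :
    ‖hadamardTransform n x y‖ ^ 2 = ((2 : ℝ) ^ n)⁻¹ := by
  rw [hadamardTransform, Matrix.smul_apply, norm_smul, norm_charTable_apply, mul_one, norm_inv,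
    Complex.norm_real, Real.norm_eq_abs, inv_pow, sq_abs, Real.sq_sqrt (by positivity)]

lemma hadamardTransform_mem_unitaryGroup (n : ℕ) :
    hadamardTransform n ∈ Matrix.unitaryGroup (BitString n) ℂ := by
  have hsqrt : ((Real.sqrt (2 ^ n) : ℝ) : ℂ) * (Real.sqrt (2 ^ n) : ℝ) = 2 ^ n := by
    rw [← Complex.ofReal_mul, Real.mul_self_sqrt (by positivity)]
    push_cast
    rfl
  rw [Matrix.mem_unitaryGroup_iff', Matrix.star_eq_conjTranspose, hadamardTransform,
    Matrix.conjTranspose_smul, Matrix.smul_mul, Matrix.mul_smul, charTable_conjTranspose_mul_self,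
    smul_smul, smul_smul, card_bitString, Complex.star_def, map_inv₀, Complex.conj_ofReal,
    Nat.cast_pow, Nat.cast_ofNat, ← hsqrt]
  have hne : ((Real.sqrt (2 ^ n) : ℝ) : ℂ) ≠ 0 := by
    rw [Complex.ofReal_ne_zero]
    positivity
  field_simp
  exact one_smul _ _

lemma diagonal_mem_unitaryGroup {α : Type*} [Fintype α] [DecidableEq α] {d : α → ℂ}
    (hd : ∀ a, ‖d a‖ = 1) : Matrix.diagonal d ∈ Matrix.unitaryGroup α ℂ := by
  rw [Matrix.mem_unitaryGroup_iff', Matrix.star_eq_conjTranspose, Matrix.diagonal_conjTranspose,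
    Matrix.diagonal_mul_diagonal, ← Matrix.diagonal_one]
  congr 1
  funext a
  rw [Pi.star_apply, Complex.star_def, Complex.conj_mul', hd]
  simp

/-- The Hadamard transform after the diagonal matrix with cubic phases `k`. -/
def phasedHadamard {n : ℕ} (k : BitString n → ZMod 3) : Matrix.unitaryGroup (BitString n) ℂ :=
  ⟨hadamardTransform n * Matrix.diagonal fun x => ZMod.stdAddChar (k x),
    mul_mem (hadamardTransform_mem_unitaryGroup n)
      (diagonal_mem_unitaryGroup fun x => AddChar.norm_apply _ (k x))⟩

lemma phasedHadamard_apply {n : ℕ} (k : BitString n → ZMod 3) (x y : BitString n) :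
    (phasedHadamard k).1 x y = hadamardTransform n x y * ZMod.stdAddChar (k y) :=
  Matrix.mul_diagonal _ _ _ _

/-! ### Collisions after a random twirl -/

section
variable {I κ : Type*} [Fintype I] [DecidableEq κ]

lemma apply_eq_of_tensor_ne_zero {M : I → Matrix κ κ ℂ} {g h : I → κ} (hM : tensor M g h ≠ 0)
    {i : I} (hi : M i = 1) : g i = h i := by
  by_contra hne
  exact Finset.prod_ne_zero_iff.1 hM i (Finset.mem_univ i) (by rw [hi, Matrix.one_apply_ne hne])

variable [DecidableEq I] [Fintype κ]

lemma tensor_mulVec_ite {M : I → Matrix κ κ ℂ} {P : (I → κ) → Prop} [DecidablePred P]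
    (hP : ∀ g h : I → κ, (∀ i, M i = 1 → g i = h i) → (P g ↔ P h)) (c : (I → κ) → ℂ)
    (g : I → κ) :
    (tensor M *ᵥ fun h => if P h then c h else 0) g = if P g then (tensor M *ᵥ c) g else 0 := by
  rw [← mul_one ((tensor M *ᵥ c) g), ← mul_ite_zero, Matrix.mulVec, Matrix.mulVec, dotProduct,
    dotProduct, Finset.sum_mul]
  refine Finset.sum_congr rfl fun h _ => ?_
  by_cases hgh : tensor M g h = 0
  · simp [hgh]
  · simp [hP g h fun _ => apply_eq_of_tensor_ne_zero hgh]

lemma sum_ite_norm_sq_tensor_mulVec {M : I → Matrix κ κ ℂ}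
    (hM : ∀ i, M i ∈ Matrix.unitaryGroup κ ℂ) (J : Finset I) {P : (I → κ) → Prop}
    [DecidablePred P] (hP : ∀ g h : I → κ, (∀ i ∈ J, g i = h i) → (P g ↔ P h))
    (c : (I → κ) → ℂ) :
    ∑ g, (if P g then ‖(tensor M *ᵥ c) g‖ ^ 2 else 0) =
      ∑ g, if P g then ‖(tensor (fun i => if i ∈ J then M i else 1) *ᵥ c) g‖ ^ 2 else 0 := by
  set inner : I → Matrix κ κ ℂ := fun i => if i ∈ J then M i else 1
  set outer : I → Matrix κ κ ℂ := fun i => if i ∈ J then 1 else M i with houter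
  have hM_eq : tensor M = tensor outer * tensor inner := by
    rw [tensor_mul]
    congr 1
    funext i
    simp only [outer, inner]
    split_ifs <;> simp
  have hunitary : tensor outer ∈ Matrix.unitaryGroup (I → κ) ℂ :=
    tensor_mem_unitaryGroup fun i => by
      simp only [houter]
      split_ifs
      · exact one_mem _
      · exact hM i
  have hP_outer (g h : I → κ) (hgh : ∀ i, outer i = 1 → g i = h i) : P g ↔ P h :=
    hP g h fun i hi => hgh i (if_pos hi)
  have hite (v : (I → κ) → ℂ) (g : I → κ) :
      (if P g then ‖v g‖ ^ 2 else 0) = ‖if P g then v g else 0‖ ^ 2 := by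
    split_ifs <;> simp
  simp only [hite]
  rw [← sum_norm_sq_mulVec hunitary fun g => if P g then (tensor inner *ᵥ c) g else 0]
  simp only [tensor_mulVec_ite hP_outer, Matrix.mulVec_mulVec, hM_eq]

lemma tensor_pair_mulVec {a b : I} (hab : a ≠ b) (M : I → Matrix κ κ ℂ) (c : (I → κ) → ℂ)
    (g : I → κ) :
    (tensor (fun i => if i ∈ ({a, b} : Finset I) then M i else 1) *ᵥ c) g =
      ∑ q : κ × κ, M a (g a) q.1 * M b (g b) q.2 *
        c (Function.update (Function.update g a q.1) b q.2) := by
  symm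
  refine Fintype.sum_of_injective
    (fun q : κ × κ => Function.update (Function.update g a q.1) b q.2) ?_ _ _ ?_ ?_
  · intro q q' h
    have ha := congrFun h a
    have hb := congrFun h b
    simp only [Function.update_self, Function.update_of_ne hab] at ha hb
    exact Prod.ext ha hb
  · intro h hh
    refine mul_eq_zero_of_left (by_contra fun hne => hh ⟨(h a, h b), funext fun i => ?_⟩) _
    by_cases hb : i = b
    · simp [hb]
    · by_cases ha : i = a
      · simp [ha, hab]
      · simp only [Function.update_of_ne hb, Function.update_of_ne ha]
        exact apply_eq_of_tensor_ne_zero hne (if_neg (by simp [ha, hb]))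
  · rintro ⟨u, v⟩
    congr 1
    simp only [tensor, Matrix.of_apply]
    rw [Fintype.prod_eq_mul a b hab]
    · simp [Function.update_of_ne hab]
    · rintro i ⟨ha, hb⟩
      rw [if_neg (by simp [ha, hb]), Function.update_of_ne hb, Function.update_of_ne ha,
        Matrix.one_apply_eq]

lemma sum_eq_sum_update_update {A : Type*} [AddCommMonoid A] {a b : I} (hab : a ≠ b) (o : κ)
    (G : (I → κ) → A) :
    ∑ g, G g = ∑ g : I → κ, if g a = o ∧ g b = o then
      ∑ u, ∑ v, G (Function.update (Function.update g a u) b v) else 0 := by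
  rw [sum_eq_sum_update b o, sum_eq_sum_update a o]
  refine Finset.sum_congr rfl fun g _ => ?_
  simp only [Function.update_of_ne hab.symm, ite_and]
  split_ifs <;> simp

/-- The partial function `g` takes the same value at `a` and `b`. -/
def CollidesAt (a b : I) (g : I → Option κ) : Prop := ∃ z, g a = some z ∧ g b = some z

instance (a b : I) : DecidablePred (CollidesAt (κ := κ) a b) := fun _ =>
  inferInstanceAs (Decidable (∃ _, _))

lemma sum_ite_collidesAt {a b : I} (hab : a ≠ b) (f : (I → Option κ) → ℝ) :
    ∑ g, (if CollidesAt a b g then ∑ q : κ × κ,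
        f (Function.update (Function.update g a (some q.1)) b (some q.2)) else 0) =
      Fintype.card κ * ∑ h, if h a ≠ none ∧ h b ≠ none then f h else 0 := by
  rw [sum_eq_sum_update_update hab none,
    sum_eq_sum_update_update hab none fun h : I → Option κ =>
      if h a ≠ none ∧ h b ≠ none then f h else 0, Finset.mul_sum]
  refine Finset.sum_congr rfl fun g _ => ?_
  have hupdate (u v u' v' : Option κ) : Function.update (Function.update (Function.update
      (Function.update g a u) b v) a u') b v' = Function.update (Function.update g a u') b v' := by
    rw [Function.update_comm hab.symm, Function.update_idem, Function.update_idem]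
  rw [mul_ite_zero]
  congr 1
  simp only [CollidesAt, hupdate, Function.update_self,
    Function.update_of_ne hab, Fintype.sum_option, Fintype.sum_prod_type]
  simp

end

section
variable {n : ℕ}

/- Averaging over the phases removes the cross terms of the amplitude at a collision, up to the
exchange of the two colliding inputs. -/
lemma sum_norm_sq_tensor_phasedHadamard_le {I : Type*} [Fintype I] [DecidableEq I] {a b : I}
    (hab : a ≠ b) {g : I → Option (BitString n)} (hg : CollidesAt a b g)
    (c : (I → Option (BitString n)) → ℂ) :
    ∑ k : BitString n → ZMod 3, ‖(tensor (fun i => if i ∈ ({a, b} : Finset I) then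
        liftOpt (phasedHadamard k).1 else 1) *ᵥ c) g‖ ^ 2 ≤
      Fintype.card (BitString n → ZMod 3) * (2 * (((2 : ℝ) ^ n)⁻¹ ^ 2 *
        ∑ q : BitString n × BitString n,
          ‖c (Function.update (Function.update g a (some q.1)) b (some q.2))‖ ^ 2)) := by
  obtain ⟨z, hza, hzb⟩ := hg
  have hamplitude (k : BitString n → ZMod 3) :
      (tensor (fun i => if i ∈ ({a, b} : Finset I) then
        liftOpt (phasedHadamard k).1 else 1) *ᵥ c) g =
      ∑ q : BitString n × BitString n,
        (hadamardTransform n z q.1 * hadamardTransform n z q.2 *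
          c (Function.update (Function.update g a (some q.1)) b (some q.2))) *
          (ZMod.stdAddChar (k q.1) * ZMod.stdAddChar (k q.2)) := by
    rw [tensor_pair_mulVec hab (fun _ => liftOpt (phasedHadamard k).1), hza, hzb,
      Fintype.sum_prod_type, Fintype.sum_option, Fintype.sum_prod_type]
    simp only [liftOpt_some_none, zero_mul, Finset.sum_const_zero, zero_add,
      Fintype.sum_option, mul_zero, liftOpt_some_some, phasedHadamard_apply]
    refine Finset.sum_congr rfl fun u _ => Finset.sum_congr rfl fun v _ => ?_
    ring
  simp only [hamplitude]
  refine (sum_norm_sq_sum_mul_cubic_le _).trans_eq ?_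
  congr 2
  rw [Finset.mul_sum]
  refine Finset.sum_congr rfl fun q _ => ?_
  rw [norm_mul, norm_mul, mul_pow, mul_pow, norm_sq_hadamardTransform_apply,
    norm_sq_hadamardTransform_apply, ← sq ((2 : ℝ) ^ n)⁻¹]

lemma sum_twirl_collidesAt_le {a b : Fin 2 × BitString n} (hab : a ≠ b) (c : RelPair n → ℂ) :
    ∑ k : BitString n → ZMod 3, ∑ g : RelPair n, (if CollidesAt a b g then
        ‖(onRec (fun _ => (phasedHadamard k).1) *ᵥ c) g‖ ^ 2 else 0) ≤
      Fintype.card (BitString n → ZMod 3) * (2 / 2 ^ n *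
        ∑ h : RelPair n, if h a ≠ none ∧ h b ≠ none then ‖c h‖ ^ 2 else 0) := by
  have hcollides (g h : RelPair n) (hgh : ∀ i ∈ ({a, b} : Finset (Fin 2 × BitString n)),
      g i = h i) : CollidesAt a b g ↔ CollidesAt a b h := by
    rw [CollidesAt, CollidesAt, hgh a (by simp), hgh b (by simp)]
  have hlocal (k : BitString n → ZMod 3) :=
    sum_ite_norm_sq_tensor_mulVec (M := fun _ => liftOpt (phasedHadamard k).1)
      (fun _ : Fin 2 × BitString n => liftOpt_mem_unitaryGroup (phasedHadamard k).2) {a, b}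
      hcollides c
  simp only [onRec, hlocal]
  rw [Finset.sum_comm]
  calc ∑ g : RelPair n, ∑ k : BitString n → ZMod 3, (if CollidesAt a b g then
        ‖(tensor (fun i => if i ∈ ({a, b} : Finset (Fin 2 × BitString n)) then
          liftOpt (phasedHadamard k).1 else 1) *ᵥ c) g‖ ^ 2 else 0)
    _ ≤ ∑ g : RelPair n, Fintype.card (BitString n → ZMod 3) * (2 * (((2 : ℝ) ^ n)⁻¹ ^ 2 *
          if CollidesAt a b g then ∑ q : BitString n × BitString n,
            ‖c (Function.update (Function.update g a (some q.1)) b (some q.2))‖ ^ 2 else 0)) := by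
      refine Finset.sum_le_sum fun g _ => ?_
      split_ifs with hg
      · exact sum_norm_sq_tensor_phasedHadamard_le hab hg c
      · simp
    _ = _ := by
      rw [← Finset.mul_sum, ← Finset.mul_sum, ← Finset.mul_sum,
        sum_ite_collidesAt hab fun h => ‖c h‖ ^ 2, card_bitString]
      push_cast
      field_simp

/-- Each of the two blocks of `g` is injective, as a partial function from outputs to inputs. -/
def BlockInj (g : RelPair n) : Prop :=
  ∀ j y y' x, g (j, y) = some x → g (j, y') = some x → y = y'

/-- The number of recorded pairs. -/
def numPairs (g : RelPair n) : ℕ := (outputs g 0).card + (outputs g 1).card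

lemma not_blockInj_iff {g : RelPair n} :
    ¬BlockInj g ↔ ∃ j y y', y ≠ y' ∧ CollidesAt (j, y) (j, y') g := by
  simp only [BlockInj, CollidesAt, not_forall, exists_prop]
  exact ⟨fun ⟨j, y, y', x, hy, hy', hne⟩ => ⟨j, y, y', hne, x, hy, hy'⟩,
    fun ⟨j, y, y', hne, x, hy, hy'⟩ => ⟨j, y, y', x, hy, hy', hne⟩⟩

lemma card_filter_both_recorded_le (g : RelPair n) :
    (Finset.univ.filter fun s : Fin 2 × BitString n × BitString n =>
      s.2.1 ≠ s.2.2 ∧ g (s.1, s.2.1) ≠ none ∧ g (s.1, s.2.2) ≠ none).card ≤ numPairs g ^ 2 := by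
  have hsubset : (Finset.univ.filter fun s : Fin 2 × BitString n × BitString n =>
      s.2.1 ≠ s.2.2 ∧ g (s.1, s.2.1) ≠ none ∧ g (s.1, s.2.2) ≠ none) ⊆
      (Finset.univ : Finset (Fin 2)).biUnion fun j => {j} ×ˢ (outputs g j ×ˢ outputs g j) := by
    rintro ⟨j, y, y'⟩ hs
    obtain ⟨-, hy, hy'⟩ := (Finset.mem_filter.1 hs).2
    simp [mem_outputs, hy, hy']
  refine ((Finset.card_le_card hsubset).trans Finset.card_biUnion_le).trans ?_
  simp only [Fin.sum_univ_two, Finset.card_product, Finset.card_singleton, one_mul, numPairs,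
    ← sq]
  rw [add_sq]
  omega

section
variable {m : ℕ}

open Classical in
/-- The squared norm of the part of a state whose records are not injective. -/
def collisionWeight (ψ : (BitString n × BitString m) × RelPair n → ℂ) : ℝ :=
  ∑ p, if BlockInj p.2 then 0 else ‖ψ p‖ ^ 2

lemma collisionWeight_le_sum (ψ : (BitString n × BitString m) × RelPair n → ℂ) :
    collisionWeight ψ ≤ ∑ p, ∑ s : Fin 2 × BitString n × BitString n with s.2.1 ≠ s.2.2,
      ∑ g : RelPair n, if CollidesAt (s.1, s.2.1) (s.1, s.2.2) g then ‖ψ (p, g)‖ ^ 2 else 0 := by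
  rw [collisionWeight, Fintype.sum_prod_type (α₁ := BitString n × BitString m)]
  refine Finset.sum_le_sum fun p _ => ?_
  rw [Finset.sum_comm]
  refine Finset.sum_le_sum fun g _ => ?_
  have hnonneg (s : Fin 2 × BitString n × BitString n) :
      0 ≤ if CollidesAt (s.1, s.2.1) (s.1, s.2.2) g then ‖ψ (p, g)‖ ^ 2 else 0 := by
    split_ifs <;> positivity
  split_ifs with hg
  · exact Finset.sum_nonneg fun s _ => hnonneg s
  · obtain ⟨j, y, y', hne, hcollides⟩ := not_blockInj_iff.1 hg
    have hmem : (j, y, y') ∈ Finset.univ.filter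
        fun s : Fin 2 × BitString n × BitString n => s.2.1 ≠ s.2.2 :=
      Finset.mem_filter.2 ⟨Finset.mem_univ _, hne⟩
    have hterm := Finset.single_le_sum (fun s _ => hnonneg s) hmem
    rwa [if_pos hcollides] at hterm

lemma sum_ite_both_recorded_le {t : ℕ} {ψ : (BitString n × BitString m) × RelPair n → ℂ}
    (hψ : SupportedOn (fun g => numPairs g = t) ψ) :
    ∑ p, ∑ s : Fin 2 × BitString n × BitString n with s.2.1 ≠ s.2.2, ∑ h : RelPair n,
      (if h (s.1, s.2.1) ≠ none ∧ h (s.1, s.2.2) ≠ none then ‖ψ (p, h)‖ ^ 2 else 0) ≤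
      t ^ 2 * l2 ψ ^ 2 := by
  rw [l2_sq, Fintype.sum_prod_type (α₁ := BitString n × BitString m), Finset.mul_sum]
  refine Finset.sum_le_sum fun p _ => ?_
  rw [Finset.sum_comm, Finset.mul_sum]
  refine Finset.sum_le_sum fun h _ => ?_
  by_cases hph : ψ (p, h) = 0
  · simp [hph]
  rw [← Finset.sum_filter, Finset.sum_const, nsmul_eq_mul, Finset.filter_filter]
  gcongr
  rw [← hψ _ hph]
  exact_mod_cast card_filter_both_recorded_le h

lemma sum_collisionWeight_twirl_le {t : ℕ} {ψ : (BitString n × BitString m) × RelPair n → ℂ}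
    (hψ : SupportedOn (fun g => numPairs g = t) ψ) :
    ∑ k : BitString n → ZMod 3,
        collisionWeight (applyRec (onRec fun _ => (phasedHadamard k).1) ψ) ≤
      Fintype.card (BitString n → ZMod 3) * (2 * t ^ 2 / 2 ^ n * l2 ψ ^ 2) := by
  refine (Finset.sum_le_sum fun k _ => collisionWeight_le_sum _).trans ?_
  calc ∑ k : BitString n → ZMod 3, ∑ p,
          ∑ s : Fin 2 × BitString n × BitString n with s.2.1 ≠ s.2.2, ∑ g : RelPair n,
            (if CollidesAt (s.1, s.2.1) (s.1, s.2.2) g then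
              ‖applyRec (onRec fun _ => (phasedHadamard k).1) ψ (p, g)‖ ^ 2 else 0)
    _ ≤ ∑ p, ∑ s : Fin 2 × BitString n × BitString n with s.2.1 ≠ s.2.2,
          Fintype.card (BitString n → ZMod 3) * (2 / 2 ^ n * ∑ h : RelPair n,
            if h (s.1, s.2.1) ≠ none ∧ h (s.1, s.2.2) ≠ none then ‖ψ (p, h)‖ ^ 2 else 0) := by
      rw [Finset.sum_comm]
      refine Finset.sum_le_sum fun p _ => ?_
      rw [Finset.sum_comm]
      refine Finset.sum_le_sum fun s hs => ?_
      exact sum_twirl_collidesAt_le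
        (fun h => (Finset.mem_filter.1 hs).2 (Prod.ext_iff.1 h).2) fun h => ψ (p, h)
    _ ≤ _ := by
      simp only [← Finset.mul_sum]
      rw [mul_div_right_comm, mul_assoc]
      gcongr
      exact sum_ite_both_recorded_le hψ

end
end

/-! ### Permutations that extend a partial injection -/

section
variable {X : Type*}

/-- The partial function `γ` is a partial inverse of `σ`. -/
def IsPartialInverse (γ : X → Option X) (σ : Equiv.Perm X) : Prop := ∀ y x, γ y = some x → σ x = y

instance [Fintype X] [DecidableEq X] (γ : X → Option X) : DecidablePred (IsPartialInverse γ) :=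
  fun _ => inferInstanceAs (Decidable (∀ _ _, _))

variable {γ : X → Option X}

lemma exists_isPartialInverse [Finite X]
    (hγ : ∀ y y' x, γ y = some x → γ y' = some x → y = y') : ∃ σ, IsPartialInverse γ σ := by
  classical
  cases nonempty_fintype X
  have hinj : Set.InjOn (fun y => (γ y).getD y)
      (Finset.univ.filter fun y => γ y ≠ none : Finset X) := by
    intro y hy y' hy' heq
    obtain ⟨x, hx⟩ := Option.ne_none_iff_exists'.1 (Finset.mem_filter.1 hy).2
    obtain ⟨x', hx'⟩ := Option.ne_none_iff_exists'.1 (Finset.mem_filter.1 hy').2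
    simp only [hx, hx', Option.getD_some] at heq
    exact hγ y y' x hx (heq ▸ hx')
  obtain ⟨e, he⟩ := Finset.exists_equiv_extend_of_card_eq (t := Finset.univ)
    Finset.card_univ.symm (Finset.subset_univ _) hinj
  refine ⟨(e.trans (Equiv.subtypeUnivEquiv Finset.mem_univ)).symm, fun y x hy => ?_⟩
  rw [Equiv.symm_apply_eq]
  simpa [hy] using (he y (by simp [hy])).symm

lemma card_isPartialInverse_mul_descFactorial [Fintype X] [DecidableEq X]
    (hγ : ∀ y y' x, γ y = some x → γ y' = some x → y = y') :
    (Finset.univ.filter (IsPartialInverse γ)).card *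
      (Fintype.card X).descFactorial (Finset.univ.filter fun y => γ y ≠ none).card =
      (Fintype.card X)! := by
  obtain ⟨σ₀, hσ₀⟩ := exists_isPartialInverse hγ
  let translate : {σ // IsPartialInverse γ σ} ≃
      {σ : Equiv.Perm X // ∀ y, ¬(γ y = none) → σ y = y} :=
    { toFun := fun σ => ⟨σ.1 * σ₀⁻¹, fun y hy => by
        obtain ⟨x, hx⟩ := Option.ne_none_iff_exists'.1 hy
        rw [Equiv.Perm.mul_apply, Equiv.Perm.inv_eq_iff_eq.2 (hσ₀ y x hx).symm]
        exact σ.2 y x hx⟩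
      invFun := fun σ => ⟨σ.1 * σ₀, fun y x hx => by
        rw [Equiv.Perm.mul_apply, hσ₀ y x hx]
        exact σ.2 y (by rw [hx]; simp)⟩
      left_inv := fun σ => by simp
      right_inv := fun σ => by simp }
  have hcard : (Finset.univ.filter fun y => γ y = none).card =
      Fintype.card X - (Finset.univ.filter fun y => γ y ≠ none).card := by
    rw [← Finset.card_univ (α := X),
      ← Finset.card_filter_add_card_filter_not (s := Finset.univ) fun y => γ y = none,
      Nat.add_sub_cancel]
  rw [← Fintype.card_subtype, Fintype.card_congr (translate.trans
    (Equiv.Perm.subtypeEquivSubtypePerm fun y => γ y = none).symm), Fintype.card_perm,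
    Fintype.card_subtype, hcard]
  exact Nat.factorial_mul_descFactorial (Finset.card_le_univ _)

end

/-! ### Characters of sign functions -/

section
variable {I : Type*}

/-- The character `f ↦ ∏_{i ∈ S} f i` of the group of sign functions. -/
def signChar (S : Finset I) (f : I → ℤˣ) : ℂ := ∏ i ∈ S, ((f i : ℤ) : ℂ)

@[simp] lemma signChar_empty (f : I → ℤˣ) : signChar ∅ f = 1 := Finset.prod_empty

lemma signChar_singleton (i : I) (f : I → ℤˣ) : signChar {i} f = (f i : ℤ) :=
  Finset.prod_singleton _ _

lemma star_signChar (S : Finset I) (f : I → ℤˣ) : star (signChar S f) = signChar S f := by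
  simp [signChar]

lemma intUnit_mul_self (u : ℤˣ) : ((u : ℤ) : ℂ) * ((u : ℤ) : ℂ) = 1 := by
  rcases Int.units_eq_one_or u with h | h <;> simp [h]

variable [DecidableEq I]

lemma signChar_eq_prod_of_subset {S A : Finset I} (hSA : S ⊆ A) (f : I → ℤˣ) :
    signChar S f = ∏ i ∈ A, if i ∈ S then ((f i : ℤ) : ℂ) else 1 := by
  rw [Finset.prod_ite_mem, Finset.inter_eq_right.2 hSA, signChar]

lemma signChar_symmDiff (S T : Finset I) (f : I → ℤˣ) :
    signChar (symmDiff S T) f = signChar S f * signChar T f := by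
  rw [signChar_eq_prod_of_subset (symmDiff_le_sup : symmDiff S T ⊆ S ∪ T),
    signChar_eq_prod_of_subset (Finset.subset_union_left : S ⊆ S ∪ T),
    signChar_eq_prod_of_subset (Finset.subset_union_right : T ⊆ S ∪ T),
    ← Finset.prod_mul_distrib]
  refine Finset.prod_congr rfl fun i _ => ?_
  by_cases hS : i ∈ S <;> by_cases hT : i ∈ T <;>
    simp [Finset.mem_symmDiff, hS, hT, intUnit_mul_self]

lemma sum_signChar [Fintype I] (S : Finset I) :
    ∑ f, signChar S f = if S = ∅ then (Fintype.card (I → ℤˣ) : ℂ) else 0 := by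
  split_ifs with hS
  · simp [hS]
  · obtain ⟨i, hi⟩ := Finset.nonempty_iff_ne_empty.2 hS
    simp only [signChar_eq_prod_of_subset (Finset.subset_univ S)]
    rw [← Fintype.piFinset_univ, ← Finset.prod_univ_sum (fun _ => Finset.univ)
      fun i (u : ℤˣ) => if i ∈ S then ((u : ℤ) : ℂ) else 1]
    refine Finset.prod_eq_zero (Finset.mem_univ i) ?_
    rw [UnitsInt.univ, Finset.sum_pair (by decide)]
    simp [hi]

lemma sum_signChar_mul_signChar [Fintype I] (S T : Finset I) :
    ∑ f, signChar S f * signChar T f = if S = T then (Fintype.card (I → ℤˣ) : ℂ) else 0 := by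
  simp only [← signChar_symmDiff, sum_signChar, Finset.symmDiff_eq_empty]

end

/-! ### Permutations with random signs -/

section
variable {n m : ℕ}

/-- The permutation matrix of `σ` with signs `s`. -/
def signedPerm (σ : Equiv.Perm (BitString n)) (s : BitString n → ℤˣ) :
    Matrix.unitaryGroup (BitString n) ℂ :=
  ⟨Matrix.of fun y x => if x = σ.symm y then ((s x : ℤ) : ℂ) else 0, by
    rw [Matrix.mem_unitaryGroup_iff]
    ext y y'
    simp only [Matrix.mul_apply, Matrix.star_apply, Matrix.of_apply, ite_mul, zero_mul,
      Finset.sum_ite_eq', Finset.mem_univ, if_true, Matrix.one_apply,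
      EmbeddingLike.apply_eq_iff_eq]
    split_ifs with hy
    · simp [intUnit_mul_self]
    · simp⟩

/-- A query to a permutation oracle with signs, in the Fourier basis of the sign functions: the
query flips the membership of its input in the recorded set. -/
def fourierStep (π : Fin 2 → Equiv.Perm (BitString n)) (j : Fin 2)
    (ψ : (BitString n × BitString m) × Finset (Fin 2 × BitString n) → ℂ) :
    (BitString n × BitString m) × Finset (Fin 2 × BitString n) → ℂ :=
  fun p => ψ (((π j).symm p.1.1, p.1.2), symmDiff p.2 {(j, (π j).symm p.1.1)})

/-- The initial state in the Fourier basis of the sign functions: all registers are zero, and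
every sign function has the same amplitude. -/
def initFourier (n m : ℕ) : (BitString n × BitString m) × Finset (Fin 2 × BitString n) → ℂ :=
  fun p => if p.1 = 0 then (if p.2 = ∅ then 1 else 0) else 0

/-- The view for permutation oracles with signs, in the Fourier basis of the sign functions. -/
def Adversary.fourierView {t : ℕ} (𝒜 : Adversary n m t) (π : Fin 2 → Equiv.Perm (BitString n)) :
    (BitString n × BitString m) × Finset (Fin 2 × BitString n) → ℂ :=
  Fin.foldl t (fun ψ i => fourierStep π (𝒜.query i) (applyLocal (𝒜.unitary i).1 ψ))
    (initFourier n m)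

/-- The view for two unitary oracles. -/
def Adversary.unitaryView {t : ℕ} (𝒜 : Adversary n m t)
    (C : Fin 2 → Matrix.unitaryGroup (BitString n) ℂ) :
    (BitString n × BitString m) × Unit → ℂ :=
  𝒜.view (unitaryOracle (C 0) (C 1)) fun _ => 1

lemma onA_mul (C D : Matrix (BitString n) (BitString n) ℂ) : onA m (C * D) = onA m C * onA m D := by
  simp [onA, Matrix.kronecker, ← Matrix.mul_kronecker_mul]

lemma applyOracle_unitaryOracle (C : Fin 2 → Matrix.unitaryGroup (BitString n) ℂ) (j : Fin 2)
    (ψ : (BitString n × BitString m) × Unit → ℂ) :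
    applyOracle (unitaryOracle (C 0) (C 1) j) ψ = applyLocal (onA m (C j).1) ψ := by
  funext p
  rw [applyLocal_onA]
  simp only [applyOracle, unitaryOracle, Matrix.of_apply, Fintype.sum_prod_type]
  refine Finset.sum_congr rfl fun x _ => ?_
  obtain rfl | rfl : j = 0 ∨ j = 1 := by omega
  all_goals simp

lemma unitaryView_twist {t : ℕ} (𝒜 : Adversary n m t)
    (C D : Fin 2 → Matrix.unitaryGroup (BitString n) ℂ) :
    (𝒜.twist C).unitaryView D = 𝒜.unitaryView fun j => D j * C j := by
  unfold Adversary.unitaryView Adversary.view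
  congr 1
  funext ψ i
  rw [applyOracle_unitaryOracle D, applyOracle_unitaryOracle fun j => D j * C j,
    Submonoid.coe_mul, onA_mul, applyLocal_mul, ← applyLocal_mul (onA m (C _).1)]
  rfl

/-- The state on `AB` given by a state in the Fourier basis of the sign functions, for the
signs `f`. -/
def evalSigns (f : Fin 2 × BitString n → ℤˣ)
    (ψ : (BitString n × BitString m) × Finset (Fin 2 × BitString n) → ℂ) :
    (BitString n × BitString m) × Unit → ℂ :=
  fun p => ∑ S, signChar S f * ψ (p.1, S)

lemma applyLocal_evalSigns (f : Fin 2 × BitString n → ℤˣ)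
    (U : Matrix (BitString n × BitString m) (BitString n × BitString m) ℂ)
    (ψ : (BitString n × BitString m) × Finset (Fin 2 × BitString n) → ℂ) :
    applyLocal U (evalSigns f ψ) = evalSigns f (applyLocal U ψ) := by
  funext p
  simp only [applyLocal, evalSigns, Finset.mul_sum]
  rw [Finset.sum_comm]
  simp only [mul_left_comm]

lemma applyLocal_signedPerm_evalSigns (π : Fin 2 → Equiv.Perm (BitString n))
    (f : Fin 2 × BitString n → ℤˣ) (j : Fin 2)
    (ψ : (BitString n × BitString m) × Finset (Fin 2 × BitString n) → ℂ) :
    applyLocal (onA m (signedPerm (π j) fun x => f (j, x)).1) (evalSigns f ψ) =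
      evalSigns f (fourierStep π j ψ) := by
  funext p
  simp only [applyLocal_onA, evalSigns, signedPerm, Matrix.of_apply, ite_mul, zero_mul,
    Finset.sum_ite_eq', Finset.mem_univ, if_true, fourierStep]
  have hinvolutive : Function.Involutive
      fun S : Finset (Fin 2 × BitString n) => symmDiff S {(j, (π j).symm p.1.1)} := fun S =>
    symmDiff_symmDiff_cancel_right _ _
  rw [← Equiv.sum_comp hinvolutive.toPerm, Finset.mul_sum]
  refine Finset.sum_congr rfl fun S _ => ?_
  simp only [Function.Involutive.coe_toPerm, signChar_symmDiff, signChar_singleton]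
  rw [mul_comm (signChar S f), ← mul_assoc, ← mul_assoc, intUnit_mul_self, one_mul]

lemma unitaryView_signedPerm {t : ℕ} (𝒜 : Adversary n m t)
    (π : Fin 2 → Equiv.Perm (BitString n)) (f : Fin 2 × BitString n → ℤˣ) :
    𝒜.unitaryView (fun j => signedPerm (π j) fun x => f (j, x)) =
      evalSigns f (𝒜.fourierView π) := by
  unfold Adversary.unitaryView Adversary.view Adversary.fourierView
  refine foldl_rel (fun _ (a : (BitString n × BitString m) × Unit → ℂ)
    (b : (BitString n × BitString m) × Finset (Fin 2 × BitString n) → ℂ) =>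
      a = evalSigns f b) t _ _ _ _ ?_ ?_
  · funext p
    by_cases hp : p.1 = 0 <;> simp [evalSigns, initFourier, hp]
  · rintro i a b rfl
    rw [applyOracle_unitaryOracle fun j => signedPerm (π j) fun x => f (j, x),
      applyLocal_evalSigns, applyLocal_signedPerm_evalSigns]

end

/-! ### Signed permutations against path recording -/

section
variable {n m : ℕ}

/-- The relations recorded when exactly the inputs in `S` have been queried to the
permutations `π`. -/
def graphOn (π : Fin 2 → Equiv.Perm (BitString n)) (S : Finset (Fin 2 × BitString n)) :
    RelPair n :=
  fun i => if (i.1, (π i.1).symm i.2) ∈ S then some ((π i.1).symm i.2) else none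

lemma graphOn_empty (π : Fin 2 → Equiv.Perm (BitString n)) : graphOn π ∅ = fun _ => none :=
  funext fun _ => if_neg (Finset.notMem_empty _)

lemma graphOn_erase (π : Fin 2 → Equiv.Perm (BitString n)) (S : Finset (Fin 2 × BitString n))
    (j : Fin 2) (y : BitString n) :
    graphOn π (S.erase (j, (π j).symm y)) = Function.update (graphOn π S) (j, y) none := by
  funext ⟨j', y'⟩
  by_cases hi : (j', y') = (j, y)
  · rw [hi]
    simp [graphOn]
  · have hne : (j', (π j').symm y') ≠ (j, (π j).symm y) := by
      intro heq
      obtain ⟨rfl, hy⟩ := Prod.mk.inj heq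
      exact hi (by rw [(π j').symm.injective hy])
    simp only [Function.update_of_ne hi, graphOn, Finset.mem_erase, ne_eq, hne, not_false_eq_true,
      true_and]

lemma numPairs_graphOn (π : Fin 2 → Equiv.Perm (BitString n))
    (S : Finset (Fin 2 × BitString n)) : numPairs (graphOn π S) = S.card := by
  have houtputs : ∀ j, (outputs (graphOn π S) j).card = ∑ x, if (j, x) ∈ S then 1 else 0 := by
    intro j
    rw [outputs, Finset.card_filter, ← Equiv.sum_comp (π j)]
    exact Finset.sum_congr rfl fun x _ => by simp [graphOn]
  calc numPairs (graphOn π S) = ∑ i, if i ∈ S then 1 else 0 := by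
        rw [numPairs, houtputs, houtputs, Fintype.sum_prod_type, Fin.sum_univ_two]
    _ = S.card := by simp

/-- The two permutations extend the partial injections recorded by `g`. -/
def Extends (π : Fin 2 → Equiv.Perm (BitString n)) (g : RelPair n) : Prop :=
  ∀ j, IsPartialInverse (fun y => g (j, y)) (π j)

instance (π : Fin 2 → Equiv.Perm (BitString n)) : DecidablePred (Extends π) :=
  fun _ => inferInstanceAs (Decidable (∀ _, _))

lemma Extends.blockInj {π : Fin 2 → Equiv.Perm (BitString n)} {g : RelPair n}
    (h : Extends π g) : BlockInj g :=
  fun j y y' x hy hy' => (h j y x hy).symm.trans (h j y' x hy')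

lemma graphOn_eq_iff (π : Fin 2 → Equiv.Perm (BitString n)) (S : Finset (Fin 2 × BitString n))
    (g : RelPair n) :
    graphOn π S = g ↔
      Extends π g ∧ S = Finset.univ.filter fun i => g (i.1, π i.1 i.2) ≠ none := by
  constructor
  · rintro rfl
    refine ⟨fun j y x h => ?_, ?_⟩
    · simp only [graphOn] at h
      split_ifs at h
      rw [← Option.some_injective _ h, Equiv.apply_symm_apply]
    · ext i
      simp [graphOn]
  · rintro ⟨hπ, rfl⟩
    funext ⟨j, y⟩
    simp only [graphOn, Finset.mem_filter, Finset.mem_univ, true_and, Equiv.apply_symm_apply]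
    split_ifs with h
    · obtain ⟨x, hx⟩ := Option.ne_none_iff_exists'.1 h
      rw [hx, ← hπ j y x hx, Equiv.symm_apply_apply]
    · exact (not_not.1 h).symm

lemma sum_graphOn {M : Type*} [AddCommMonoid M] (π : Fin 2 → Equiv.Perm (BitString n))
    (Φ : RelPair n → M) : ∑ S, Φ (graphOn π S) = ∑ g with Extends π g, Φ g :=
  Finset.sum_nbij' (graphOn π) (fun g => Finset.univ.filter fun i => g (i.1, π i.1 i.2) ≠ none)
    (fun S _ => Finset.mem_filter.2 ⟨Finset.mem_univ _, ((graphOn_eq_iff π S _).1 rfl).1⟩)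
    (fun _ _ => Finset.mem_univ _)
    (fun S _ => ((graphOn_eq_iff π S _).1 rfl).2.symm)
    (fun g hg => (graphOn_eq_iff π _ g).2 ⟨(Finset.mem_filter.1 hg).2, rfl⟩)
    fun _ _ => rfl

/-- The normalization `∏_j √(N (N - 1) ⋯ (N - |g_j| + 1))`, whose inverse is the amplitude with
which path recording reaches `g`. -/
def extNorm (g : RelPair n) : ℝ :=
  ∏ j, Real.sqrt ((2 ^ n).descFactorial (outputs g j).card : ℕ)

lemma extNorm_none : extNorm (fun _ => none : RelPair n) = 1 := by simp [extNorm, outputs]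

lemma extNorm_sq (g : RelPair n) :
    extNorm g ^ 2 = ∏ j, (((2 ^ n).descFactorial (outputs g j).card : ℕ) : ℝ) := by
  rw [extNorm, ← Finset.prod_pow]
  exact Finset.prod_congr rfl fun j _ => Real.sq_sqrt (Nat.cast_nonneg _)

lemma card_extends_mul_extNorm_sq {g : RelPair n} (hg : BlockInj g) :
    ((Finset.univ.filter fun π : Fin 2 → Equiv.Perm (BitString n) => Extends π g).card : ℝ) *
      extNorm g ^ 2 = Fintype.card (Fin 2 → Equiv.Perm (BitString n)) := by
  have hpi : (Finset.univ.filter fun π : Fin 2 → Equiv.Perm (BitString n) => Extends π g) =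
      Fintype.piFinset fun j => Finset.univ.filter (IsPartialInverse fun y => g (j, y)) := by
    ext π
    simp [Extends, Fintype.mem_piFinset]
  have hblock : ∀ j, (Finset.univ.filter (IsPartialInverse fun y => g (j, y))).card *
      (2 ^ n).descFactorial (outputs g j).card = (2 ^ n)! := fun j => by
    rw [← card_bitString n]
    exact card_isPartialInverse_mul_descFactorial (hg j)
  rw [hpi, Fintype.card_piFinset, extNorm_sq]
  norm_cast
  rw [← Finset.prod_mul_distrib, Finset.prod_congr rfl fun j _ => hblock j]
  simp [Fintype.card_perm]

open Classical in
lemma sum_sum_extends_extNorm_sq_mul (Φ : RelPair n → ℂ) :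
    ∑ π : Fin 2 → Equiv.Perm (BitString n), ∑ g with Extends π g,
        ((extNorm g ^ 2 : ℝ) : ℂ) * Φ g =
      Fintype.card (Fin 2 → Equiv.Perm (BitString n)) * ∑ g with BlockInj g, Φ g := by
  simp only [Finset.sum_filter]
  rw [Finset.sum_comm, Finset.mul_sum]
  refine Finset.sum_congr rfl fun g _ => ?_
  split_ifs with hg
  · rw [← Finset.sum_filter, Finset.sum_const, nsmul_eq_mul, ← mul_assoc,
      ← Complex.ofReal_natCast, ← Complex.ofReal_mul, card_extends_mul_extNorm_sq hg,
      Complex.ofReal_natCast]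
  · rw [mul_zero]
    exact Finset.sum_eq_zero fun π _ => if_neg fun hπ => hg hπ.blockInj

lemma sqrt_descFactorial_succ {N k : ℕ} (hk : k < N) :
    √(N.descFactorial (k + 1) : ℕ) = √((N : ℝ) - k) * √(N.descFactorial k : ℕ) := by
  rw [Nat.descFactorial_succ, Nat.cast_mul, Nat.cast_sub hk.le,
    Real.sqrt_mul (sub_nonneg.2 (Nat.cast_le.2 hk.le))]

lemma extNorm_mul_prWeight {g : RelPair n} {j : Fin 2} {y x : BitString n}
    (h : g (j, y) = some x) :
    extNorm g * prWeight n j (Function.update g (j, y) none) y =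
      extNorm (Function.update g (j, y) none) := by
  set g₀ := Function.update g (j, y) none with hg₀
  have hg : g = Function.update g₀ (j, y) (some x) := by
    rw [hg₀, Function.update_idem, ← h, Function.update_eq_self]
  have hy : g₀ (j, y) = none := by simp [hg₀]
  have hcard : (outputs g j).card = (outputs g₀ j).card + 1 := by
    rw [hg, outputs_update_self, Finset.card_insert_of_notMem (by simp [mem_outputs, hy])]
  have hsplit : ∀ F : Fin 2 → ℝ, ∏ j', F j' = F j * ∏ j' ∈ Finset.univ.erase j, F j' := fun F =>
    (Finset.mul_prod_erase _ _ (Finset.mem_univ j)).symm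
  have hother : ∏ j' ∈ Finset.univ.erase j, √((2 ^ n).descFactorial (outputs g j').card : ℕ) =
      ∏ j' ∈ Finset.univ.erase j, √((2 ^ n).descFactorial (outputs g₀ j').card : ℕ) :=
    Finset.prod_congr rfl fun j' hj' => by
      rw [hg, outputs_update_of_ne _ (Finset.ne_of_mem_erase hj')]
  have hlt := card_outputs_lt hy
  have hsqrt : √((2 : ℝ) ^ n - (outputs g₀ j).card) ≠ 0 :=
    (Real.sqrt_pos.2 (sub_pos.2 (by exact_mod_cast hlt))).ne'
  rw [extNorm, extNorm, hsplit, hsplit, hother, hcard, sqrt_descFactorial_succ hlt, prWeight]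
  push_cast
  field_simp

/-- After `i` queries, the Fourier-basis state `a` for the permutations `π` lives on sets of at
most `i` inputs, and on sets of exactly `i` inputs it is the recording state `b` up to the
normalization `extNorm`. -/
def AgreeOnTop (π : Fin 2 → Equiv.Perm (BitString n)) (i : ℕ)
    (a : (BitString n × BitString m) × Finset (Fin 2 × BitString n) → ℂ)
    (b : (BitString n × BitString m) × RelPair n → ℂ) : Prop :=
  ∀ p S, (i < S.card → a (p, S) = 0) ∧
    (S.card = i → a (p, S) = extNorm (graphOn π S) * b (p, graphOn π S))

lemma agreeOnTop_init (π : Fin 2 → Equiv.Perm (BitString n)) :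
    AgreeOnTop π 0 (initFourier n m) (initRec n m) := by
  refine fun p S => ⟨fun hS => ?_, fun hS => ?_⟩
  · simp [initFourier, Finset.nonempty_iff_ne_empty.1 (Finset.card_pos.1 hS)]
  · obtain rfl := Finset.card_eq_zero.1 hS
    rw [graphOn_empty, extNorm_none]
    simp [initFourier, initRec]

section
variable {π : Fin 2 → Equiv.Perm (BitString n)} {i : ℕ}
  {a : (BitString n × BitString m) × Finset (Fin 2 × BitString n) → ℂ}
  {b : (BitString n × BitString m) × RelPair n → ℂ}

lemma AgreeOnTop.applyLocal (h : AgreeOnTop π i a b)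
    (U : Matrix (BitString n × BitString m) (BitString n × BitString m) ℂ) :
    AgreeOnTop π i (applyLocal U a) (applyLocal U b) := by
  refine fun p S => ⟨fun hS => Finset.sum_eq_zero fun q _ => ?_, fun hS => ?_⟩
  · rw [(h q S).1 hS, mul_zero]
  · simp only [PathRec.applyLocal, Finset.mul_sum]
    refine Finset.sum_congr rfl fun q _ => ?_
    rw [(h q S).2 hS, mul_left_comm]

lemma AgreeOnTop.fourierStep (h : AgreeOnTop π i a b) (j : Fin 2) :
    AgreeOnTop π (i + 1) (fourierStep π j a) (recStep (prWeight n j) j b) := by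
  rintro ⟨y, z⟩ S
  simp only [PathRec.fourierStep]
  by_cases hS : (j, (π j).symm y) ∈ S
  · have hrecorded : graphOn π S (j, y) = some ((π j).symm y) := if_pos hS
    have hcard := Finset.card_erase_add_one hS
    rw [symmDiff_of_ge (Finset.singleton_subset_iff.2 hS), Finset.sdiff_singleton_eq_erase]
    refine ⟨fun hi => (h _ _).1 (by omega), fun hi => ?_⟩
    rw [(h _ _).2 (by omega), graphOn_erase, ← extNorm_mul_prWeight hrecorded]
    simp only [recStep, hrecorded, Option.elim, Complex.ofReal_mul, mul_assoc]
  · have hunrecorded : graphOn π S (j, y) = none := if_neg hS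
    have hdisjoint := Finset.disjoint_singleton_right.2 hS
    have hcard := Finset.card_union_of_disjoint hdisjoint
    rw [Finset.card_singleton] at hcard
    rw [hdisjoint.symmDiff_eq_sup, Finset.sup_eq_union]
    refine ⟨fun hi => (h _ _).1 (by omega), fun hi => ?_⟩
    rw [(h _ _).1 (by omega)]
    simp [recStep, hunrecorded]

end

lemma agreeOnTop_fourierView_recView {t : ℕ} (𝒜 : Adversary n m t)
    (π : Fin 2 → Equiv.Perm (BitString n)) :
    AgreeOnTop π t (𝒜.fourierView π) (𝒜.recView (prWeight n)) :=
  foldl_rel (AgreeOnTop π) t _ _ _ _ (agreeOnTop_init π) fun i _ _ h =>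
    (h.applyLocal (𝒜.unitary i).1).fourierStep (𝒜.query i)

end

/-! ### Sizes and norms of the views -/

section
variable {n m : ℕ}

lemma numPairs_update {g : RelPair n} {j : Fin 2} {y : BitString n} (x : BitString n)
    (h : g (j, y) = none) : numPairs (Function.update g (j, y) (some x)) = numPairs g + 1 := by
  have hy : y ∉ outputs g j := by simp [mem_outputs, h]
  unfold numPairs
  obtain rfl | rfl : j = 0 ∨ j = 1 := by omega
  all_goals
    rw [outputs_update_self, outputs_update_of_ne _ (by decide), Finset.card_insert_of_notMem hy]
    omega

lemma card_outputs_le_numPairs (g : RelPair n) (j : Fin 2) :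
    (outputs g j).card ≤ numPairs g := by
  obtain rfl | rfl : j = 0 ∨ j = 1 := by omega
  · exact Nat.le_add_right _ _
  · exact Nat.le_add_left _ _

lemma SupportedOn.recStep_numPairs {k : ℕ} {ψ : (BitString n × BitString m) × RelPair n → ℂ}
    (hψ : SupportedOn (fun g => numPairs g = k) ψ) (w : RelPair n → BitString n → ℝ)
    (j : Fin 2) : SupportedOn (fun g => numPairs g = k + 1) (recStep w j ψ) := by
  intro p hp
  obtain ⟨g, x, y, hgy, hpg, -, q, hq⟩ := exists_of_recStep_ne_zero hp
  have hg : numPairs g = k := hψ _ hq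
  rw [hpg, numPairs_update x hgy, hg]

lemma supportedOn_initRec_numPairs :
    SupportedOn (fun g => numPairs g = 0) (initRec n m) := by
  intro p hp
  have hnone : p.2 = fun _ => none := by
    by_contra h
    simp [initRec, h] at hp
  simp [hnone, numPairs, outputs]

lemma supportedOn_recView_numPairs {t : ℕ} (𝒜 : Adversary n m t)
    (w : Fin 2 → RelPair n → BitString n → ℝ) :
    SupportedOn (fun g => numPairs g = t) (𝒜.recView w) :=
  foldl_induction (fun i (ψ : (BitString n × BitString m) × RelPair n → ℂ) =>
    SupportedOn (fun g => numPairs g = i) ψ) t _ _ supportedOn_initRec_numPairs fun i _ hψ =>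
      (hψ.applyLocal (𝒜.unitary i).1).recStep_numPairs _ _

lemma l2_recStep_prWeight {k : ℕ} (hk : k < 2 ^ n)
    {ψ : (BitString n × BitString m) × RelPair n → ℂ}
    (hψ : SupportedOn (fun g => numPairs g = k) ψ) (j : Fin 2) :
    l2 (recStep (prWeight n j) j ψ) = l2 ψ := by
  rw [← sq_eq_sq₀ (l2_nonneg _) (l2_nonneg _), l2_sq_recStep, l2_sq]
  refine Finset.sum_congr rfl fun p _ => ?_
  by_cases hp : ψ p = 0
  · simp [hp]
  · have hcard : (outputs p.2 j).card < 2 ^ n :=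
      ((card_outputs_le_numPairs p.2 j).trans_eq (hψ p hp)).trans_lt hk
    rw [sum_prWeight_sq hcard, mul_one]

lemma l2_recView_prWeight {t : ℕ} (ht : t ≤ 2 ^ n) (𝒜 : Adversary n m t) :
    l2 (𝒜.recView (prWeight n)) = 1 := by
  refine (foldl_induction (fun i (ψ : (BitString n × BitString m) × RelPair n → ℂ) =>
    SupportedOn (fun g => numPairs g = i) ψ ∧ l2 ψ = 1) t _ _
      ⟨supportedOn_initRec_numPairs, l2_initRec⟩ ?_).2
  rintro i ψ ⟨hsupp, hnorm⟩
  have hsupp' := hsupp.applyLocal (𝒜.unitary i).1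
  exact ⟨hsupp'.recStep_numPairs _ _, by
    rw [l2_recStep_prWeight (i.2.trans_le ht) hsupp', l2_applyLocal (𝒜.unitary i).2, hnorm]⟩

lemma l2_fourierStep (π : Fin 2 → Equiv.Perm (BitString n)) (j : Fin 2)
    (ψ : (BitString n × BitString m) × Finset (Fin 2 × BitString n) → ℂ) :
    l2 (fourierStep π j ψ) = l2 ψ := by
  rw [← sq_eq_sq₀ (l2_nonneg _) (l2_nonneg _), l2_sq, l2_sq]
  simp only [Fintype.sum_prod_type (α₁ := BitString n × BitString m),
    Fintype.sum_prod_type (α₁ := BitString n) (α₂ := BitString m)]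
  rw [← Equiv.sum_comp (π j)]
  refine Finset.sum_congr rfl fun x _ => Finset.sum_congr rfl fun b _ => ?_
  have hinvolutive : Function.Involutive
      fun S : Finset (Fin 2 × BitString n) => symmDiff S {(j, x)} := fun S =>
    symmDiff_symmDiff_cancel_right _ _
  rw [← Equiv.sum_comp hinvolutive.toPerm]
  simp [fourierStep]

lemma l2_initFourier : l2 (initFourier n m) = 1 := by
  have hinit : initFourier n m = Pi.single (0, ∅) 1 := by
    funext p
    simp only [initFourier, Pi.single_apply, Prod.ext_iff, ite_and]
  rw [← sq_eq_sq₀ (l2_nonneg _) zero_le_one, l2_sq, hinit]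
  simp [Pi.single_apply, apply_ite norm]

lemma l2_fourierView {t : ℕ} (𝒜 : Adversary n m t) (π : Fin 2 → Equiv.Perm (BitString n)) :
    l2 (𝒜.fourierView π) = 1 :=
  foldl_induction
    (fun _ (ψ : (BitString n × BitString m) × Finset (Fin 2 × BitString n) → ℂ) => l2 ψ = 1)
    t _ _ l2_initFourier fun i ψ hψ => by
      rw [l2_fourierStep, l2_applyLocal (𝒜.unitary i).2, hψ]

end

/-! ### Quadratic forms of slices -/

section
variable {ι : Type*} [Fintype ι]

/-- The quadratic form `⟨v, W v⟩` of a matrix. -/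
def quadForm (W : Matrix ι ι ℂ) (v : ι → ℂ) : ℂ := star v ⬝ᵥ W *ᵥ v

@[simp] lemma quadForm_zero (W : Matrix ι ι ℂ) : quadForm W 0 = 0 := by simp [quadForm]

lemma quadForm_ofReal_smul (W : Matrix ι ι ℂ) (r : ℝ) (v : ι → ℂ) :
    quadForm W ((r : ℂ) • v) = ((r ^ 2 : ℝ) : ℂ) * quadForm W v := by
  rw [quadForm, star_smul, Matrix.mulVec_smul, smul_dotProduct, dotProduct_smul, ← quadForm,
    smul_eq_mul, smul_eq_mul, Complex.star_def, Complex.conj_ofReal, ← mul_assoc]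
  push_cast
  ring

variable [DecidableEq ι]

lemma quadForm_one (v : ι → ℂ) : quadForm 1 v = ((∑ p, ‖v p‖ ^ 2 : ℝ) : ℂ) := by
  rw [quadForm, Matrix.one_mulVec, ofReal_sum_norm_sq]

lemma norm_quadForm_le {W : Matrix ι ι ℂ} (hW : W ∈ Matrix.unitaryGroup ι ℂ) (v : ι → ℂ) :
    ‖quadForm W v‖ ≤ ∑ p, ‖v p‖ ^ 2 := by
  have hl2 : l2 (W *ᵥ v) = l2 v := by
    rw [← sq_eq_sq₀ (l2_nonneg _) (l2_nonneg _), l2_sq, l2_sq, sum_norm_sq_mulVec hW]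
  calc ‖quadForm W v‖ ≤ l2 v * l2 (W *ᵥ v) := norm_sum_star_mul_le v (W *ᵥ v)
    _ = ∑ p, ‖v p‖ ^ 2 := by rw [hl2, ← sq, l2_sq]

end

section
variable {n m : ℕ}

lemma trace_mul_reducedState_eq_sum_quadForm {E : Type} [Fintype E]
    (W : Matrix (BitString n × BitString m) (BitString n × BitString m) ℂ)
    (ψ : (BitString n × BitString m) × E → ℂ) :
    (W * reducedState ψ).trace = ∑ e, quadForm W fun p => ψ (p, e) := by
  rw [trace_mul_reducedState, Fintype.sum_prod_type_right]
  rfl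

lemma trace_reducedState {E : Type} [Fintype E] (ψ : (BitString n × BitString m) × E → ℂ) :
    (reducedState ψ).trace = ((l2 ψ ^ 2 : ℝ) : ℂ) := by
  rw [← one_mul (reducedState ψ), trace_mul_reducedState_eq_sum_quadForm, l2_sq,
    Fintype.sum_prod_type_right, Complex.ofReal_sum]
  exact Finset.sum_congr rfl fun e _ => quadForm_one _

open Classical in
lemma collisionWeight_eq_sum_filter (ψ : (BitString n × BitString m) × RelPair n → ℂ) :
    collisionWeight ψ = ∑ g with ¬BlockInj g, ∑ p, ‖ψ (p, g)‖ ^ 2 := by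
  rw [collisionWeight, Fintype.sum_prod_type_right, Finset.sum_filter]
  refine Finset.sum_congr rfl fun g _ => ?_
  by_cases hg : BlockInj g <;> simp [hg]

lemma sum_quadForm_fourierView_of_card_eq {t : ℕ} (𝒜 : Adversary n m t)
    (W : Matrix (BitString n × BitString m) (BitString n × BitString m) ℂ)
    (π : Fin 2 → Equiv.Perm (BitString n)) :
    ∑ S with S.card = t, quadForm W (fun p => 𝒜.fourierView π (p, S)) =
      ∑ g with Extends π g, ((extNorm g ^ 2 : ℝ) : ℂ) *
        quadForm W fun p => 𝒜.recView (prWeight n) (p, g) := by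
  rw [← sum_graphOn, Finset.sum_filter]
  refine Finset.sum_congr rfl fun S _ => ?_
  split_ifs with hS
  · rw [← quadForm_ofReal_smul]
    congr 1
    funext p
    exact (agreeOnTop_fourierView_recView 𝒜 π p S).2 hS
  · have hzero : (fun p => 𝒜.recView (prWeight n) (p, graphOn π S)) = 0 := by
      funext p
      by_contra hp
      exact hS ((numPairs_graphOn π S).symm.trans (supportedOn_recView_numPairs 𝒜 _ _ hp))
    rw [hzero, quadForm_zero, mul_zero]

open Classical in
lemma sum_trace_fourierView_sub_trace_recView {t : ℕ} (𝒜 : Adversary n m t)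
    (W : Matrix (BitString n × BitString m) (BitString n × BitString m) ℂ) :
    ∑ π : Fin 2 → Equiv.Perm (BitString n), (W * reducedState (𝒜.fourierView π)).trace -
        Fintype.card (Fin 2 → Equiv.Perm (BitString n)) *
          (W * reducedState (𝒜.recView (prWeight n))).trace =
      ∑ π : Fin 2 → Equiv.Perm (BitString n), ∑ S with ¬S.card = t,
          quadForm W (fun p => 𝒜.fourierView π (p, S)) -
        Fintype.card (Fin 2 → Equiv.Perm (BitString n)) * ∑ g with ¬BlockInj g,
          quadForm W fun p => 𝒜.recView (prWeight n) (p, g) := by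
  simp only [trace_mul_reducedState_eq_sum_quadForm]
  rw [← Finset.sum_filter_add_sum_filter_not Finset.univ BlockInj, mul_add,
    ← sum_sum_extends_extNorm_sq_mul]
  simp only [← sum_quadForm_fourierView_of_card_eq, ← Finset.sum_filter_add_sum_filter_not
    (Finset.univ : Finset (Finset (Fin 2 × BitString n))) fun S => S.card = t,
    Finset.sum_add_distrib]
  ring

-- The identity for traces at `W = 1`, where both traces are 1.
lemma sum_norm_sq_fourierView_of_card_ne {t : ℕ} (ht : t ≤ 2 ^ n) (𝒜 : Adversary n m t) :
    ∑ π : Fin 2 → Equiv.Perm (BitString n), ∑ S with ¬S.card = t,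
        ∑ p, ‖𝒜.fourierView π (p, S)‖ ^ 2 =
      Fintype.card (Fin 2 → Equiv.Perm (BitString n)) *
        collisionWeight (𝒜.recView (prWeight n)) := by
  have htrace := sum_trace_fourierView_sub_trace_recView 𝒜 1
  simp only [one_mul, trace_reducedState, l2_fourierView, l2_recView_prWeight ht, one_pow,
    Complex.ofReal_one, Finset.sum_const, Finset.card_univ, nsmul_eq_mul, sub_self,
    quadForm_one] at htrace
  rw [collisionWeight_eq_sum_filter, ← Complex.ofReal_inj]
  push_cast at htrace ⊢
  exact sub_eq_zero.1 htrace.symm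

lemma norm_sum_trace_fourierView_sub_le {t : ℕ} (ht : t ≤ 2 ^ n) (𝒜 : Adversary n m t)
    {W : Matrix (BitString n × BitString m) (BitString n × BitString m) ℂ}
    (hW : W ∈ Matrix.unitaryGroup (BitString n × BitString m) ℂ) :
    ‖∑ π : Fin 2 → Equiv.Perm (BitString n), (W * reducedState (𝒜.fourierView π)).trace -
        Fintype.card (Fin 2 → Equiv.Perm (BitString n)) *
          (W * reducedState (𝒜.recView (prWeight n))).trace‖ ≤
      Fintype.card (Fin 2 → Equiv.Perm (BitString n)) *
        (2 * collisionWeight (𝒜.recView (prWeight n))) := by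
  rw [sum_trace_fourierView_sub_trace_recView, mul_left_comm, two_mul]
  refine (norm_sub_le _ _).trans (add_le_add ?_ ?_)
  · rw [← sum_norm_sq_fourierView_of_card_ne ht 𝒜]
    exact (norm_sum_le _ _).trans (Finset.sum_le_sum fun π _ => (norm_sum_le _ _).trans
      (Finset.sum_le_sum fun S _ => norm_quadForm_le hW _))
  · rw [norm_mul, Complex.norm_natCast, collisionWeight_eq_sum_filter]
    exact mul_le_mul_of_nonneg_left ((norm_sum_le _ _).trans
      (Finset.sum_le_sum fun g _ => norm_quadForm_le hW _)) (Nat.cast_nonneg _)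

/-! ### Averaging over random signed permutations and phases -/

lemma sum_signs_reducedState {t : ℕ} (𝒜 : Adversary n m t)
    (π : Fin 2 → Equiv.Perm (BitString n)) :
    ∑ f : Fin 2 × BitString n → ℤˣ,
        reducedState (𝒜.unitaryView fun j => signedPerm (π j) fun x => f (j, x)) =
      (Fintype.card (Fin 2 × BitString n → ℤˣ) : ℂ) • reducedState (𝒜.fourierView π) := by
  ext p q
  have horthogonal : ∀ S T,
      ∑ f, signChar S f * 𝒜.fourierView π (p, S) *
          (signChar T f * star (𝒜.fourierView π (q, T))) =
        𝒜.fourierView π (p, S) * star (𝒜.fourierView π (q, T)) *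
          if S = T then (Fintype.card (Fin 2 × BitString n → ℤˣ) : ℂ) else 0 := by
    intro S T
    rw [← sum_signChar_mul_signChar, Finset.mul_sum]
    exact Finset.sum_congr rfl fun f _ => by ring
  rw [Matrix.sum_apply, Matrix.smul_apply]
  simp only [unitaryView_signedPerm, evalSigns, reducedState, Matrix.of_apply,
    Finset.univ_unique, Finset.sum_singleton, star_sum, star_mul', star_signChar,
    Finset.sum_mul_sum, smul_eq_mul]
  rw [Finset.sum_comm, Finset.mul_sum]
  refine Finset.sum_congr rfl fun S _ => ?_
  rw [Finset.sum_comm]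
  simp only [horthogonal, mul_ite, mul_zero, Finset.sum_ite_eq, Finset.mem_univ, if_true]
  ring

/-- The randomness of signed permutations after a randomly phased Hadamard transform. -/
abbrev Seed (n : ℕ) : Type :=
  (BitString n → ZMod 3) × (Fin 2 → Equiv.Perm (BitString n)) × (Fin 2 × BitString n → ℤˣ)

/-- The pair of unitaries sampled by a seed. -/
def sample (s : Seed n) (j : Fin 2) : Matrix.unitaryGroup (BitString n) ℂ :=
  signedPerm (s.2.1 j) (fun x => s.2.2 (j, x)) * phasedHadamard s.1

lemma unitaryView_sample_mul {t : ℕ} (𝒜 : Adversary n m t) (s : Seed n)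
    (U : Fin 2 → Matrix.unitaryGroup (BitString n) ℂ) :
    𝒜.unitaryView (fun j => sample s j * U j) =
      (𝒜.twist fun j => phasedHadamard s.1 * U j).unitaryView
        fun j => signedPerm (s.2.1 j) fun x => s.2.2 (j, x) := by
  simp only [unitaryView_twist, sample, mul_assoc]

lemma sum_seed_trace {t : ℕ} (𝒜 : Adversary n m t)
    (W : Matrix (BitString n × BitString m) (BitString n × BitString m) ℂ)
    (U : Fin 2 → Matrix.unitaryGroup (BitString n) ℂ) :
    ∑ s : Seed n, (W * reducedState (𝒜.unitaryView fun j => sample s j * U j)).trace =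
      Fintype.card (Fin 2 × BitString n → ℤˣ) * ∑ k, ∑ π : Fin 2 → Equiv.Perm (BitString n),
        (W * reducedState ((𝒜.twist fun j => phasedHadamard k * U j).fourierView π)).trace := by
  simp only [Fintype.sum_prod_type (α₁ := BitString n → ZMod 3),
    Fintype.sum_prod_type (α₁ := Fin 2 → Equiv.Perm (BitString n)), Finset.mul_sum,
    unitaryView_sample_mul]
  refine Finset.sum_congr rfl fun k _ => Finset.sum_congr rfl fun π _ => ?_
  rw [← Matrix.trace_sum, ← Finset.mul_sum, sum_signs_reducedState, Matrix.mul_smul,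
    Matrix.trace_smul, smul_eq_mul]

lemma sum_collisionWeight_recView_twist_le {t : ℕ} (ht : t ≤ 2 ^ n) (𝒜 : Adversary n m t)
    (U : Fin 2 → Matrix.unitaryGroup (BitString n) ℂ) :
    ∑ k : BitString n → ZMod 3,
        collisionWeight ((𝒜.twist fun j => phasedHadamard k * U j).recView (prWeight n)) ≤
      Fintype.card (BitString n → ZMod 3) * (2 * t ^ 2 / 2 ^ n) := by
  have hview : ∀ k, (𝒜.twist fun j => phasedHadamard k * U j).recView (prWeight n) =
      applyRec (onRec fun _ => (phasedHadamard k).1) ((𝒜.twist U).recView (prWeight n)) := by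
    intro k
    rw [recView_twist, recView_twist, ← applyRec_mul, onRec_mul]
    rfl
  have hle := sum_collisionWeight_twirl_le (supportedOn_recView_numPairs (𝒜.twist U) (prWeight n))
  rw [l2_recView_prWeight ht, one_pow, mul_one] at hle
  simpa only [hview] using hle

lemma norm_sum_seed_trace_sub_le {t : ℕ} (ht : t ≤ 2 ^ n) (𝒜 : Adversary n m t)
    {W : Matrix (BitString n × BitString m) (BitString n × BitString m) ℂ}
    (hW : W ∈ Matrix.unitaryGroup (BitString n × BitString m) ℂ)
    (U : Fin 2 → Matrix.unitaryGroup (BitString n) ℂ) :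
    ‖∑ s : Seed n, (W * reducedState (𝒜.unitaryView fun j => sample s j * U j)).trace -
        Fintype.card (Seed n) * (W * reducedState (𝒜.recView (prWeight n))).trace‖ ≤
      Fintype.card (Seed n) * (4 * t ^ 2 / 2 ^ n) := by
  set numPerms := Fintype.card (Fin 2 → Equiv.Perm (BitString n))
  set numSigns := Fintype.card (Fin 2 × BitString n → ℤˣ)
  set numPhases := Fintype.card (BitString n → ZMod 3) with hnumPhases
  set z := (W * reducedState (𝒜.recView (prWeight n))).trace with hz
  set 𝒜' : (BitString n → ZMod 3) → Adversary n m t :=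
    fun k => 𝒜.twist fun j => phasedHadamard k * U j
  have hcard : Fintype.card (Seed n) = numPhases * (numPerms * numSigns) := by
    rw [Fintype.card_prod, Fintype.card_prod]
  have hsplit : ∑ s : Seed n,
        (W * reducedState (𝒜.unitaryView fun j => sample s j * U j)).trace -
        Fintype.card (Seed n) * z =
      numSigns * ∑ k, (∑ π : Fin 2 → Equiv.Perm (BitString n),
        (W * reducedState ((𝒜' k).fourierView π)).trace - numPerms * z) := by
    rw [sum_seed_trace, hcard, Finset.sum_sub_distrib, Finset.sum_const, Finset.card_univ,
      nsmul_eq_mul, ← hnumPhases]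
    push_cast
    ring
  have hphase : ∀ k, ‖∑ π : Fin 2 → Equiv.Perm (BitString n),
        (W * reducedState ((𝒜' k).fourierView π)).trace - numPerms * z‖ ≤
      numPerms * (2 * collisionWeight ((𝒜' k).recView (prWeight n))) := fun k => by
    rw [hz, ← reducedState_recView_twist 𝒜 fun j => phasedHadamard k * U j]
    exact norm_sum_trace_fourierView_sub_le ht (𝒜' k) hW
  rw [hsplit, norm_mul, Complex.norm_natCast]
  calc numSigns * ‖∑ k, (∑ π : Fin 2 → Equiv.Perm (BitString n),
          (W * reducedState ((𝒜' k).fourierView π)).trace - numPerms * z)‖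
      ≤ numSigns * ∑ k, numPerms * (2 * collisionWeight ((𝒜' k).recView (prWeight n))) := by
        gcongr
        exact (norm_sum_le _ _).trans (Finset.sum_le_sum fun k _ => hphase k)
    _ = numSigns * numPerms * 2 * ∑ k, collisionWeight ((𝒜' k).recView (prWeight n)) := by
        rw [← Finset.mul_sum, ← Finset.mul_sum]
        ring
    _ ≤ numSigns * numPerms * 2 * (numPhases * (2 * t ^ 2 / 2 ^ n)) := by
        gcongr
        exact sum_collisionWeight_recView_twist_le ht 𝒜 U
    _ = Fintype.card (Seed n) * (4 * t ^ 2 / 2 ^ n) := by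
        rw [hcard]
        push_cast
        ring

end

/-! ### Haar-random unitaries -/

open MeasureTheory

lemma continuous_foldl {Z ι : Type*} [TopologicalSpace Z] (t : ℕ)
    (f : Z → (ι → ℂ) → Fin t → (ι → ℂ)) (a : ι → ℂ)
    (hf : ∀ (i : Fin t) (g : Z → ι → ℂ), Continuous g → Continuous fun z => f z (g z) i) :
    Continuous fun z => Fin.foldl t (f z) a := by
  induction t with
  | zero => simpa only [Fin.foldl_zero] using continuous_const
  | succ t ih =>
    simp only [Fin.foldl_succ_last]
    exact hf (Fin.last t) _ (ih _ fun i g hg => hf i.castSucc g hg)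

instance secondCountableTopology_unitaryGroup {ι : Type} [Fintype ι] [DecidableEq ι] :
    SecondCountableTopology (Matrix.unitaryGroup ι ℂ) :=
  haveI : SecondCountableTopology (Matrix ι ι ℂ) :=
    inferInstanceAs (SecondCountableTopology (ι → ι → ℂ))
  TopologicalSpace.Subtype.secondCountableTopology _

section
variable {n m t : ℕ}

instance isProbabilityMeasure_haar : IsProbabilityMeasure (haar n) :=
  ⟨Measure.haarMeasure_self
    (K₀ := (⊤ : TopologicalSpace.PositiveCompacts (Matrix.unitaryGroup (BitString n) ℂ)))⟩

instance isMulLeftInvariant_haar : (haar n).IsMulLeftInvariant :=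
  inferInstanceAs (Measure.haarMeasure _).IsMulLeftInvariant

lemma integrable_haar_prod_of_continuous {f : Matrix.unitaryGroup (BitString n) ℂ ×
    Matrix.unitaryGroup (BitString n) ℂ → ℂ} (hf : Continuous f) :
    Integrable f ((haar n).prod (haar n)) :=
  hf.integrable_of_hasCompactSupport (HasCompactSupport.of_compactSpace f)

lemma continuous_unitaryOracle (j : Fin 2) (p q : BitString n × Unit) :
    Continuous fun C : Matrix.unitaryGroup (BitString n) ℂ × Matrix.unitaryGroup (BitString n) ℂ =>
      unitaryOracle C.1 C.2 j p q := by
  have hentry : Continuous fun U : Matrix.unitaryGroup (BitString n) ℂ => U.1 p.1 q.1 :=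
    continuous_subtype_val.matrix_elem p.1 q.1
  simp only [unitaryOracle, Matrix.of_apply]
  split_ifs
  · exact hentry.comp continuous_fst
  · exact hentry.comp continuous_snd

lemma continuous_unitaryView (𝒜 : Adversary n m t) :
    Continuous fun C : Matrix.unitaryGroup (BitString n) ℂ × Matrix.unitaryGroup (BitString n) ℂ =>
      𝒜.unitaryView ![C.1, C.2] := by
  refine continuous_foldl t
    (fun (C : Matrix.unitaryGroup (BitString n) ℂ × Matrix.unitaryGroup (BitString n) ℂ)
      (ψ : (BitString n × BitString m) × Unit → ℂ) i =>
        applyOracle (unitaryOracle C.1 C.2 (𝒜.query i)) (applyLocal (𝒜.unitary i).1 ψ))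
    _ fun i g hg => continuous_pi fun p => ?_
  simp only [applyOracle, applyLocal]
  exact continuous_finsetSum _ fun q _ => (continuous_unitaryOracle _ _ _).mul
    (continuous_finsetSum _ fun r _ => continuous_const.mul ((continuous_apply _).comp hg))

lemma continuous_reducedState_unitaryView (𝒜 : Adversary n m t) (i j : BitString n × BitString m) :
    Continuous fun C : Matrix.unitaryGroup (BitString n) ℂ × Matrix.unitaryGroup (BitString n) ℂ =>
      reducedState (𝒜.unitaryView ![C.1, C.2]) i j := by
  have hview (q) := (continuous_apply q).comp (continuous_unitaryView 𝒜)
  simp only [reducedState, Matrix.of_apply]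
  exact continuous_finsetSum _ fun e _ => (hview (i, e)).mul (hview (j, e)).star

lemma continuous_trace_mul_reducedState_unitaryView (𝒜 : Adversary n m t)
    (W : Matrix (BitString n × BitString m) (BitString n × BitString m) ℂ) :
    Continuous fun C : Matrix.unitaryGroup (BitString n) ℂ × Matrix.unitaryGroup (BitString n) ℂ =>
      (W * reducedState (𝒜.unitaryView ![C.1, C.2])).trace := by
  simp only [Matrix.trace, Matrix.diag, Matrix.mul_apply]
  exact continuous_finsetSum _ fun i _ => continuous_finsetSum _ fun j _ =>
    continuous_const.mul (continuous_reducedState_unitaryView 𝒜 j i)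

lemma isHermitian_haarState (𝒜 : Adversary n m t) : 𝒜.haarState.IsHermitian := by
  ext i j
  simp only [Matrix.conjTranspose_apply, Adversary.haarState, Matrix.of_apply]
  rw [Complex.star_def, ← integral_conj]
  refine integral_congr_ae (Filter.Eventually.of_forall fun C => ?_)
  exact congrFun (congrFun (isHermitian_reducedState
    (𝒜.view (unitaryOracle C.1 C.2) fun _ => 1)) i) j

lemma trace_mul_haarState (𝒜 : Adversary n m t)
    (W : Matrix (BitString n × BitString m) (BitString n × BitString m) ℂ) :
    (W * 𝒜.haarState).trace =
      ∫ C, (W * reducedState (𝒜.unitaryView ![C.1, C.2])).trace ∂((haar n).prod (haar n)) := by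
  simp only [Matrix.trace, Matrix.diag, Matrix.mul_apply]
  have hint (i j) : Integrable (fun C : Matrix.unitaryGroup (BitString n) ℂ ×
      Matrix.unitaryGroup (BitString n) ℂ =>
        W i j * reducedState (𝒜.unitaryView ![C.1, C.2]) j i) ((haar n).prod (haar n)) :=
    (integrable_haar_prod_of_continuous (continuous_reducedState_unitaryView 𝒜 j i)).const_mul _
  rw [integral_finsetSum _ fun i _ => integrable_finsetSum _ fun j _ => hint i j]
  refine Finset.sum_congr rfl fun i _ => ?_
  rw [integral_finsetSum _ fun j _ => hint i j]
  refine Finset.sum_congr rfl fun j _ => ?_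
  rw [integral_const_mul]
  rfl

lemma integral_sum_translates {κ : Type*} [Fintype κ] {F : Matrix.unitaryGroup (BitString n) ℂ ×
      Matrix.unitaryGroup (BitString n) ℂ → ℂ} (hF : Continuous F)
    (D : κ → Matrix.unitaryGroup (BitString n) ℂ × Matrix.unitaryGroup (BitString n) ℂ) :
    ∫ C, ∑ s, F (D s * C) ∂((haar n).prod (haar n)) =
      Fintype.card κ * ∫ C, F C ∂((haar n).prod (haar n)) := by
  have htranslate (s) : Continuous fun C => F (D s * C) := hF.comp (continuous_const_mul (D s))
  rw [integral_finsetSum _ fun s _ => integrable_haar_prod_of_continuous (htranslate s)]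
  simp only [integral_mul_left_eq_self, Finset.sum_const, Finset.card_univ, nsmul_eq_mul]

lemma norm_trace_haar_sub_pr_le_of_le (ht : t ≤ 2 ^ n) (𝒜 : Adversary n m t)
    {W : Matrix (BitString n × BitString m) (BitString n × BitString m) ℂ}
    (hW : W ∈ Matrix.unitaryGroup (BitString n × BitString m) ℂ) :
    ‖(W * 𝒜.haarState).trace - (W * reducedState (𝒜.recView (prWeight n))).trace‖ ≤
      4 * t ^ 2 / 2 ^ n := by
  set μ := (haar n).prod (haar n)
  set z := (W * reducedState (𝒜.recView (prWeight n))).trace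
  set K := Fintype.card (Seed n)
  let F (C : Matrix.unitaryGroup (BitString n) ℂ × Matrix.unitaryGroup (BitString n) ℂ) : ℂ :=
    (W * reducedState (𝒜.unitaryView ![C.1, C.2])).trace
  have hF : Continuous F := continuous_trace_mul_reducedState_unitaryView 𝒜 W
  have htranslate (s : Seed n) : Continuous fun C => F ((sample s 0, sample s 1) * C) :=
    hF.comp (continuous_const_mul _)
  have haverage : (K : ℂ) * (∫ C, F C ∂μ - z) =
      ∫ C, (∑ s : Seed n, F ((sample s 0, sample s 1) * C) - K * z) ∂μ := by
    rw [integral_sub (integrable_haar_prod_of_continuous (continuous_finsetSum _ fun s _ =>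
        htranslate s)) (integrable_const _),
      integral_sum_translates hF, integral_const, probReal_univ, one_smul, mul_sub]
  have hbound (C) : ‖∑ s : Seed n, F ((sample s 0, sample s 1) * C) - K * z‖ ≤
      K * (4 * t ^ 2 / 2 ^ n) :=
    norm_sum_seed_trace_sub_le ht 𝒜 hW ![C.1, C.2]
  have hle := norm_integral_le_of_norm_le_const (μ := μ) (Filter.Eventually.of_forall hbound)
  rw [← haverage, probReal_univ, mul_one, norm_mul, Complex.norm_natCast] at hle
  rw [trace_mul_haarState]
  exact le_of_mul_le_mul_left hle (Nat.cast_pos.2 Fintype.card_pos)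

lemma l2_unitaryView (𝒜 : Adversary n m t)
    (C : Fin 2 → Matrix.unitaryGroup (BitString n) ℂ) : l2 (𝒜.unitaryView C) = 1 := by
  refine foldl_induction (fun _ ψ => l2 ψ = 1) t _ _ ?_ fun i ψ hψ => ?_
  · rw [← sq_eq_sq₀ (l2_nonneg _) zero_le_one, l2_sq, Fintype.sum_prod_type]
    simp [apply_ite norm]
  · rw [applyOracle_unitaryOracle, l2_applyLocal (onA_mem_unitaryGroup (C _).2),
      l2_applyLocal (𝒜.unitary i).2, hψ]

lemma norm_trace_mul_haarState_le (𝒜 : Adversary n m t)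
    {W : Matrix (BitString n × BitString m) (BitString n × BitString m) ℂ}
    (hW : W ∈ Matrix.unitaryGroup (BitString n × BitString m) ℂ) :
    ‖(W * 𝒜.haarState).trace‖ ≤ 1 := by
  have hbound (C : Matrix.unitaryGroup (BitString n) ℂ × Matrix.unitaryGroup (BitString n) ℂ) :
      ‖(W * reducedState (𝒜.unitaryView ![C.1, C.2])).trace‖ ≤ 1 := by
    simpa only [l2_unitaryView, one_pow] using
      norm_trace_mul_reducedState_le hW (𝒜.unitaryView ![C.1, C.2])
  simpa only [trace_mul_haarState, probReal_univ, mul_one] using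
    norm_integral_le_of_norm_le_const (μ := (haar n).prod (haar n))
      (Filter.Eventually.of_forall hbound)

lemma norm_trace_haar_sub_pr_le (𝒜 : Adversary n m t)
    {W : Matrix (BitString n × BitString m) (BitString n × BitString m) ℂ}
    (hW : W ∈ Matrix.unitaryGroup (BitString n × BitString m) ℂ) :
    ‖(W * 𝒜.haarState).trace - (W * reducedState (𝒜.recView (prWeight n))).trace‖ ≤
      4 * ((t : ℝ) ^ 2 / Real.sqrt (2 ^ n)) := by
  rcases le_total t (2 ^ n) with ht | ht
  · refine (norm_trace_haar_sub_pr_le_of_le ht 𝒜 hW).trans ?_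
    rw [mul_div_assoc]
    gcongr
    rw [Real.sqrt_le_left (by positivity)]
    exact le_self_pow₀ (one_le_pow₀ (by norm_num)) two_ne_zero
  · have hview : l2 (𝒜.recView (prWeight n)) ≤ 1 := l2_recView_le 𝒜 sum_prWeight_sq_le
    have hpr : ‖(W * reducedState (𝒜.recView (prWeight n))).trace‖ ≤ 1 :=
      (norm_trace_mul_reducedState_le hW _).trans (pow_le_one₀ (l2_nonneg _) hview)
    calc _ ≤ 1 + 1 := (norm_sub_le _ _).trans (add_le_add (norm_trace_mul_haarState_le 𝒜 hW) hpr)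
      _ ≤ 4 * ((t : ℝ) ^ 2 / Real.sqrt (2 ^ n)) := by
        linarith [one_le_two_mul_sq_div_sqrt (n := n) (t := t) (by omega)]

lemma traceDist_cf_pr_le {ℓ lam : ℕ} (hlam : lam ≤ n) (hℓ : 1 ≤ ℓ) (𝒜 : Adversary n m t) :
    traceDist (𝒜.recState (cfprOracle n ℓ lam)) (𝒜.recState (prOracle n)) ≤
      4 * cfError ℓ lam t := by
  rw [recState_prOracle, recState_cfprOracle]
  exact traceDist_le (isHermitian_reducedState _) (isHermitian_reducedState _) fun W hW =>
    norm_trace_cf_sub_pr_le hlam hℓ 𝒜 hW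

lemma traceDist_cf_haar_le {ℓ lam : ℕ} (hlam : lam ≤ n) (hℓ : 1 ≤ ℓ) (𝒜 : Adversary n m t) :
    traceDist (𝒜.recState (cfprOracle n ℓ lam)) 𝒜.haarState ≤ 6 * cfError ℓ lam t := by
  rw [recState_cfprOracle]
  refine traceDist_le (isHermitian_reducedState _) (isHermitian_haarState 𝒜) fun W hW => ?_
  set trPr := (W * reducedState (𝒜.recView (prWeight n))).trace
  calc _ ≤ ‖(W * reducedState (𝒜.recView (cfWeight n ℓ lam))).trace - trPr‖ +
        ‖trPr - (W * 𝒜.haarState).trace‖ := norm_sub_le_norm_sub_add_norm_sub _ _ _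
    _ ≤ 2 * (4 * cfError ℓ lam t) + 4 * ((t : ℝ) ^ 2 / Real.sqrt (2 ^ n)) := by
        rw [norm_sub_rev trPr]
        exact add_le_add (norm_trace_cf_sub_pr_le hlam hℓ 𝒜 hW) (norm_trace_haar_sub_pr_le 𝒜 hW)
    _ ≤ 2 * (6 * cfError ℓ lam t) := by linarith [sq_div_sqrt_le_cfError t hlam hℓ]

end

end

end PathRec

theorem mainTheorem8 :
    (∃ C : ℝ, 0 < C ∧ ∀ n lam ℓ m t : ℕ, lam ≤ n → 1 ≤ ℓ →
      ∀ 𝒜 : PathRec.Adversary n m t,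
        PathRec.traceDist (𝒜.recState (PathRec.cfprOracle n ℓ lam))
            (𝒜.recState (PathRec.prOracle n)) ≤
          C * (Real.sqrt ℓ * (t : ℝ) ^ (ℓ + 1) / (2 : ℝ) ^ ((lam : ℝ) / 2))) ∧
    (∃ C : ℝ, 0 < C ∧ ∀ n lam ℓ m t : ℕ, lam ≤ n → 1 ≤ ℓ →
      ∀ 𝒜 : PathRec.Adversary n m t,
        PathRec.traceDist (𝒜.recState (PathRec.cfprOracle n ℓ lam)) 𝒜.haarState ≤
          C * (Real.sqrt ℓ * (t : ℝ) ^ (ℓ + 1) / (2 : ℝ) ^ ((lam : ℝ) / 2)) +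
            4 * (t : ℝ) * ((t : ℝ) - 1) / ((2 : ℝ) ^ n + 1)) ∧
    (∀ (n : ℕ) (j : Fin 2), PathRec.sharedPrOracle n j = PathRec.cfprOracle n 1 n j) ∧
    (∃ C : ℝ, 0 < C ∧ ∀ n m t : ℕ, ∀ 𝒜 : PathRec.Adversary n m t,
      PathRec.traceDist (𝒜.recState (PathRec.sharedPrOracle n)) 𝒜.haarState ≤
        C * ((t : ℝ) ^ 2 / Real.sqrt ((2 : ℝ) ^ n))) := by
  have hshared (n : ℕ) : PathRec.sharedPrOracle n = PathRec.cfprOracle n 1 n :=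
    funext (PathRec.sharedPrOracle_eq_cfprOracle n)
  refine ⟨⟨4, by norm_num, fun n lam ℓ m t hlam hℓ => PathRec.traceDist_cf_pr_le hlam hℓ⟩,
    ⟨6, by norm_num, fun n lam ℓ m t hlam hℓ 𝒜 => ?_⟩, PathRec.sharedPrOracle_eq_cfprOracle,
    ⟨6, by norm_num, fun n m t 𝒜 => ?_⟩⟩
  · have hbirthday : 0 ≤ (t : ℝ) * (t - 1) := by
      exact_mod_cast (by nlinarith [sq_nonneg (t : ℤ)] : (0 : ℤ) ≤ t * (t - 1))
    refine (PathRec.traceDist_cf_haar_le hlam hℓ 𝒜).trans (le_add_of_nonneg_right ?_)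
    rw [mul_assoc]
    positivity
  · rw [hshared]
    refine (PathRec.traceDist_cf_haar_le le_rfl le_rfl 𝒜).trans_eq ?_
    rw [PathRec.cfError, PathRec.two_rpow_half]
    norm_num
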